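/- Let $(N,h)$ be a nonorientable $n$-dimensional Riemannian orbifold (effective, given by an orbifold atlas with charts $\tilde U\to\tilde U/G_U\cong U\subset N$) and let $f:M\to N$ be an $S^1$-orbifold bundle with structure group $\mathrm{Aff}(S^1)=S^1\rtimes\{\pm1\}$: over each chart it is $(\tilde U\times S^1)/G_U\cong f^{-1}(U)$, with $G_U$ acting on $\tilde U\times S^1$ over its action on $\tilde U$ by affine maps of the fibres, and the changes of charts lift to fibrewise affine maps. $M$ carries the induced orbifold structure. A $\mathrm{pin}^-$ structure on $N$ is a two-sheeted covering $P_{\mathrm{Pin}^-}N\to P_{\mathrm O}N$ of the orthonormal frame bundle with a continuous right $\mathrm{Pin}^-(n)$-action, on which $-1$ acts without fixed points, compatible with the double covering $\mathrm{Pin}^-(n)\to\mathrm O(n)$, where unit vectors satisfy $v^2=-1$ in $\mathrm{Pin}^-(n)$. A spin structure on $M$, equipped with an orientation and a Riemannian metric, is a two-sheeted covering of the bundle $P_{\mathrm{SO}}M$ of positively oriented orthonormal frames compatible in the same way with $\mathrm{Spin}(n+1)\to\mathrm{SO}(n+1)$. It extends uniquely to a topological spin structure, i.e. a compatible two-sheeted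 covering of the bundle $P_{\mathrm{GL}_+}M$ of all positively oriented linear frames. The spin structure is projectable if every local $S^1$-action, i.e. the rotation of the second factor of $\tilde U\times S^1$ for each chart, lifts to the (pulled back) topological spin structure. Call a positively oriented frame $(v_0,v_1,\dots,v_n)$ of $M$ adapted if $v_0$ is vertical and $(df(v_1),\dots,df(v_n))$ is an orthonormal frame of $N$. The embedding $\mathrm O(n)\hookrightarrow\mathrm{SO}(n+1)$, $A\mapsto\begin{pmatrix}\det A&0\\0&A\end{pmatrix}$, acts on adapted frames and lifts to an embedding $\mathrm{Pin}^-(n)\hookrightarrow\mathrm{Spin}(n+1)$. A spin structure on $M$ and a $\mathrm{pin}^-$ structure on $N$ are said to induce each other if, $\mathrm{Pin}^-(n)$-equivariantly, the topological spin structure restricted to the adapted frames is the pullback of $P_{\mathrm{Pin}^-}N\to P_{\mathrm O}N$ under $(v_0,\dots,v_n)\mapsto(df(v_1),\dots,df(v_n))$. 1. For every orientation and every Riemannian metric on $M$, every projectable spin structure on $M$ induces a $\mathrm{pin}^-$ structure on $N$. 2. If $M$ is orientable, then for every orientation and every Riemannian metric on $M$, every $\mathrm{pin}^-$ structure on $N$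 induces a spin structure on $M$. -/

import Mathlib

open scoped Topology ContDiff

universe u

namespace OrbPin

noncomputable section

/-! ### Charts, transitions and frames -/

/-- A family of charts `map i : dom i → X` on open subsets of the model vector space `E`. -/
structure ChartFamily (E : Type) [NormedAddCommGroup E] [NormedSpace ℝ E]
    (X : Type u) [TopologicalSpace X] where
  ι : Type u
  dom : ι → Set E
  map : ι → E → X
  isOpen_dom : ∀ i, IsOpen (dom i)

namespace ChartFamily

variable {E : Type} [NormedAddCommGroup E] [NormedSpace ℝ E]
variable {X : Type u} [TopologicalSpace X]

/-- A transition from chart `i` to chart `j`: a smooth diffeomorphism from an open subset of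
`dom i` onto an open subset of `dom j` that commutes with the charts. -/
structure IsTransition (K : ChartFamily E X) (i j : K.ι) (κ : OpenPartialHomeomorph E E) :
    Prop where
  source_subset : κ.source ⊆ K.dom i
  target_subset : κ.target ⊆ K.dom j
  contDiffOn : ContDiffOn ℝ ∞ κ κ.source
  contDiffOn_symm : ContDiffOn ℝ ∞ κ.symm κ.target
  map_eq : ∀ x ∈ κ.source, K.map j (κ x) = K.map i x

/-- A frame in a chart: an index `i`, a point `x` of `dom i` and a linear isomorphism
`A : E → T_x(dom i) = E`. -/
abbrev ChartFrame (K : ChartFamily E X) : Type u :=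
  Σ i : K.ι, {q : E × (E →L[ℝ] E) // q.1 ∈ K.dom i ∧ Function.Bijective q.2}

/-- Two chart frames are identified when the differential of a transition carries the first
one to the second one. -/
def FrameRel (K : ChartFamily E X) (c d : K.ChartFrame) : Prop :=
  ∃ κ : OpenPartialHomeomorph E E, K.IsTransition c.1 d.1 κ ∧ c.2.1.1 ∈ κ.source ∧
    κ c.2.1.1 = d.2.1.1 ∧ d.2.1.2 = (fderiv ℝ κ c.2.1.1).comp c.2.1.2

theorem IsTransition.refl (K : ChartFamily E X) (i : K.ι) :
    K.IsTransition i i (OpenPartialHomeomorph.ofSet (K.dom i) (K.isOpen_dom i)) where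
  source_subset := subset_rfl
  target_subset := subset_rfl
  contDiffOn := contDiffOn_id
  contDiffOn_symm := contDiffOn_id
  map_eq := fun _ _ => rfl

theorem IsTransition.symm {K : ChartFamily E X} {i j : K.ι} {κ : OpenPartialHomeomorph E E}
    (h : K.IsTransition i j κ) : K.IsTransition j i κ.symm where
  source_subset := h.target_subset
  target_subset := h.source_subset
  contDiffOn := h.contDiffOn_symm
  contDiffOn_symm := h.contDiffOn
  map_eq := fun y hy => by
    have := h.map_eq (κ.symm y) (κ.map_target hy)
    rw [κ.right_inv hy] at this
    exact this.symm

theorem IsTransition.trans {K : ChartFamily E X} {i j k : K.ι}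
    {κ μ : OpenPartialHomeomorph E E} (h : K.IsTransition i j κ) (h' : K.IsTransition j k μ) :
    K.IsTransition i k (κ.trans μ) where
  source_subset := fun x hx => h.source_subset (by
    rw [OpenPartialHomeomorph.trans_source] at hx; exact hx.1)
  target_subset := fun x hx => h'.target_subset (by
    rw [OpenPartialHomeomorph.trans_target] at hx; exact hx.1)
  contDiffOn := by
    rw [OpenPartialHomeomorph.trans_source]
    exact h'.contDiffOn.comp (h.contDiffOn.mono fun _ hx => hx.1) fun _ hx => hx.2
  contDiffOn_symm := by
    rw [OpenPartialHomeomorph.trans_target]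
    exact h.contDiffOn_symm.comp (h'.contDiffOn_symm.mono fun _ hx => hx.1) fun _ hx => hx.2
  map_eq := fun x hx => by
    rw [OpenPartialHomeomorph.trans_source] at hx
    exact (h'.map_eq _ hx.2).trans (h.map_eq _ hx.1)

theorem IsTransition.differentiableAt {K : ChartFamily E X} {i j : K.ι}
    {κ : OpenPartialHomeomorph E E} (h : K.IsTransition i j κ) {x : E} (hx : x ∈ κ.source) :
    DifferentiableAt ℝ κ x :=
  (h.contDiffOn.differentiableOn (by simp)).differentiableAt (κ.open_source.mem_nhds hx)

theorem IsTransition.fderiv_symm_comp {K : ChartFamily E X} {i j : K.ι}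
    {κ : OpenPartialHomeomorph E E} (h : K.IsTransition i j κ) {x : E} (hx : x ∈ κ.source) :
    (fderiv ℝ κ.symm (κ x)).comp (fderiv ℝ κ x) = ContinuousLinearMap.id ℝ E := by
  rw [← fderiv_comp x (h.symm.differentiableAt (κ.map_source hx)) (h.differentiableAt hx)]
  have : (κ.symm ∘ κ) =ᶠ[𝓝 x] id := by
    filter_upwards [κ.open_source.mem_nhds hx] with y hy using κ.left_inv hy
  rw [this.fderiv_eq, fderiv_id]

theorem frameRel_equivalence (K : ChartFamily E X) : Equivalence K.FrameRel where
  refl := by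
    rintro ⟨i, ⟨x, A⟩, hx, hA⟩
    refine ⟨_, IsTransition.refl K i, hx, rfl, ?_⟩
    have : (fderiv ℝ (id : E → E) x).comp A = A := by rw [fderiv_id]; rfl
    exact this.symm
  symm := by
    rintro ⟨i, ⟨x, A⟩, hx, hA⟩ ⟨j, ⟨y, B⟩, hy, hB⟩ ⟨κ, hκ, hs, hxy, hd⟩
    dsimp only at hκ hs hxy hd
    subst hxy hd
    refine ⟨κ.symm, hκ.symm, κ.map_source hs, κ.left_inv hs, ?_⟩
    dsimp only
    rw [← ContinuousLinearMap.comp_assoc, hκ.fderiv_symm_comp hs]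
    rfl
  trans := by
    rintro ⟨i, ⟨x, A⟩, hx, hA⟩ ⟨j, ⟨y, B⟩, hy, hB⟩ ⟨k, ⟨z, C⟩, hz, hC⟩
      ⟨κ, hκ, hs, hxy, hd⟩ ⟨μ, hμ, hs', hyz, hd'⟩
    dsimp only at hκ hs hxy hd hμ hs' hyz hd'
    subst hxy hd hyz hd'
    refine ⟨κ.trans μ, hκ.trans hμ, ?_, rfl, ?_⟩
    · rw [OpenPartialHomeomorph.trans_source]
      exact ⟨hs, hs'⟩
    · dsimp only
      rw [OpenPartialHomeomorph.coe_trans,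
        fderiv_comp x (hμ.differentiableAt hs') (hκ.differentiableAt hs)]
      rfl

instance frameSetoid (K : ChartFamily E X) : Setoid K.ChartFrame :=
  ⟨K.FrameRel, K.frameRel_equivalence⟩

/-- The bundle of all linear frames, glued from the frames in the charts, with the quotient
topology. -/
abbrev Frame (K : ChartFamily E X) : Type u := Quotient K.frameSetoid

/-- The right action of `GL(E)` on frames. -/
def Frame.act {K : ChartFamily E X} (L : E ≃L[ℝ] E) : K.Frame → K.Frame :=
  Quotient.map
    (fun c => ⟨c.1, (c.2.1.1, c.2.1.2.comp (L : E →L[ℝ] E)), c.2.2.1,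
      c.2.2.2.comp L.bijective⟩)
    (by
      rintro c d ⟨κ, hκ, hs, hxy, hd⟩
      exact ⟨κ, hκ, hs, hxy, by dsimp only; rw [hd]; rfl⟩)

/-- An orientation: a locally constant choice of which frames are positive (`sgn = 1`) and
which are negative (`sgn = -1`), compatible with the action of `GL(E)`. -/
structure Orientation (K : ChartFamily E X) where
  sgn : K.Frame → ℤˣ
  locallyConstant : IsLocallyConstant sgn
  sgn_act_of_pos : ∀ (L : E ≃L[ℝ] E) (e : K.Frame),
    0 < LinearMap.det (L : E →ₗ[ℝ] E) → sgn (Frame.act L e) = sgn e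
  sgn_act_of_neg : ∀ (L : E ≃L[ℝ] E) (e : K.Frame),
    LinearMap.det (L : E →ₗ[ℝ] E) < 0 → sgn (Frame.act L e) = -sgn e

/-- A (continuous) Riemannian metric, given in the charts and invariant under transitions. -/
structure Metric (K : ChartFamily E X) where
  inner : K.ι → E → E →L[ℝ] E →L[ℝ] ℝ
  continuousOn : ∀ i, ContinuousOn (inner i) (K.dom i)
  symm : ∀ i, ∀ x ∈ K.dom i, ∀ v w, inner i x v w = inner i x w v
  pos : ∀ i, ∀ x ∈ K.dom i, ∀ v, v ≠ 0 → 0 < inner i x v v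
  invariant : ∀ i j κ, K.IsTransition i j κ → ∀ x ∈ κ.source, ∀ v w,
    inner j (κ x) (fderiv ℝ κ x v) (fderiv ℝ κ x w) = inner i x v w

/-- The orthonormal frames of a metric, where the model space `E` carries the scalar product
with square norm `-Q`. -/
def orthonormalFrames (K : ChartFamily E X) (Q : QuadraticForm ℝ E) (g : K.Metric) :
    Set K.Frame :=
  {e | ∃ c : K.ChartFrame, ⟦c⟧ = e ∧
    ∀ v, g.inner c.1 c.2.1.1 (c.2.1.2 v) (c.2.1.2 v) = -Q v}

/-- The positively oriented linear frames. -/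
def positiveFrames (K : ChartFamily E X) (o : K.Orientation) : Set K.Frame :=
  {e | o.sgn e = 1}

end ChartFamily

/-! ### Effective orbifolds -/

/-- An `n`-dimensional smooth effective orbifold structure on `X`: an orbifold atlas, consisting
of connected open sets `dom i ⊆ ℝⁿ`, finite groups `grp i` that act smoothly and effectively on
them, and maps `map i` that induce homeomorphisms from `dom i / grp i` onto open subsets
covering `X`; any two charts are related by smooth transitions. -/
structure Orbifold (n : ℕ) (X : Type u) [TopologicalSpace X] extends
    ChartFamily (EuclideanSpace ℝ (Fin n)) X where
  dom_connected : ∀ i, IsConnected (dom i)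
  grp : ι → Type u
  [grpGroup : ∀ i, Group (grp i)]
  [grpFinite : ∀ i, Finite (grp i)]
  act : ∀ i, grp i → EuclideanSpace ℝ (Fin n) → EuclideanSpace ℝ (Fin n)
  act_mem : ∀ i g, ∀ x ∈ dom i, act i g x ∈ dom i
  act_one : ∀ i, ∀ x ∈ dom i, act i 1 x = x
  act_mul : ∀ i g h, ∀ x ∈ dom i, act i (g * h) x = act i g (act i h x)
  act_smooth : ∀ i g, ContDiffOn ℝ ∞ (act i g) (dom i)
  act_effective : ∀ i g, (∀ x ∈ dom i, act i g x = x) → g = 1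
  continuousOn_map : ∀ i, ContinuousOn (map i) (dom i)
  isOpen_image : ∀ i, ∀ W ⊆ dom i, IsOpen W → IsOpen (map i '' W)
  map_eq_iff : ∀ i, ∀ x ∈ dom i, ∀ y ∈ dom i, map i x = map i y ↔ ∃ g, act i g x = y
  covers : ∀ p : X, ∃ i, ∃ x ∈ dom i, map i x = p
  compatible : ∀ i j, ∀ x ∈ dom i, ∀ y ∈ dom j, map i x = map j y →
    ∃ κ, toChartFamily.IsTransition i j κ ∧ x ∈ κ.source ∧ κ x = y

attribute [instance] Orbifold.grpGroup Orbifold.grpFinite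

/-! ### Circle orbifold bundles -/

/-- An `S¹`-orbifold bundle `proj : Y → X` over the orbifold `N`, with structure group
`Aff(S¹) = S¹ ⋊ {±1}` and `S¹ = ℝ/ℤ`. Over the chart `dom i` the bundle is trivialized: the
group `grp i` acts on `dom i × S¹` by `g (x, s) = (g x, eps g • s + rot g x)` with
`eps g = ±1`, and `triv i` induces a homeomorphism from `(dom i × S¹) / grp i` onto the preimage
of the image of `dom i`. The transitions of `N` lift to fibrewise affine maps. -/
structure CircleBundle {n : ℕ} {X : Type u} [TopologicalSpace X] (N : Orbifold n X)
    (Y : Type u) [TopologicalSpace Y] where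
  proj : Y → X
  triv : N.ι → EuclideanSpace ℝ (Fin n) → UnitAddCircle → Y
  proj_triv : ∀ i, ∀ x ∈ N.dom i, ∀ s, proj (triv i x s) = N.map i x
  triv_surj : ∀ i y, ∀ x ∈ N.dom i, proj y = N.map i x →
    ∃ x' ∈ N.dom i, ∃ s, triv i x' s = y
  continuousOn_triv : ∀ i,
    ContinuousOn (fun z : EuclideanSpace ℝ (Fin n) × UnitAddCircle => triv i z.1 z.2)
      (N.dom i ×ˢ Set.univ)
  isOpen_image : ∀ i, ∀ W : Set (EuclideanSpace ℝ (Fin n) × UnitAddCircle),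
    W ⊆ N.dom i ×ˢ Set.univ → IsOpen W → IsOpen ((fun z => triv i z.1 z.2) '' W)
  eps : ∀ i, N.grp i → ℤˣ
  rot : ∀ i, N.grp i → EuclideanSpace ℝ (Fin n) → UnitAddCircle
  eps_mul : ∀ i g h, eps i (g * h) = eps i g * eps i h
  rot_mul : ∀ i g h, ∀ x ∈ N.dom i,
    rot i (g * h) x = eps i g • rot i h x + rot i g (N.act i h x)
  rot_smooth : ∀ i g, ∀ x ∈ N.dom i, ∃ α : EuclideanSpace ℝ (Fin n) → ℝ,
    ContDiffAt ℝ ∞ α x ∧ ∀ᶠ x' in 𝓝 x, rot i g x' = (α x' : UnitAddCircle)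
  triv_eq_iff : ∀ i, ∀ x ∈ N.dom i, ∀ x' ∈ N.dom i, ∀ s s',
    triv i x s = triv i x' s' ↔ ∃ g, N.act i g x = x' ∧ eps i g • s + rot i g x = s'
  affine : ∀ i j κ, N.IsTransition i j κ → ∀ x ∈ κ.source,
    ∃ (ε : ℤˣ) (α : EuclideanSpace ℝ (Fin n) → ℝ), ContDiffAt ℝ ∞ α x ∧
      ∀ᶠ x' in 𝓝 x, ∀ s, triv j (κ x') (ε • s + (α x' : UnitAddCircle)) = triv i x' s

/-- The charts of the total space: `(x, t) ↦ triv i x (t mod ℤ)` on `dom i × ℝ`. Restricted to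
`dom i × I` for short intervals `I` and to small invariant open sets these are the usual finite
quotient charts of the orbifold `Y`. -/
def CircleBundle.total {n : ℕ} {X : Type u} [TopologicalSpace X] {N : Orbifold n X}
    {Y : Type u} [TopologicalSpace Y] (B : CircleBundle N Y) :
    ChartFamily (EuclideanSpace ℝ (Fin n) × ℝ) Y where
  ι := N.ι
  dom i := N.dom i ×ˢ Set.univ
  map i z := B.triv i z.1 (z.2 : UnitAddCircle)
  isOpen_dom i := (N.isOpen_dom i).prod isOpen_univ

/-! ### Pin and spin groups -/

/-- The canonical topology of a real Clifford algebra. -/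
instance cliffordTopology {V : Type} [AddCommGroup V] [Module ℝ V] (Q : QuadraticForm ℝ V) :
    TopologicalSpace (CliffordAlgebra Q) :=
  moduleTopology ℝ (CliffordAlgebra Q)

section TwistedAdjoint

open CliffordAlgebra

variable {V : Type} [AddCommGroup V] [Module ℝ V] (Q : QuadraticForm ℝ V)

/-- The projection of the Clifford algebra onto its vectors. -/
def vectorPart : CliffordAlgebra Q →ₗ[ℝ] V :=
  ExteriorAlgebra.ιInv ∘ₗ (equivExterior Q).toLinearMap

theorem vectorPart_ι (v : V) : vectorPart Q (ι Q v) = v := by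
  simp only [vectorPart, LinearMap.comp_apply, LinearEquiv.coe_coe, equivExterior,
    changeFormEquiv_apply, changeForm_ι]
  exact ExteriorAlgebra.ι_leftInverse v

/-- The twisted adjoint action `v ↦ x̂ v x⁻¹` of the pin group on vectors, where `x̂` is the
grade involution. -/
def twistedAdjointFun (x : pinGroup Q) : V →ₗ[ℝ] V :=
  vectorPart Q ∘ₗ LinearMap.mulLeft ℝ (involute (x : CliffordAlgebra Q)) ∘ₗ
    LinearMap.mulRight ℝ (star (x : CliffordAlgebra Q)) ∘ₗ ι Q

theorem ι_twistedAdjointFun (x : pinGroup Q) (v : V) :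
    ι Q (twistedAdjointFun Q x v) =
      involute (x : CliffordAlgebra Q) * ι Q v * star (x : CliffordAlgebra Q) := by
  obtain ⟨w, hw⟩ := pinGroup.involute_act_ι_mem_range_ι (Q := Q) (x := pinGroup.toUnits x)
    x.2 v
  have hw' : ι Q w = involute (x : CliffordAlgebra Q) * ι Q v * star (x : CliffordAlgebra Q) :=
    hw
  have : twistedAdjointFun Q x v = vectorPart Q (ι Q w) := by
    rw [hw']
    simp [twistedAdjointFun, mul_assoc]
  rw [this, vectorPart_ι, hw']

theorem ι_injective : Function.Injective (ι Q) :=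
  Function.LeftInverse.injective (vectorPart_ι Q)

/-- The twisted adjoint representation as a homomorphism. -/
def twistedAdjointHom : pinGroup Q →* Module.End ℝ V where
  toFun := twistedAdjointFun Q
  map_one' := by
    ext v
    apply ι_injective Q
    rw [ι_twistedAdjointFun]
    simp
  map_mul' x y := by
    ext v
    apply ι_injective Q
    rw [ι_twistedAdjointFun, Module.End.mul_apply, ι_twistedAdjointFun, ι_twistedAdjointFun]
    simp [mul_assoc]

end TwistedAdjoint

/-- The twisted adjoint representation `Pin(V, Q) → GL(V)` on a finite-dimensional space. For
negative definite `Q` its image is `O(V)` and its kernel is `{±1}`. -/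
def pinRho {V : Type} [NormedAddCommGroup V] [NormedSpace ℝ V] [FiniteDimensional ℝ V]
    (Q : QuadraticForm ℝ V) : pinGroup Q →* (V ≃L[ℝ] V) where
  toFun x := (LinearMap.GeneralLinearGroup.toLinearEquiv
    ((twistedAdjointHom Q).toHomUnits x)).toContinuousLinearEquiv
  map_one' := by
    ext v
    simp only [map_one]
    rfl
  map_mul' x y := by
    ext v
    simp only [map_mul]
    rfl

/-- The adjoint representation `Spin(V, Q) → GL(V)`. -/
def spinRho {V : Type} [NormedAddCommGroup V] [NormedSpace ℝ V] [FiniteDimensional ℝ V]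
    (Q : QuadraticForm ℝ V) : spinGroup Q →* (V ≃L[ℝ] V) :=
  (pinRho Q).comp (Submonoid.inclusion (fun _ hx => spinGroup.mem_pin hx))

/-- The quadratic form `v ↦ -‖v‖²` on `ℝⁿ`. -/
def negSq (n : ℕ) : QuadraticForm ℝ (EuclideanSpace ℝ (Fin n)) :=
  -LinearMap.BilinMap.toQuadraticMap (innerₗ (EuclideanSpace ℝ (Fin n)))

theorem negSq_apply (n : ℕ) (v : EuclideanSpace ℝ (Fin n)) : negSq n v = -‖v‖ ^ 2 := by
  simp [negSq]

/-- The quadratic form `(v, t) ↦ -‖v‖² - t²` on `ℝⁿ⁺¹ = ℝⁿ × ℝ`. -/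
abbrev negSqProd (n : ℕ) : QuadraticForm ℝ (EuclideanSpace ℝ (Fin n) × ℝ) :=
  CliffordAlgebra.EquivEven.Q' (negSq n)

/-- `Pin⁻(n)`: unit vectors `v` satisfy `v² = -1`. -/
abbrev PinMinus (n : ℕ) : Type := pinGroup (negSq n)

/-- `Spin(n+1)`. -/
abbrev SpinSucc (n : ℕ) : Type := spinGroup (negSqProd n)

section PinToSpin

open CliffordAlgebra CliffordAlgebra.EquivEven

theorem toEven_mem_lipschitz (n : ℕ) (x : (CliffordAlgebra (negSq n))ˣ)
    (hx : x ∈ lipschitzGroup (negSq n)) :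
    Units.map ((CliffordAlgebra.even (negSqProd n)).val.comp (toEven (negSq n)) :
      CliffordAlgebra (negSq n) →* CliffordAlgebra (negSqProd n)) x ∈
        lipschitzGroup (negSqProd n) := by
  have key : ∀ y ∈ ((↑) ⁻¹' Set.range (ι (negSq n)) : Set (CliffordAlgebra (negSq n))ˣ),
      Units.map ((CliffordAlgebra.even (negSqProd n)).val.comp (toEven (negSq n)) :
      CliffordAlgebra (negSq n) →* CliffordAlgebra (negSqProd n)) y ∈
        lipschitzGroup (negSqProd n) := by
    rintro y ⟨v, hv⟩
    set z := Units.map ((CliffordAlgebra.even (negSqProd n)).val.comp (toEven (negSq n)) :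
      CliffordAlgebra (negSq n) →* CliffordAlgebra (negSqProd n)) y with hz
    let e : (CliffordAlgebra (negSqProd n))ˣ :=
      ⟨e0 (negSq n), -e0 (negSq n), by rw [mul_neg, e0_mul_e0, neg_neg],
        by rw [neg_mul, e0_mul_e0, neg_neg]⟩
    have he : e ∈ lipschitzGroup (negSqProd n) := Subgroup.subset_closure ⟨(0, 1), rfl⟩
    have hzv : (z : CliffordAlgebra (negSqProd n)) =
        e0 (negSq n) * EquivEven.v (negSq n) v := by
      rw [hz, Units.coe_map]
      change ((toEven (negSq n) (y : CliffordAlgebra (negSq n)) :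
        CliffordAlgebra.even (negSqProd n)) : CliffordAlgebra (negSqProd n)) = _
      rw [← hv, toEven_ι]
    have hw : e⁻¹ * z ∈ lipschitzGroup (negSqProd n) := by
      refine Subgroup.subset_closure ⟨(v, 0), ?_⟩
      rw [Units.val_mul, hzv]
      change ι (negSqProd n) (v, 0) = -e0 (negSq n) * _
      rw [← mul_assoc, neg_mul, e0_mul_e0, neg_neg, one_mul]
      rfl
    have := mul_mem he hw
    rwa [mul_inv_cancel_left] at this
  have : lipschitzGroup (negSq n) ≤ (lipschitzGroup (negSqProd n)).comap (Units.map _) :=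
    (Subgroup.closure_le _).2 key
  exact this hx

theorem star_toEven (n : ℕ) (x : CliffordAlgebra (negSq n)) :
    star ((toEven (negSq n) x : CliffordAlgebra.even (negSqProd n)) :
      CliffordAlgebra (negSqProd n)) = (toEven (negSq n) (star x) :
        CliffordAlgebra.even (negSqProd n)) := by
  rw [star_def, star_def, coe_toEven_reverse_involute,
    involute_eq_of_mem_even (toEven (negSq n) x).2]

/-- The lift `Pin⁻(n) → Spin(n+1)` of the embedding `A ↦ (A, det A)` of `O(n)` into
`SO(n+1)`. It is the restriction of the algebra homomorphism with `v ↦ e₀ v`, where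
`e₀ = (0, 1)`. -/
def pinToSpin (n : ℕ) : PinMinus n →* SpinSucc n where
  toFun x := ⟨(toEven (negSq n) (x : CliffordAlgebra (negSq n)) :
      CliffordAlgebra.even (negSqProd n)), by
    refine spinGroup.mem_iff.2 ⟨pinGroup.mem_iff.2 ⟨?_, ?_⟩, Subtype.coe_prop _⟩
    · exact ⟨_, toEven_mem_lipschitz n (pinGroup.toUnits x)
        (pinGroup.units_mem_lipschitzGroup (x := pinGroup.toUnits x) x.2), rfl⟩
    · rw [Unitary.mem_iff, star_toEven]
      constructor
      · rw [← Subalgebra.coe_mul, ← map_mul, pinGroup.star_mul_self_of_mem x.2, map_one]; rfl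
      · rw [← Subalgebra.coe_mul, ← map_mul, pinGroup.mul_star_self_of_mem x.2, map_one]; rfl⟩
  map_one' := by
    ext
    simp
  map_mul' x y := by
    ext
    simp

end PinToSpin

/-! ### Spin and pin structures -/

/-- A two-sheeted covering `P → S` of a space `S` of frames, with a continuous right action of
`Γ` on `P` that covers the action of `Γ` on frames through `ρ : Γ → GL(E)`, and on which the
kernel of `ρ` acts freely. Pulled back to a chart `U` of an orbifold this is a principal
`Γ`-bundle over `U` that doubly covers the bundle of the frames of `U` in `S`. -/
structure FrameCover {E : Type} [NormedAddCommGroup E] [NormedSpace ℝ E]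
    {X : Type u} [TopologicalSpace X] (K : ChartFamily E X)
    {Γ : Type} [Monoid Γ] [TopologicalSpace Γ] (ρ : Γ →* (E ≃L[ℝ] E)) (S : Set K.Frame) where
  P : Type u
  [top : TopologicalSpace P]
  act : P → Γ → P
  proj : P → S
  act_one : ∀ p, act p 1 = p
  act_mul : ∀ p a b, act p (a * b) = act (act p a) b
  continuous_act : Continuous fun z : P × Γ => act z.1 z.2
  isCoveringMap : IsCoveringMap proj
  two_sheeted : ∀ e : S, Nat.card (proj ⁻¹' {e}) = 2
  proj_act : ∀ p a, (proj (act p a) : K.Frame) = ChartFamily.Frame.act (ρ a) (proj p)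
  free_ker : ∀ p a, ρ a = 1 → act p a = p → a = 1

attribute [instance] FrameCover.top

section Structures

variable {n : ℕ} {X : Type u} [TopologicalSpace X] {N : Orbifold n X}
variable {Y : Type u} [TopologicalSpace Y]

/-- A `pin⁻` structure on the Riemannian orbifold `(N, h)`: a double covering of the orthonormal
frame bundle compatible with `Pin⁻(n) → O(n)`. -/
abbrev PinMinusStructure (N : Orbifold n X) (h : N.Metric) : Type (u + 1) :=
  FrameCover N.toChartFamily (pinRho (negSq n)) (N.orthonormalFrames (negSq n) h)

/-- A spin structure on the total space of an `S¹`-orbifold bundle with orientation `o` and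
Riemannian metric `g`: a double covering of the bundle of positively oriented orthonormal
frames compatible with `Spin(n+1) → SO(n+1)`. -/
abbrev SpinStructure (B : CircleBundle N Y) (o : B.total.Orientation) (g : B.total.Metric) :
    Type (u + 1) :=
  FrameCover B.total (spinRho (negSqProd n))
    (B.total.positiveFrames o ∩ B.total.orthonormalFrames (negSqProd n) g)

/-- A topological spin structure on the oriented total space: a double covering of the bundle
of all positively oriented linear frames. The compatible action of the double cover of `GL₊` is
recorded through its maximal compact subgroup `Spin(n+1)`, onto which it retracts; the action
of the whole double cover is recovered from it by lifting paths. -/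
abbrev TopSpinStructure (B : CircleBundle N Y) (o : B.total.Orientation) : Type (u + 1) :=
  FrameCover B.total (spinRho (negSqProd n)) (B.total.positiveFrames o)

/-- The spin structure `σ` is the restriction of the topological spin structure `τ` to the
orthonormal frames. -/
def TopSpinStructure.Extends {B : CircleBundle N Y} {o : B.total.Orientation}
    {g : B.total.Metric} (τ : TopSpinStructure B o) (σ : SpinStructure B o g) : Prop :=
  ∃ Ψ : σ.P → τ.P, Continuous Ψ ∧
    (∀ p, (τ.proj (Ψ p) : B.total.Frame) = σ.proj p) ∧
    ∀ p a, Ψ (σ.act p a) = τ.act (Ψ p) a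

/-- The pullback of a topological spin structure to the covering `dom i × S¹` of the part of the
total space over a chart. Its points are `((x, s, A), p)` with `A` a frame of `dom i × S¹` at
`(x, s)` and `p` a point over the class of this frame. -/
def ChartPullback {B : CircleBundle N Y} {o : B.total.Orientation} (τ : TopSpinStructure B o)
    (i : N.ι) : Type u :=
  {z : (EuclideanSpace ℝ (Fin n) × UnitAddCircle ×
      ((EuclideanSpace ℝ (Fin n) × ℝ) →L[ℝ] (EuclideanSpace ℝ (Fin n) × ℝ))) × τ.P //
    ∃ (t : ℝ) (hx : (z.1.1, t) ∈ B.total.dom i) (hA : Function.Bijective z.1.2.2),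
      (t : UnitAddCircle) = z.1.2.1 ∧
      (τ.proj z.2 : B.total.Frame) = ⟦⟨i, ((z.1.1, t), z.1.2.2), hx, hA⟩⟧}

instance {B : CircleBundle N Y} {o : B.total.Orientation} (τ : TopSpinStructure B o)
    (i : N.ι) : TopologicalSpace (ChartPullback τ i) :=
  inferInstanceAs (TopologicalSpace (Subtype _))

/-- The local `S¹`-action over the chart `i`, that is, the action of `S¹` on `dom i × S¹` by
rotation of the second factor, lifts to the topological spin structure. (Such a lift commutes
with the action of the spin group by uniqueness of lifts of paths.) -/
def TopSpinStructure.LiftsLocalAction {B : CircleBundle N Y} {o : B.total.Orientation}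
    (τ : TopSpinStructure B o) (i : N.ι) : Prop :=
  ∃ κ : UnitAddCircle → ChartPullback τ i → ChartPullback τ i,
    (Continuous fun z : UnitAddCircle × ChartPullback τ i => κ z.1 z.2) ∧
    (∀ z, κ 0 z = z) ∧
    (∀ r s z, κ (r + s) z = κ r (κ s z)) ∧
    ∀ r z, (κ r z).1.1 = (z.1.1.1, r + z.1.1.2.1, z.1.1.2.2)

/-- A spin structure is projectable if every local `S¹`-action lifts to the corresponding
topological spin structure. -/
def IsProjectable {B : CircleBundle N Y} {o : B.total.Orientation} {g : B.total.Metric}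
    (σ : SpinStructure B o g) : Prop :=
  ∃ τ : TopSpinStructure B o, TopSpinStructure.Extends τ σ ∧
    ∀ i, TopSpinStructure.LiftsLocalAction τ i

/-- The frame `e` of the total space is adapted and lies over the frame `d` of `N`: its last
vector is vertical and its first `n` vectors project to `d`. -/
def FrameOver (B : CircleBundle N Y) (e : B.total.Frame) (d : N.Frame) : Prop :=
  ∃ (i : N.ι) (x : EuclideanSpace ℝ (Fin n)) (t : ℝ)
    (A : (EuclideanSpace ℝ (Fin n) × ℝ) →L[ℝ] (EuclideanSpace ℝ (Fin n) × ℝ))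
    (D : EuclideanSpace ℝ (Fin n) →L[ℝ] EuclideanSpace ℝ (Fin n))
    (hx : x ∈ N.dom i) (hA : Function.Bijective A) (hD : Function.Bijective D),
    e = ⟦⟨i, ((x, t), A), ⟨hx, Set.mem_univ t⟩, hA⟩⟧ ∧ d = ⟦⟨i, (x, D), hx, hD⟩⟧ ∧
    (∀ v, (A (v, 0)).1 = D v) ∧ (A (0, 1)).1 = 0

/-- The spin structure `σ` on the total space and the `pin⁻` structure `π` on `N` induce each
other: over the adapted frames of the total space that lie over orthonormal frames of `N`, the
topological spin structure that extends `σ` is the pullback of `π`, equivariantly with respect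
to `Pin⁻(n) → Spin(n+1)`. -/
def AreInduced {h : N.Metric} {B : CircleBundle N Y} {o : B.total.Orientation}
    {g : B.total.Metric} (σ : SpinStructure B o g) (π : PinMinusStructure N h) : Prop :=
  ∃ τ : TopSpinStructure B o, TopSpinStructure.Extends τ σ ∧
    ∃ Φ : {p : τ.P // ∃ d ∈ N.orthonormalFrames (negSq n) h, FrameOver B (τ.proj p) d} → π.P,
      Continuous Φ ∧
      (∀ p, FrameOver B (τ.proj p.1) (π.proj (Φ p))) ∧
      ∀ p q a, q.1 = τ.act p.1 (pinToSpin n a) → Φ q = π.act (Φ p) a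

end Structures

end

end OrbPin

open OrbPin

/-!
A frame of the total space whose last vector is vertical lies over a frame of the base
(`FrameOver`). Every transition of the total space covers a transition of the base
(`exists_base_transition`), so the base frame is well defined (`FrameOver.unique`) and depends
continuously on the vertical frame (`continuous_baseFrame`). In both directions a covering of one
frame bundle is constructed from a covering of the other, and it is a covering because locally it is
the pullback along a continuous map (`isEvenlyCovered_of_pullback`).

*From a projectable spin structure to a pin structure.* The points of the pin structure over a
frame `d` of the base are the path components of the part of the topological spin structure that
lies over the vertical frames over `d` (`Descent`). In a chart these frames are given by a fibre
coordinate in `ℝ/ℤ` and a vertical line map over `d`. The lifted circle action, being an action of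
`ℝ/ℤ` and not only of `ℝ`, rotates the fibre coordinate to zero without ambiguity, and the linear
path to a block matrix contracts the rest. Hence every point is transported to a point over a local
section `d ↦ s d` in a way that is constant on components and is the identity over the section
(`exists_transport`, `exists_local_section`), so that over the domain of `s` the components form
the pullback of the spin structure along `s`.

At singular points of the orbifold this needs the chart coordinates of frames to be locally unique.
The group of a chart acts freely on frames, since a smooth action of a finite group that fixes a
point and has the identity as its derivative there is trivial (`Orbifold.eq_one_of_fderiv_eq_id`),
and every smooth lift of the identity has the `1`-jets of group elements. So frames of a chart embed
locally (`Orbifold.exists_injOn_mkFrame`), and a vertical frame over a given base frame has unique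
coordinates up to integer translations of the fibre coordinate (`CircleBundle.eq_of_mkFrame_eq`).
Its coordinates in a prescribed chart exist because transitions of the base lift to the total space
(`CircleBundle.exists_total_transition`).

*From a pin structure to a spin structure.* The topological spin structure is an associated covering
(`Cover`): its points are the triples of a frame `e`, an element `u` of `Spin(n + 1)` that takes `e`
to a vertical frame, and a point of the pin structure over the frame of the base below, modulo
`Pin⁻(n)`. Since the frame of the base is only linear, it is first made orthonormal by the polar
decomposition (`polarFrame`), which commutes with `O(n)`. For a fixed `u` the third entry determines
the class and is determined by it: two elements `u` for one frame differ by an element of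
`Spin(n + 1)` that preserves the last axis, and such elements come from `Pin⁻(n)`
(`exists_pinToSpin_eq`). An element `u` can be chosen continuously near every frame
(`exists_spin_vertical`), as a product of two unit vectors that rotates one vector to another. The
embedding of `Pin⁻(n)` contains `-1` only if `n ≠ 0`, and nonorientability of the base excludes
`n = 0` (`dim_ne_zero`).
-/

namespace OrbPin
open Set

/-! ### Coverings that are locally pulled back from a covering -/

/-- A map that over an open set `U` is the pullback of a covering along a continuous map `f` is
evenly covered over `U`, with the fibre of that covering. -/
theorem isEvenlyCovered_of_pullback {P S Q D : Type*} [TopologicalSpace P] [TopologicalSpace S]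
    [TopologicalSpace Q] [TopologicalSpace D] {c : P → S} {q : Q → D} (hq : IsCoveringMap q)
    (hc : Continuous c) {s : S} {U : Set S} (hU : IsOpen U) (hs : s ∈ U) (f : U → D)
    (F : c ⁻¹' U → Q) (G : {z : U × Q // q z.2 = f z.1} → P)
    (hf : Continuous f) (hF : Continuous F) (hG : Continuous G)
    (hqF : ∀ p, q (F p) = f ⟨c p, p.2⟩) (hcG : ∀ z, c (G z) = z.1.1)
    (hFG : ∀ z, F ⟨G z, by rw [mem_preimage, hcG]; exact z.1.1.2⟩ = z.1.2)
    (hGF : ∀ p : c ⁻¹' U, G ⟨(⟨c p, p.2⟩, F p), hqF p⟩ = p) :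
    IsEvenlyCovered c s (q ⁻¹' {f ⟨s, hs⟩}) := by
  obtain ⟨hI, V, hV, hVo, -, H, hH⟩ := hq (f ⟨s, hs⟩)
  have hU' : IsOpen (Subtype.val '' (f ⁻¹' V) : Set S) :=
    hU.isOpenMap_subtype_val _ (hVo.preimage hf)
  have hHs : ∀ z, q (H.symm z) = z.1 := fun z => by
    rw [← hH, H.apply_symm_apply]
  have hmem : ∀ p : c ⁻¹' (Subtype.val '' (f ⁻¹' V)), c p ∈ U := by
    rintro ⟨p, y, -, h⟩
    exact (h : y.1 = c p) ▸ y.2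
  have hmem' : ∀ p : c ⁻¹' (Subtype.val '' (f ⁻¹' V)), f ⟨c p, hmem p⟩ ∈ V := by
    rintro ⟨p, hp⟩
    obtain ⟨y, hy, h⟩ := hp
    have : y = (⟨c p, hmem ⟨p, y, hy, h⟩⟩ : U) := Subtype.ext h
    rwa [this] at hy
  have hmemU : ∀ y : (Subtype.val '' (f ⁻¹' V) : Set S), ∃ h : y.1 ∈ U, f ⟨y, h⟩ ∈ V := by
    rintro ⟨_, y, hy, rfl⟩
    exact ⟨y.2, hy⟩
  refine ⟨hI, Subtype.val '' (f ⁻¹' V), ⟨⟨s, hs⟩, hV, rfl⟩, hU', hU'.preimage hc,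
    { toFun := fun p => (⟨c p, p.2⟩,
        (H ⟨F ⟨p, hmem p⟩, by rw [mem_preimage, hqF]; exact hmem' p⟩).2)
      invFun := fun z => ⟨G ⟨(⟨z.1, (hmemU z.1).1⟩, H.symm (⟨f ⟨z.1, (hmemU z.1).1⟩,
        (hmemU z.1).2⟩, z.2)), by rw [hHs]⟩, by
          rw [mem_preimage, hcG]; exact z.1.2⟩
      left_inv := ?_
      right_inv := ?_
      continuous_toFun := ?_
      continuous_invFun := ?_ }, fun _ => rfl⟩
  · intro p
    apply Subtype.ext
    refine Eq.trans ?_ (hGF ⟨p, hmem p⟩)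
    dsimp only
    congr 1
    apply Subtype.ext
    refine Prod.ext rfl ?_
    dsimp only
    refine congrArg Subtype.val (a₂ := ⟨F ⟨p, hmem p⟩, by rw [mem_preimage, hqF]; exact hmem' p⟩)
      (H.symm_apply_eq.2 ?_)
    refine Prod.ext (Subtype.ext ?_) rfl
    rw [hH]
    exact (hqF ⟨p, hmem p⟩).symm
  · intro z
    refine Prod.ext (Subtype.ext ?_) ?_
    · dsimp only; rw [hcG]
    · dsimp only
      simp only [hFG, Subtype.coe_eta, H.apply_symm_apply]
  · refine (Continuous.subtype_mk (hc.comp continuous_subtype_val) _).prodMk ?_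
    refine continuous_snd.comp (H.continuous.comp (Continuous.subtype_mk (hF.comp ?_) _))
    exact Continuous.subtype_mk continuous_subtype_val _
  · have h1 : Continuous fun z : (Subtype.val '' (f ⁻¹' V) : Set S) × (q ⁻¹' {f ⟨s, hs⟩}) =>
        (⟨z.1, (hmemU z.1).1⟩ : U) :=
      Continuous.subtype_mk (continuous_subtype_val.comp continuous_fst) _
    refine Continuous.subtype_mk (hG.comp (Continuous.subtype_mk (h1.prodMk ?_) _)) _
    refine continuous_subtype_val.comp
      (H.symm.continuous.comp (Continuous.prodMk ?_ continuous_snd))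
    exact Continuous.subtype_mk (hf.comp h1) _

namespace ChartFamily

variable {E : Type} [NormedAddCommGroup E] [NormedSpace ℝ E]
variable {X : Type u} [TopologicalSpace X]

/-! ### The topology of the frame bundle -/

theorem IsTransition.bijective_fderiv {K : ChartFamily E X} {i j : K.ι}
    {κ : OpenPartialHomeomorph E E} (h : K.IsTransition i j κ) {x : E} (hx : x ∈ κ.source) :
    Function.Bijective (fderiv ℝ κ x) := by
  have e1 := h.fderiv_symm_comp hx
  have e2 := h.symm.fderiv_symm_comp (κ.map_source hx)
  rw [κ.left_inv hx, OpenPartialHomeomorph.symm_symm] at e2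
  exact Function.bijective_iff_has_inverse.2 ⟨fderiv ℝ κ.symm (κ x),
    fun v => congrArg (fun L => L v) e1, fun v => congrArg (fun L => L v) e2⟩

/-- The frames of the tangent spaces of the chart domain `dom i`. -/
abbrev LocalFrame (K : ChartFamily E X) (i : K.ι) : Type :=
  {q : E × (E →L[ℝ] E) // q.1 ∈ K.dom i ∧ Function.Bijective q.2}

/-- The gluing is along local homeomorphisms, so local frames map openly to the frame bundle. -/
theorem isOpenQuotientMap_frame_mk (K : ChartFamily E X) :
    IsOpenQuotientMap (Quotient.mk K.frameSetoid) := by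
  refine ⟨Quotient.mk_surjective, continuous_quotient_mk', ?_⟩
  intro W hW
  rw [← isQuotientMap_quotient_mk'.isOpen_preimage, isOpen_iff_mem_nhds]
  rintro ⟨j, ⟨y, B⟩, hy, hB⟩ ⟨⟨i, ⟨x, A⟩, hx, hA⟩, hW', h⟩
  obtain ⟨κ, hκ, hs, hxy, hd⟩ := Quotient.exact h.symm
  -- pull `W` back along the transition from the chart `j` to the chart `i`
  dsimp only at hκ hs hxy hd
  have hWi : IsOpen {q : K.LocalFrame i |
      (⟨i, q⟩ : K.ChartFrame) ∈ W} := hW.preimage continuous_sigmaMk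
  obtain ⟨W', hW'o, hW'e⟩ := isOpen_induced_iff.1 hWi
  have hmem : ((κ y, (fderiv ℝ κ y).comp B) : E × (E →L[ℝ] E)) ∈ W' := by
    have : (⟨(x, A), hx, hA⟩ : {q : E × (E →L[ℝ] E) // q.1 ∈ K.dom i ∧
      Function.Bijective q.2}) ∈ Subtype.val ⁻¹' W' := by rw [hW'e]; exact hW'
    rw [hxy, ← hd]; exact this
  have hcont : ContinuousAt (fun q : E × (E →L[ℝ] E) => (κ q.1, (fderiv ℝ κ q.1).comp q.2))
      (y, B) := by
    have h1 : ContinuousAt κ y := κ.continuousAt hs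
    have h2 : ContinuousAt (fderiv ℝ κ) y :=
      (hκ.contDiffOn.continuousOn_fderiv_of_isOpen κ.open_source (by simp)).continuousAt
        (κ.open_source.mem_nhds hs)
    refine (h1.comp (x := (y, B)) continuousAt_fst).prodMk ?_
    exact (h2.comp (x := (y, B)) continuousAt_fst).clm_comp continuousAt_snd
  have hev : ∀ᶠ q in 𝓝 (y, B), (κ q.1, (fderiv ℝ κ q.1).comp q.2) ∈ W' ∧ q.1 ∈ κ.source :=
    (hcont.eventually_mem (hW'o.mem_nhds hmem)).and
      (continuousAt_fst.eventually_mem (κ.open_source.mem_nhds hs))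
  rw [Sigma.nhds_mk, Filter.mem_map, nhds_subtype_eq_comap]
  refine Filter.mem_of_superset (Filter.preimage_mem_comap hev) ?_
  rintro ⟨⟨y', B'⟩, hy', hB'⟩ ⟨h1, h2⟩
  dsimp only at h1 h2
  have hbij : Function.Bijective ((fderiv ℝ κ y').comp B') := (hκ.bijective_fderiv h2).comp hB'
  refine ⟨⟨i, (κ y', (fderiv ℝ κ y').comp B'), hκ.target_subset (κ.map_source h2), hbij⟩,
    ?_, ?_⟩
  · have : (⟨(κ y', (fderiv ℝ κ y').comp B'), hκ.target_subset (κ.map_source h2), hbij⟩ :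
      {q : E × (E →L[ℝ] E) // q.1 ∈ K.dom i ∧ Function.Bijective q.2}) ∈
        Subtype.val ⁻¹' W' := h1
    rw [hW'e] at this
    exact this
  · exact (Quotient.sound ⟨κ, hκ, h2, rfl, rfl⟩ : (⟦_⟧ : K.Frame) = ⟦_⟧).symm

theorem Frame.act_act {K : ChartFamily E X} (L M : E ≃L[ℝ] E) (e : K.Frame) :
    Frame.act M (Frame.act L e) = Frame.act (L * M) e := by
  induction e using Quotient.inductionOn
  rfl

theorem Frame.act_one {K : ChartFamily E X} (e : K.Frame) :
    Frame.act 1 e = e := by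
  induction e using Quotient.inductionOn
  rfl

/-- The class of a frame in the chart `i`. -/
def mkFrame (K : ChartFamily E X) (i : K.ι)
    (q : K.LocalFrame i) : K.Frame :=
  Quotient.mk _ ⟨i, q⟩

theorem isOpenMap_mkFrame (K : ChartFamily E X) (i : K.ι) : IsOpenMap (K.mkFrame i) :=
  K.isOpenQuotientMap_frame_mk.isOpenMap.comp isOpenMap_sigmaMk

theorem continuous_mkFrame (K : ChartFamily E X) (i : K.ι) : Continuous (K.mkFrame i) :=
  continuous_quotient_mk'.comp continuous_sigmaMk

theorem exists_mkFrame_eq (K : ChartFamily E X) (e : K.Frame) : ∃ i q, K.mkFrame i q = e := by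
  obtain ⟨⟨i, q⟩, rfl⟩ := Quotient.mk_surjective e
  exact ⟨i, q, rfl⟩

theorem Frame.act_mkFrame {K : ChartFamily E X} (L : E ≃L[ℝ] E) (i : K.ι) (q : K.LocalFrame i) :
    Frame.act L (K.mkFrame i q) =
      K.mkFrame i ⟨(q.1.1, q.1.2.comp (L : E →L[ℝ] E)), q.2.1, q.2.2.comp L.bijective⟩ := rfl

/-- Continuity of a map out of a product with the frame bundle can be checked in charts. -/
theorem Frame.continuousAt_prod_iff {K : ChartFamily E X} {T Z : Type*} [TopologicalSpace T]
    [TopologicalSpace Z] {g : T × K.Frame → Z} (t : T) (i : K.ι)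
    (q : K.LocalFrame i) :
    ContinuousAt g (t, K.mkFrame i q) ↔
      ContinuousAt (fun z : T × K.LocalFrame i => g (z.1, K.mkFrame i z.2)) (t, q) := by
  have h : Filter.map (Prod.map id (K.mkFrame i)) (𝓝 (t, q)) = 𝓝 (t, K.mkFrame i q) :=
    (IsOpenMap.id.prodMap (K.isOpenMap_mkFrame i)).map_nhds_eq
      (continuous_id.prodMap (K.continuous_mkFrame i)).continuousAt
  rw [ContinuousAt, ← h, Filter.tendsto_map'_iff]
  rfl

theorem Frame.continuous_prod_iff {K : ChartFamily E X} {T Z : Type*} [TopologicalSpace T]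
    [TopologicalSpace Z] {g : T × K.Frame → Z} :
    Continuous g ↔ ∀ i, Continuous fun z : T × K.LocalFrame i => g (z.1, K.mkFrame i z.2) := by
  refine ⟨fun h i => h.comp (continuous_id.prodMap (K.continuous_mkFrame i)), fun h => ?_⟩
  rw [continuous_iff_continuousAt]
  rintro ⟨t, e⟩
  obtain ⟨i, q, rfl⟩ := K.exists_mkFrame_eq e
  exact (continuousAt_prod_iff t i q).2 (h i).continuousAt

theorem Frame.continuous_iff {K : ChartFamily E X} {Z : Type*}
    [TopologicalSpace Z] {g : K.Frame → Z} :
    Continuous g ↔ ∀ i, Continuous fun q => g (K.mkFrame i q) := by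
  rw [← K.isOpenQuotientMap_frame_mk.continuous_comp_iff, continuous_sigma_iff]
  rfl

/-- The action of `GL(E)` on frames is jointly continuous. -/
theorem Frame.continuous_act {K : ChartFamily E X} {T : Type*} [TopologicalSpace T]
    {L : T → E ≃L[ℝ] E} (hL : Continuous fun t => (L t : E →L[ℝ] E)) :
    Continuous fun z : T × K.Frame => Frame.act (L z.1) z.2 := by
  rw [Frame.continuous_prod_iff]
  intro i
  have h : Continuous fun z : T × K.LocalFrame i =>
      (⟨(z.2.1.1, z.2.1.2.comp (L z.1 : E →L[ℝ] E)), z.2.2.1,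
        z.2.2.2.comp (L z.1).bijective⟩ : K.LocalFrame i) := by
    refine Continuous.subtype_mk (Continuous.prodMk ?_ ?_) _
    · exact continuous_fst.comp (continuous_subtype_val.comp continuous_snd)
    · exact (continuous_snd.comp (continuous_subtype_val.comp continuous_snd)).clm_comp
        (hL.comp continuous_fst)
  exact (K.continuous_mkFrame i).comp h

end ChartFamily
end OrbPin

namespace OrbPin
open Set
open CliffordAlgebra

/-! ### Clifford algebras as topological algebras -/

section Topological

variable {V : Type} [AddCommGroup V] [Module ℝ V] (Q : QuadraticForm ℝ V)

instance : IsModuleTopology ℝ (CliffordAlgebra Q) := ⟨rfl⟩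

instance [FiniteDimensional ℝ V] : Module.Finite ℝ (CliffordAlgebra Q) := by
  have : Module.Finite ℝ (ExteriorAlgebra ℝ V) :=
    .of_basis ((Module.finBasis ℝ V).ExteriorAlgebra)
  exact Module.Finite.equiv (equivExterior Q).symm

instance [FiniteDimensional ℝ V] : IsTopologicalRing (CliffordAlgebra Q) :=
  IsModuleTopology.isTopologicalRing ℝ _

variable {Q}

theorem continuous_of_linear {Q : QuadraticForm ℝ V} {W : Type*} [AddCommGroup W] [Module ℝ W]
    [TopologicalSpace W] [ContinuousAdd W] [ContinuousSMul ℝ W] (f : CliffordAlgebra Q →ₗ[ℝ] W) :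
    Continuous f :=
  IsModuleTopology.continuous_of_linearMap f

instance : ContinuousAdd (CliffordAlgebra Q) := IsModuleTopology.toContinuousAdd ℝ _

theorem continuous_star_clifford : Continuous (star : CliffordAlgebra Q → CliffordAlgebra Q) := by
  have : (star : CliffordAlgebra Q → CliffordAlgebra Q) =
      (reverse (Q := Q)) ∘ₗ (involute (Q := Q)).toLinearMap := by
    ext x; exact star_def x
  rw [this]
  exact continuous_of_linear _

theorem continuous_ι {V : Type} [NormedAddCommGroup V] [NormedSpace ℝ V] [FiniteDimensional ℝ V]
    (Q : QuadraticForm ℝ V) : Continuous (ι Q) := by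
  have : ContinuousSMul ℝ (CliffordAlgebra Q) := IsModuleTopology.toContinuousSMul ℝ _
  exact LinearMap.continuous_of_finiteDimensional _

end Topological

/-! ### The twisted adjoint representation -/

section Adjoint

variable {V : Type} [NormedAddCommGroup V] [NormedSpace ℝ V] [FiniteDimensional ℝ V]
variable {Q : QuadraticForm ℝ V}

theorem ι_pinRho (x : pinGroup Q) (v : V) :
    ι Q (pinRho Q x v) =
      involute (x : CliffordAlgebra Q) * ι Q v * star (x : CliffordAlgebra Q) :=
  ι_twistedAdjointFun Q x v

theorem ι_spinRho (x : spinGroup Q) (v : V) :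
    ι Q (spinRho Q x v) = (x : CliffordAlgebra Q) * ι Q v * star (x : CliffordAlgebra Q) := by
  refine (ι_twistedAdjointFun Q _ v).trans ?_
  change involute (x : CliffordAlgebra Q) * _ * star (x : CliffordAlgebra Q) = _
  rw [spinGroup.involute_eq x.2]

theorem Q_spinRho (x : spinGroup Q) (v : V) : Q (spinRho Q x v) = Q v := by
  apply (algebraMap ℝ (CliffordAlgebra Q)).injective
  have h : star (x : CliffordAlgebra Q) * x = 1 := spinGroup.star_mul_self_of_mem x.2
  have h' : (x : CliffordAlgebra Q) * star (x : CliffordAlgebra Q) = 1 :=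
    spinGroup.mul_star_self_of_mem x.2
  rw [← ι_sq_scalar, ι_spinRho]
  calc (x : CliffordAlgebra Q) * ι Q v * star (x : CliffordAlgebra Q) *
        (x * ι Q v * star (x : CliffordAlgebra Q))
      = x * ι Q v * (star (x : CliffordAlgebra Q) * x) * ι Q v * star (x : CliffordAlgebra Q) := by
        simp only [mul_assoc]
    _ = x * (ι Q v * ι Q v) * star (x : CliffordAlgebra Q) := by
        rw [h, mul_one, mul_assoc (x : CliffordAlgebra Q)]
    _ = algebraMap ℝ _ (Q v) := by
        rw [ι_sq_scalar, ← Algebra.commutes, mul_assoc, h', mul_one]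

theorem continuous_pinRho :
    Continuous fun x : pinGroup Q => (pinRho Q x : V →L[ℝ] V) := by
  rw [continuous_clm_apply]
  intro v
  have : ∀ x : pinGroup Q, (pinRho Q x : V →L[ℝ] V) v = vectorPart Q
      (involute (x : CliffordAlgebra Q) * ι Q v * star (x : CliffordAlgebra Q)) := by
    intro x
    rw [← ι_pinRho, vectorPart_ι]
    rfl
  simp only [this]
  refine (continuous_of_linear (vectorPart Q)).comp ?_
  refine Continuous.mul (Continuous.mul ?_ continuous_const) ?_
  · exact (continuous_of_linear (involute (Q := Q)).toLinearMap).comp continuous_subtype_val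
  · exact continuous_star_clifford.comp continuous_subtype_val

theorem continuous_spinRho :
    Continuous fun x : spinGroup Q => (spinRho Q x : V →L[ℝ] V) :=
  continuous_pinRho.comp (Continuous.subtype_mk continuous_subtype_val _ :
    Continuous (Submonoid.inclusion fun _ hx => spinGroup.mem_pin hx))

omit [FiniteDimensional ℝ V] in
theorem continuous_inv_spin : Continuous fun x : spinGroup Q => x⁻¹ :=
  Continuous.subtype_mk (continuous_star_clifford.comp continuous_subtype_val) _

/-- An element of the Lipschitz group acts on vectors by the twisted conjugation, and the sign of
the determinant of this action is the parity of the element: a single vector acts by a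
reflection. -/
theorem exists_det_of_mem_lipschitzGroup {x : (CliffordAlgebra Q)ˣ} (hx : x ∈ lipschitzGroup Q) :
    ∃ L : V →ₗ[ℝ] V, (∀ v, ι Q (L v) = involute (x : CliffordAlgebra Q) * ι Q v * ↑x⁻¹) ∧
      ((involute (x : CliffordAlgebra Q) = x ∧ 0 < LinearMap.det L) ∨
        (involute (x : CliffordAlgebra Q) = -x ∧ LinearMap.det L < 0)) := by
  induction hx using Subgroup.closure_induction with
  | mem x hx =>
    obtain ⟨w, hw⟩ := hx
    have hQ : Q w ≠ 0 := by
      intro h0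
      have h1 : (x : CliffordAlgebra Q) * x = 0 := by
        rw [← hw, ι_sq_scalar, h0, map_zero]
      have h2 := congrArg (fun z => (↑x⁻¹ : CliffordAlgebra Q) * z) h1
      simp only [Units.inv_mul_cancel_left, mul_zero] at h2
      exact x.ne_zero h2
    have hinv : (↑x⁻¹ : CliffordAlgebra Q) = (Q w)⁻¹ • ι Q w := by
      rw [Units.inv_eq_of_mul_eq_one_right]
      rw [← hw, mul_smul_comm, ι_sq_scalar, ← algebraMap_smul (CliffordAlgebra Q), smul_eq_mul,
        ← map_mul, inv_mul_cancel₀ hQ, map_one]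
    refine ⟨LinearMap.transvection ((-(Q w)⁻¹) • (QuadraticMap.polarBilin Q w)) w, ?_,
      Or.inr ⟨by rw [← hw, involute_ι], ?_⟩⟩
    · intro v
      rw [← hw, hinv, involute_ι, LinearMap.transvection.apply]
      rw [mul_smul_comm, neg_mul, neg_mul, ι_mul_ι_mul_ι, ← map_neg,
        ← map_smul (ι Q) (Q w)⁻¹]
      refine congrArg _ ?_
      rw [LinearMap.smul_apply, QuadraticMap.polarBilin_apply_apply, neg_sub, smul_sub, smul_smul,
        smul_smul, inv_mul_cancel₀ hQ, one_smul, smul_eq_mul]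
      module
    · rw [LinearMap.transvection.det]
      have : (Q w)⁻¹ * (2 * Q w) = 2 := by field_simp
      simp [this]
  | one =>
    exact ⟨LinearMap.id, fun v => by simp, Or.inl ⟨by simp, by simp⟩⟩
  | mul x y _ _ hx hy =>
    obtain ⟨L, hL, hL'⟩ := hx
    obtain ⟨M, hM, hM'⟩ := hy
    refine ⟨L ∘ₗ M, fun v => ?_, ?_⟩
    · rw [LinearMap.comp_apply, hL, hM, Units.val_mul, map_mul, mul_inv_rev, Units.val_mul]
      simp only [mul_assoc]
    · rw [Units.val_mul, map_mul, LinearMap.det_comp]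
      rcases hL' with ⟨h1, h2⟩ | ⟨h1, h2⟩ <;> rcases hM' with ⟨h3, h4⟩ | ⟨h3, h4⟩ <;> rw [h1, h3]
      · exact Or.inl ⟨rfl, mul_pos h2 h4⟩
      · exact Or.inr ⟨by rw [mul_neg], mul_neg_of_pos_of_neg h2 h4⟩
      · exact Or.inr ⟨by rw [neg_mul], mul_neg_of_neg_of_pos h2 h4⟩
      · exact Or.inl ⟨by rw [neg_mul_neg], mul_pos_of_neg_of_neg h2 h4⟩
  | inv x _ hx =>
    obtain ⟨L, hL, hL'⟩ := hx
    have hdet : LinearMap.det L ≠ 0 := by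
      rcases hL' with ⟨-, h⟩ | ⟨-, h⟩
      exacts [h.ne', h.ne]
    let M := LinearMap.equivOfDetNeZero L hdet
    have hM : ∀ v, L (M.symm v) = v := fun v => M.apply_symm_apply v
    have hinv : involute (↑x⁻¹ : CliffordAlgebra Q) * involute (x : CliffordAlgebra Q) = 1 := by
      rw [← map_mul, Units.inv_mul, map_one]
    have hdet' : LinearMap.det L * LinearMap.det (M.symm : V →ₗ[ℝ] V) = 1 := by
      rw [← LinearMap.det_comp]
      have : L ∘ₗ (M.symm : V →ₗ[ℝ] V) = LinearMap.id := LinearMap.ext hM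
      rw [this, LinearMap.det_id]
    refine ⟨M.symm, fun v => ?_, ?_⟩
    · conv_rhs => rw [← hM v, hL]
      rw [inv_inv, ← mul_assoc, ← mul_assoc, hinv, one_mul, mul_assoc, Units.inv_mul, mul_one]
      rfl
    · rcases hL' with ⟨h1, h2⟩ | ⟨h1, h2⟩
      · refine Or.inl ⟨?_, ?_⟩
        · rw [h1] at hinv
          exact (Units.eq_inv_of_mul_eq_one_right hinv)
        · exact (pos_iff_pos_of_mul_pos (by rw [hdet']; exact one_pos)).1 h2
      · refine Or.inr ⟨?_, ?_⟩
        · rw [h1, mul_neg, ← neg_mul] at hinv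
          exact neg_eq_iff_eq_neg.1 (Units.eq_inv_of_mul_eq_one_right hinv)
        · exact (neg_iff_neg_of_mul_pos (by rw [hdet']; exact one_pos)).1 h2

/-- The adjoint representation of the spin group has image in `GL₊`. -/
theorem det_spinRho_pos (x : spinGroup Q) :
    0 < LinearMap.det (spinRho Q x : V →ₗ[ℝ] V) := by
  obtain ⟨L, hL, h⟩ := exists_det_of_mem_lipschitzGroup
    (pinGroup.units_mem_lipschitzGroup
      (x := pinGroup.toUnits ⟨(x : CliffordAlgebra Q), spinGroup.mem_pin x.2⟩)
      (spinGroup.mem_pin x.2))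
  have hx : involute (x : CliffordAlgebra Q) = x := spinGroup.involute_eq x.2
  have hLx : L = (spinRho Q x : V →ₗ[ℝ] V) := by
    ext v
    apply ι_injective Q
    refine (hL v).trans ((ι_spinRho x v).trans ?_).symm
    change _ = involute (x : CliffordAlgebra Q) * _ * star (x : CliffordAlgebra Q)
    rw [hx]
  rw [← hLx]
  rcases h with ⟨-, h⟩ | ⟨h, -⟩
  · exact h
  · change involute (x : CliffordAlgebra Q) = -x at h
    rw [hx] at h
    have h0 : (x : CliffordAlgebra Q) = 0 := by
      have h2 : (2 : ℝ) • (x : CliffordAlgebra Q) = 0 := by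
        rw [two_smul]; nth_rewrite 2 [h]; exact add_neg_cancel _
      exact (smul_eq_zero.1 h2).resolve_left two_ne_zero
    have h1 : star (x : CliffordAlgebra Q) * x = 1 := spinGroup.star_mul_self_of_mem x.2
    rw [h0, mul_zero] at h1
    exact absurd h1 zero_ne_one

theorem involute_pin (x : pinGroup Q) :
    involute (x : CliffordAlgebra Q) = x ∨ involute (x : CliffordAlgebra Q) = -x := by
  obtain ⟨L, hL, h⟩ := exists_det_of_mem_lipschitzGroup
    (pinGroup.units_mem_lipschitzGroup (x := pinGroup.toUnits x) x.2)
  exact h.imp And.left And.left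

omit [FiniteDimensional ℝ V] in
theorem ι_mem_pinGroup {v : V} (hv : Q v = -1) : ι Q v ∈ pinGroup Q := by
  have h1 : ι Q v * ι Q v = -1 := by rw [ι_sq_scalar, hv, map_neg, map_one]
  refine pinGroup.mem_iff.2 ⟨⟨⟨ι Q v, -ι Q v, by rw [mul_neg, h1, neg_neg],
    by rw [neg_mul, h1, neg_neg]⟩, Subgroup.subset_closure ⟨v, rfl⟩, rfl⟩, ?_⟩
  rw [Unitary.mem_iff, star_ι]
  exact ⟨by rw [neg_mul, h1, neg_neg], by rw [mul_neg, h1, neg_neg]⟩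

end Adjoint

end OrbPin

namespace OrbPin
open Set
open CliffordAlgebra

/-! ### The even elements of a Clifford algebra that commute with all vectors -/

section Center

variable {V : Type} [AddCommGroup V] [Module ℝ V] {Q : QuadraticForm ℝ V}
variable {κ : Type} {b : κ → V}

/-- The product of the vectors `b i`, `i ∈ l`, in the Clifford algebra. -/
noncomputable def cliffordWord (Q : QuadraticForm ℝ V) (b : κ → V) (l : List κ) :
    CliffordAlgebra Q :=
  (l.map fun i => ι Q (b i)).prod

theorem cliffordWord_cons (i : κ) (l : List κ) :
    cliffordWord Q b (i :: l) = ι Q (b i) * cliffordWord Q b l := by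
  simp [cliffordWord]

theorem cliffordWord_append (l l' : List κ) :
    cliffordWord Q b (l ++ l') = cliffordWord Q b l * cliffordWord Q b l' := by
  simp [cliffordWord]

theorem ι_mul_cliffordWord [DecidableEq κ]
    (horth : ∀ i j, i ≠ j → ι Q (b i) * ι Q (b j) = -(ι Q (b j) * ι Q (b i))) (j : κ)
    (l : List κ) :
    ι Q (b j) * cliffordWord Q b l =
      (-1 : ℝ) ^ (l.length + l.count j) • (cliffordWord Q b l * ι Q (b j)) := by
  induction l with
  | nil => simp [cliffordWord]
  | cons i l ih =>
    rw [cliffordWord_cons, List.length_cons, List.count_cons]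
    by_cases h : i = j
    · subst h
      conv_lhs => rw [ih, mul_smul_comm, ← mul_assoc]
      simp only [beq_self_eq_true, if_true]
      congr 1
      ring
    · rw [← mul_assoc, horth j i (Ne.symm h), neg_mul, mul_assoc, ih, mul_smul_comm, mul_assoc]
      simp only [beq_iff_eq, h, if_false, add_zero]
      rw [← neg_smul]
      congr 1
      ring

/-- Anticommutation sorts the words and cancels repeated letters, so words without repetition span
the algebra. -/
theorem mem_span_cliffordWord (hsq : ∀ i, Q (b i) = -1)
    (horth : ∀ i j, i ≠ j → ι Q (b i) * ι Q (b j) = -(ι Q (b j) * ι Q (b i)))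
    (hspan : ⊤ ≤ Submodule.span ℝ (range b)) (x : CliffordAlgebra Q) :
    x ∈ Submodule.span ℝ (cliffordWord Q b '' {l | l.Nodup}) := by
  classical
  induction x using CliffordAlgebra.left_induction with
  | algebraMap r =>
    rw [Algebra.algebraMap_eq_smul_one]
    exact Submodule.smul_mem _ _
      (Submodule.subset_span ⟨[], List.nodup_nil, by simp [cliffordWord]⟩)
  | add x y hx hy => exact add_mem hx hy
  | ι_mul x m hx =>
    have hm : m ∈ Submodule.span ℝ (range b) := hspan trivial
    induction hm using Submodule.span_induction with
    | zero => simp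
    | add m m' _ _ h h' => rw [map_add, add_mul]; exact add_mem h h'
    | smul r m _ h => rw [map_smul, smul_mul_assoc]; exact Submodule.smul_mem _ _ h
    | mem m hm =>
      obtain ⟨i, rfl⟩ := hm
      induction hx using Submodule.span_induction with
      | zero => simp
      | add x x' _ _ h h' => rw [mul_add]; exact add_mem h h'
      | smul r x _ h => rw [mul_smul_comm]; exact Submodule.smul_mem _ _ h
      | mem x hx =>
        obtain ⟨l, hl, rfl⟩ := hx
        by_cases hi : i ∈ l
        · obtain ⟨l₁, l₂, rfl⟩ := List.append_of_mem hi
          rw [cliffordWord_append, ← mul_assoc, ι_mul_cliffordWord horth, smul_mul_assoc,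
            cliffordWord_cons, mul_assoc, ← mul_assoc (ι Q (b i)) (ι Q (b i)), ι_sq_scalar, hsq,
            ← Algebra.smul_def, mul_smul_comm, ← cliffordWord_append]
          refine Submodule.smul_mem _ _ (Submodule.smul_mem _ _ (Submodule.subset_span
            ⟨_, List.Nodup.sublist ?_ hl, rfl⟩))
          exact List.Sublist.append (List.Sublist.refl _) (List.sublist_cons_self _ _)
        · exact Submodule.subset_span ⟨i :: l, List.nodup_cons.2 ⟨hi, hl⟩, cliffordWord_cons _ _⟩

/-- An even element of the Clifford algebra that commutes with the vectors of an orthogonal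
spanning family is a scalar: averaging over conjugation by `b j` fixes it and kills the words
that contain `j`. -/
theorem exists_eq_algebraMap_of_even_of_commute [Finite κ] (hsq : ∀ i, Q (b i) = -1)
    (horth : ∀ i j, i ≠ j → ι Q (b i) * ι Q (b j) = -(ι Q (b j) * ι Q (b i)))
    (hspan : ⊤ ≤ Submodule.span ℝ (range b)) {y : CliffordAlgebra Q} (hy : involute y = y)
    (hc : ∀ i, y * ι Q (b i) = ι Q (b i) * y) : ∃ c : ℝ, y = algebraMap ℝ _ c := by
  classical
  have := Fintype.ofFinite κ
  have hsq' : ∀ i, ι Q (b i) * ι Q (b i) = -1 := fun i => by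
    rw [ι_sq_scalar, hsq, map_neg, map_one]
  have hJ : ∀ J : List κ, y ∈ Submodule.span ℝ
      (cliffordWord Q b '' {l | l.Nodup ∧ Even l.length ∧ ∀ j ∈ J, j ∉ l}) := by
    intro J
    induction J with
    | nil =>
      have hp : ∀ x, (2⁻¹ : ℝ) • (x + involute x) ∈ Submodule.span ℝ
          (cliffordWord Q b '' {l | l.Nodup ∧ Even l.length ∧ ∀ j ∈ ([] : List κ), j ∉ l}) := by
        intro x
        have hx := mem_span_cliffordWord hsq horth hspan x
        induction hx using Submodule.span_induction with
        | zero => simp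
        | add x x' _ _ h h' =>
          have := add_mem h h'
          rw [← smul_add] at this
          rw [map_add]
          convert this using 2
          abel
        | smul r x _ h =>
          have := Submodule.smul_mem _ r h
          rw [map_smul, ← smul_add, smul_comm]
          exact this
        | mem x hx =>
          obtain ⟨l, hl, rfl⟩ := hx
          have : involute (cliffordWord Q b l) = (-1 : ℝ) ^ l.length • cliffordWord Q b l := by
            have := involute_prod_map_ι (Q := Q) (l.map b)
            simpa [cliffordWord, List.map_map, Function.comp_def] using this
          rw [this]
          rcases Nat.even_or_odd l.length with he | ho
          · rw [he.neg_one_pow, one_smul]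
            refine Submodule.smul_mem _ _ (add_mem ?_ ?_) <;>
              exact Submodule.subset_span ⟨l, ⟨hl, he, by simp⟩, rfl⟩
          · rw [ho.neg_one_pow, neg_one_smul, add_neg_cancel, smul_zero]
            exact zero_mem _
      have h := hp y
      rwa [hy, ← two_smul ℝ, smul_smul, inv_mul_cancel₀ two_ne_zero, one_smul] at h
    | cons j J ih =>
      have hT : ∀ x ∈ Submodule.span ℝ
          (cliffordWord Q b '' {l | l.Nodup ∧ Even l.length ∧ ∀ j ∈ J, j ∉ l}),
          (2⁻¹ : ℝ) • (x - ι Q (b j) * x * ι Q (b j)) ∈ Submodule.span ℝ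
          (cliffordWord Q b '' {l | l.Nodup ∧ Even l.length ∧ ∀ i ∈ j :: J, i ∉ l}) := by
        intro x hx
        induction hx using Submodule.span_induction with
        | zero => simp
        | add x x' _ _ h h' =>
          have := add_mem h h'
          rw [← smul_add] at this
          rw [mul_add, add_mul]
          convert this using 2
          abel
        | smul r x _ h =>
          have := Submodule.smul_mem _ r h
          rw [mul_smul_comm, smul_mul_assoc, ← smul_sub, smul_comm]
          exact this
        | mem x hx =>
          obtain ⟨l, ⟨hl, he, hlJ⟩, rfl⟩ := hx
          rw [ι_mul_cliffordWord horth, smul_mul_assoc, mul_assoc, hsq', mul_neg_one, pow_add,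
            he.neg_one_pow, one_mul]
          by_cases hj : j ∈ l
          · rw [List.count_eq_one_of_mem hl hj, pow_one, smul_neg, neg_one_smul, neg_neg, sub_self,
              smul_zero]
            exact zero_mem _
          · rw [List.count_eq_zero_of_not_mem hj, pow_zero, one_smul, sub_neg_eq_add]
            refine Submodule.smul_mem _ _ (add_mem ?_ ?_) <;>
            · refine Submodule.subset_span ⟨l, ⟨hl, he, fun i hi => ?_⟩, rfl⟩
              rcases List.mem_cons.1 hi with rfl | hi
              exacts [hj, hlJ i hi]
      have h := hT y ih
      rwa [← hc, mul_assoc, hsq', mul_neg_one, sub_neg_eq_add, ← two_smul ℝ, smul_smul,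
        inv_mul_cancel₀ two_ne_zero, one_smul] at h
  have h := hJ Finset.univ.toList
  have hset : {l : List κ | l.Nodup ∧ Even l.length ∧ ∀ j ∈ Finset.univ.toList, j ∉ l} ⊆ {[]} := by
    rintro l ⟨-, -, h⟩
    exact List.eq_nil_iff_forall_not_mem.2 fun j => h j (by simp)
  have h' := Submodule.span_mono (image_mono hset) h
  rw [image_singleton, Submodule.mem_span_singleton] at h'
  obtain ⟨c, rfl⟩ := h'
  exact ⟨c, by simp [cliffordWord, Algebra.algebraMap_eq_smul_one]⟩

end Center

end OrbPin

namespace OrbPin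
open Set Topology
open CliffordAlgebra CliffordAlgebra.EquivEven
open scoped RealInnerProductSpace

/-! ### `Pin⁻(n)` inside `Spin(n + 1)` -/

section

variable {n : ℕ}

theorem negSqProd_apply (w : EuclideanSpace ℝ (Fin n) × ℝ) :
    negSqProd n w = -‖w.1‖ ^ 2 - w.2 * w.2 := by
  rw [negSqProd, Q'_apply, negSq_apply]

theorem polar_negSq (v w : EuclideanSpace ℝ (Fin n)) :
    QuadraticMap.polar (negSq n) v w = -2 * ⟪v, w⟫ := by
  simp only [QuadraticMap.polar, negSq_apply]
  rw [norm_add_sq_real]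
  ring

theorem coe_pinToSpin (x : PinMinus n) :
    (pinToSpin n x : CliffordAlgebra (negSqProd n)) =
      (toEven (negSq n) (x : CliffordAlgebra (negSq n)) : CliffordAlgebra.even (negSqProd n)) :=
  rfl

theorem e0_mul_toEven (x : CliffordAlgebra (negSq n)) :
    e0 (negSq n) * (toEven (negSq n) x : CliffordAlgebra.even (negSqProd n)) =
      (toEven (negSq n) (involute x) : CliffordAlgebra.even (negSqProd n)) * e0 (negSq n) := by
  induction x using CliffordAlgebra.induction with
  | algebraMap r =>
    simp only [AlgHom.commutes, Subalgebra.coe_algebraMap, Algebra.commutes]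
  | ι m =>
    rw [involute_ι, map_neg, Subalgebra.coe_neg, toEven_ι, neg_mul, ← mul_assoc, e0_mul_e0,
      e0_mul_v_mul_e0, neg_one_mul]
  | mul x y hx hy =>
    rw [map_mul, map_mul, map_mul, Subalgebra.coe_mul, Subalgebra.coe_mul, ← mul_assoc, hx,
      mul_assoc, hy, mul_assoc]
  | add x y hx hy =>
    rw [map_add, map_add, map_add, Subalgebra.coe_add, Subalgebra.coe_add, mul_add, hx, hy,
      add_mul]

theorem toEven_mul_e0 (x : CliffordAlgebra (negSq n)) :
    (toEven (negSq n) x : CliffordAlgebra.even (negSqProd n)) * e0 (negSq n) =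
      e0 (negSq n) * (toEven (negSq n) (involute x) : CliffordAlgebra.even (negSqProd n)) := by
  rw [e0_mul_toEven, involute_involute]

theorem v_eq_e0_mul_toEven (v : EuclideanSpace ℝ (Fin n)) :
    ι (negSqProd n) (v, 0) =
      -(e0 (negSq n) * (toEven (negSq n) (ι (negSq n) v) : CliffordAlgebra.even (negSqProd n))) := by
  rw [toEven_ι, ← mul_assoc, e0_mul_e0, neg_one_mul, neg_neg]
  rfl

theorem spinRho_pinToSpin_inl (x : PinMinus n) (v : EuclideanSpace ℝ (Fin n)) :
    spinRho (negSqProd n) (pinToSpin n x) (v, 0) = (pinRho (negSq n) x v, 0) := by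
  apply ι_injective (negSqProd n)
  rw [ι_spinRho, v_eq_e0_mul_toEven, v_eq_e0_mul_toEven, ι_pinRho, coe_pinToSpin, star_toEven,
    mul_neg, neg_mul, ← mul_assoc, toEven_mul_e0, map_mul, map_mul, Subalgebra.coe_mul,
    Subalgebra.coe_mul]
  simp only [mul_assoc]

theorem spinRho_pinToSpin_inr (x : PinMinus n) :
    spinRho (negSqProd n) (pinToSpin n x) (0, 1) = (0, 1) ∨
      spinRho (negSqProd n) (pinToSpin n x) (0, 1) = (0, -1) := by
  have h1 : (x : CliffordAlgebra (negSq n)) * star (x : CliffordAlgebra (negSq n)) = 1 :=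
    pinGroup.mul_star_self_of_mem x.2
  have key : ι (negSqProd n) (spinRho (negSqProd n) (pinToSpin n x) (0, 1)) = e0 (negSq n) *
      (toEven (negSq n) (involute (x : CliffordAlgebra (negSq n)) *
        star (x : CliffordAlgebra (negSq n))) : CliffordAlgebra.even (negSqProd n)) := by
    rw [ι_spinRho, coe_pinToSpin, star_toEven]
    change _ * e0 (negSq n) * _ = _
    rw [toEven_mul_e0, map_mul, Subalgebra.coe_mul, mul_assoc]
  rcases involute_pin x with h | h
  · left
    apply ι_injective (negSqProd n)
    rw [key, h, h1, map_one, Subalgebra.coe_one, mul_one]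
    rfl
  · right
    apply ι_injective (negSqProd n)
    rw [key, h, neg_mul, h1, map_neg, map_one, Subalgebra.coe_neg, Subalgebra.coe_one, mul_neg,
      mul_one]
    have : ((0, -1) : EuclideanSpace ℝ (Fin n) × ℝ) = -(0, 1) := by simp
    rw [this, map_neg]
    rfl

theorem pinToSpin_injective : Function.Injective (pinToSpin n) := by
  intro x y h
  apply Subtype.ext
  have h' : toEven (negSq n) (x : CliffordAlgebra (negSq n)) = toEven (negSq n) y :=
    Subtype.ext (by rw [← coe_pinToSpin, ← coe_pinToSpin, h])
  exact (equivEven (negSq n)).injective h'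

theorem continuous_pinToSpin : Continuous (pinToSpin n) :=
  Continuous.subtype_mk ((continuous_of_linear
    ((CliffordAlgebra.even (negSqProd n)).val.comp (toEven (negSq n))).toLinearMap).comp
      continuous_subtype_val) _

/-- An injective linear map of finite-dimensional spaces has a continuous linear left inverse, so
its restriction to `Pin⁻(n)` is an embedding. -/
theorem isEmbedding_pinToSpin : IsEmbedding (pinToSpin n) := by
  obtain ⟨f, hf⟩ := LinearMap.exists_leftInverse_of_injective
    ((CliffordAlgebra.even (negSqProd n)).val.comp (toEven (negSq n))).toLinearMap
    (LinearMap.ker_eq_bot.2 (Subtype.val_injective.comp (equivEven (negSq n)).injective))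
  have : ∀ x : PinMinus n, f (pinToSpin n x : CliffordAlgebra (negSqProd n)) = x := fun x =>
    congrArg (fun g => g (x : CliffordAlgebra (negSq n))) hf
  refine IsEmbedding.of_comp continuous_pinToSpin
    ((continuous_of_linear f).comp continuous_subtype_val) ?_
  have h : (f ∘ Subtype.val) ∘ pinToSpin n = Subtype.val := funext this
  rw [h]
  exact IsEmbedding.subtypeVal

theorem norm_pinRho (x : PinMinus n) (v : EuclideanSpace ℝ (Fin n)) :
    ‖pinRho (negSq n) x v‖ = ‖v‖ := by
  have h := Q_spinRho (pinToSpin n x) (v, 0)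
  rw [spinRho_pinToSpin_inl, negSqProd_apply, negSqProd_apply] at h
  dsimp only at h
  have : ‖pinRho (negSq n) x v‖ ^ 2 = ‖v‖ ^ 2 := by linarith
  exact (pow_left_inj₀ (norm_nonneg _) (norm_nonneg _) two_ne_zero).1 this

theorem spinRho_eq_one {x : SpinSucc n}
    (h : ∀ v, spinRho (negSqProd n) x (v, 0) = (v, 0))
    (h' : spinRho (negSqProd n) x (0, 1) = (0, 1) ∨ spinRho (negSqProd n) x (0, 1) = (0, -1)) :
    spinRho (negSqProd n) x = 1 := by
  have hx : ∀ (v : EuclideanSpace ℝ (Fin n)) (r : ℝ), spinRho (negSqProd n) x (v, r) =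
      (v, 0) + r • spinRho (negSqProd n) x (0, 1) := by
    intro v r
    conv_rhs => rw [← h v]
    rw [← map_smul, ← map_add]
    simp
  rcases h' with h' | h'
  · ext1
    funext ⟨v, r⟩
    rw [hx, h']
    change _ = (v, r)
    simp
  · have hdet := det_spinRho_pos x
    have : (spinRho (negSqProd n) x : (EuclideanSpace ℝ (Fin n) × ℝ) →ₗ[ℝ] _) =
        LinearMap.prodMap LinearMap.id (-LinearMap.id) := by
      refine LinearMap.ext fun ⟨v, r⟩ => ?_
      refine (hx v r).trans ?_
      rw [h']
      simp
    rw [this, LinearMap.det_prodMap, LinearMap.det_id, one_mul, ← neg_one_smul ℝ,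
      LinearMap.det_smul, LinearMap.det_id] at hdet
    norm_num at hdet

theorem spinRho_pinToSpin_eq_one {x : PinMinus n} (hx : pinRho (negSq n) x = 1) :
    spinRho (negSqProd n) (pinToSpin n x) = 1 := by
  refine spinRho_eq_one (fun v => ?_) (spinRho_pinToSpin_inr x)
  rw [spinRho_pinToSpin_inl, hx]
  rfl

/-- Every isometry of `ℝⁿ` is in the image of `Pin⁻(n)`, since reflections are. -/
theorem exists_pinRho_eq (φ : EuclideanSpace ℝ (Fin n) ≃ₗᵢ[ℝ] EuclideanSpace ℝ (Fin n)) :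
    ∃ x : PinMinus n, ∀ v, pinRho (negSq n) x v = φ v := by
  have hφ : φ ∈ Subgroup.closure (Set.range fun v : EuclideanSpace ℝ (Fin n) =>
      (ℝ ∙ v)ᗮ.reflection) := by
    rw [LinearIsometryEquiv.reflections_generate]; trivial
  induction hφ using Subgroup.closure_induction with
  | mem φ h =>
    obtain ⟨w, rfl⟩ := h
    by_cases hw : w = 0
    · refine ⟨1, fun v => ?_⟩
      subst hw
      rw [map_one]
      exact (Submodule.reflection_mem_subspace_eq_self (by simp)).symm
    · have hw' : ‖w‖ ≠ 0 := norm_ne_zero_iff.2 hw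
      have hQ : negSq n (‖w‖⁻¹ • w) = -1 := by
        rw [negSq_apply, norm_smul, norm_inv, norm_norm, inv_mul_cancel₀ hw']
        norm_num
      refine ⟨⟨_, ι_mem_pinGroup hQ⟩, fun v => ?_⟩
      apply ι_injective (negSq n)
      rw [ι_pinRho]
      dsimp only
      rw [involute_ι, star_ι, neg_mul, neg_mul_neg, ι_mul_ι_mul_ι, hQ, polar_negSq,
        Submodule.reflection_orthogonal_apply, Submodule.reflection_singleton_apply,
        real_inner_smul_left]
      congr 1
      simp only [RCLike.ofReal_real_eq_id, id_eq, smul_smul, ← Nat.cast_smul_eq_nsmul ℝ]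
      have : ‖w‖⁻¹ * ⟪w, v⟫ * ‖w‖⁻¹ = ⟪w, v⟫ / ‖w‖ ^ 2 := by field_simp
      rw [← this]
      push_cast
      module
  | one => exact ⟨1, fun v => by rw [map_one]; rfl⟩
  | mul φ ψ _ _ hφ hψ =>
    obtain ⟨x, hx⟩ := hφ
    obtain ⟨y, hy⟩ := hψ
    exact ⟨x * y, fun v => by rw [map_mul]; exact (hx _).trans (congrArg φ (hy v))⟩
  | inv φ _ hφ =>
    obtain ⟨x, hx⟩ := hφ
    refine ⟨x⁻¹, fun v => ?_⟩
    have h1 : pinRho (negSq n) x (pinRho (negSq n) x⁻¹ v) = v := by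
      have : (pinRho (negSq n) x * pinRho (negSq n) x⁻¹) v = v := by
        rw [← map_mul, mul_inv_cancel, map_one]; rfl
      exact this
    rw [hx] at h1
    exact (φ.symm_apply_eq.2 h1.symm).symm

end
end OrbPin

namespace OrbPin
open Set Topology
open CliffordAlgebra CliffordAlgebra.EquivEven
open scoped RealInnerProductSpace

section

variable {n : ℕ}

theorem polar_negSqProd (w w' : EuclideanSpace ℝ (Fin n) × ℝ) :
    QuadraticMap.polar (negSqProd n) w w' = -2 * ⟪w.1, w'.1⟫ - 2 * (w.2 * w'.2) := by
  simp only [QuadraticMap.polar, negSqProd_apply, Prod.fst_add, Prod.snd_add]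
  rw [norm_add_sq_real]
  ring

/-- The kernel of `Spin(n + 1) → SO(n + 1)` is `{±1}`. -/
theorem eq_one_or_neg_one_of_spinRho_eq_one {x : SpinSucc n}
    (hx : spinRho (negSqProd n) x = 1) :
    (x : CliffordAlgebra (negSqProd n)) = 1 ∨ (x : CliffordAlgebra (negSqProd n)) = -1 := by
  have hs : star (x : CliffordAlgebra (negSqProd n)) * x = 1 :=
    spinGroup.star_mul_self_of_mem x.2
  let b : Option (Fin n) → EuclideanSpace ℝ (Fin n) × ℝ :=
    fun i => i.elim (0, 1) fun i => (EuclideanSpace.single i 1, 0)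
  have hcomm : ∀ w, (x : CliffordAlgebra (negSqProd n)) * ι (negSqProd n) w =
      ι (negSqProd n) w * x := by
    intro w
    have h := ι_spinRho x w
    rw [hx] at h
    change ι (negSqProd n) w = _ at h
    conv_rhs => rw [h, mul_assoc, hs, mul_one]
  obtain ⟨c, hc⟩ := exists_eq_algebraMap_of_even_of_commute (Q := negSqProd n) (b := b)
    (y := (x : CliffordAlgebra (negSqProd n)))
    (by rintro (_ | i) <;> simp [b, negSq_apply])
    (by
      intro i j hij
      rw [ι_mul_ι_comm, polar_negSqProd]
      have : -2 * ⟪(b i).1, (b j).1⟫ - 2 * ((b i).2 * (b j).2) = 0 := by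
        rcases i with _ | i <;> rcases j with _ | j
        · exact absurd rfl hij
        · simp [b]
        · simp [b]
        · have : i ≠ j := fun h => hij (by rw [h])
          simp [b, EuclideanSpace.inner_single_left, this]
      rw [this, map_zero, zero_sub])
    (by
      rintro ⟨v, r⟩ -
      have hv : (v, r) = ∑ i, v i • b (some i) + r • b none := by
        refine Prod.ext ?_ ?_
        · simp only [b, Option.elim, Prod.fst_add, Prod.fst_sum, Prod.smul_fst, smul_zero, add_zero]
          ext j
          simp [Finset.sum_apply, Pi.single_apply]
        · simp [b, Prod.snd_sum]
      rw [hv]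
      refine add_mem (Submodule.sum_mem _ fun i _ => ?_) ?_ <;>
        exact Submodule.smul_mem _ _ (Submodule.subset_span ⟨_, rfl⟩))
    (spinGroup.involute_eq x.2) (fun i => hcomm _)
  rw [hc, star_algebraMap, ← map_mul, ← map_one (algebraMap ℝ (CliffordAlgebra (negSqProd n)))]
    at hs
  have hc' : c * c = 1 := (algebraMap ℝ (CliffordAlgebra (negSqProd n))).injective hs
  rcases mul_self_eq_one_iff.1 hc' with h | h
  · left; rw [hc, h, map_one]
  · right; rw [hc, h, map_neg, map_one]

theorem exists_coe_pinToSpin_eq_neg_one (hn : n ≠ 0) :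
    ∃ x : PinMinus n, (pinToSpin n x : CliffordAlgebra (negSqProd n)) = -1 := by
  obtain ⟨i⟩ : Nonempty (Fin n) := ⟨⟨0, Nat.pos_of_ne_zero hn⟩⟩
  have hQ : negSq n (EuclideanSpace.single i 1) = -1 := by simp [negSq_apply]
  refine ⟨⟨_, ι_mem_pinGroup hQ⟩ * ⟨_, ι_mem_pinGroup hQ⟩, ?_⟩
  rw [coe_pinToSpin]
  change ((toEven (negSq n) (ι (negSq n) _ * ι (negSq n) _) :
    CliffordAlgebra.even (negSqProd n)) : CliffordAlgebra (negSqProd n)) = -1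
  rw [ι_sq_scalar, hQ, map_neg, map_one, map_neg, map_one]
  rfl

theorem exists_isometry_of_norm_fst_eq
    (L : (EuclideanSpace ℝ (Fin n) × ℝ) ≃L[ℝ] (EuclideanSpace ℝ (Fin n) × ℝ))
    (hL : ∀ v, ‖(L (v, 0)).1‖ = ‖v‖) :
    ∃ φ : EuclideanSpace ℝ (Fin n) ≃ₗᵢ[ℝ] EuclideanSpace ℝ (Fin n), ∀ v, φ v = (L (v, 0)).1 := by
  let f : EuclideanSpace ℝ (Fin n) →ₗ[ℝ] EuclideanSpace ℝ (Fin n) :=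
    { toFun := fun v => (L (v, 0)).1
      map_add' := fun v w => by
        rw [← Prod.fst_add, ← map_add, Prod.mk_add_mk, add_zero]
      map_smul' := fun r v => by
        rw [RingHom.id_apply, ← Prod.smul_fst, ← map_smul, Prod.smul_mk, smul_zero] }
  let φ₀ : EuclideanSpace ℝ (Fin n) →ₗᵢ[ℝ] EuclideanSpace ℝ (Fin n) := ⟨f, fun v => hL v⟩
  exact ⟨φ₀.toLinearIsometryEquiv rfl, fun v => rfl⟩

/-- The elements of `Spin(n + 1)` that preserve the last coordinate axis are those of
`Pin⁻(n)`. For `n = 0` this fails, because then `-1` is not in `Pin⁻(n)`. -/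
theorem exists_pinToSpin_eq (hn : n ≠ 0) {x : SpinSucc n}
    (hx : (spinRho (negSqProd n) x (0, 1)).1 = 0) : ∃ a, pinToSpin n a = x := by
  set w := spinRho (negSqProd n) x (0, 1) with hw
  have hQw : -‖w.1‖ ^ 2 - w.2 * w.2 = -1 := by
    rw [← negSqProd_apply, hw, Q_spinRho, negSqProd_apply]
    simp
  have hw2 : w.2 * w.2 = 1 := by
    rw [hx, norm_zero] at hQw
    linarith
  have hsnd : ∀ v, (spinRho (negSqProd n) x (v, 0)).2 = 0 := by
    intro v
    have h1 := Q_spinRho x (v, 1)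
    have h2 := Q_spinRho x (v, 0)
    have : spinRho (negSqProd n) x (v, 1) = spinRho (negSqProd n) x (v, 0) + w := by
      rw [hw, ← map_add]; simp
    rw [this, negSqProd_apply, negSqProd_apply] at h1
    rw [negSqProd_apply, negSqProd_apply] at h2
    simp only [Prod.fst_add, Prod.snd_add, hx, add_zero] at h1 h2
    have h3 : (spinRho (negSqProd n) x (v, 0)).2 * w.2 = 0 := by linarith
    have hw0 : w.2 ≠ 0 := fun h => by rw [h] at hw2; norm_num at hw2
    exact (mul_eq_zero.1 h3).resolve_right hw0
  have hnorm : ∀ v, ‖(spinRho (negSqProd n) x (v, 0)).1‖ = ‖v‖ := by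
    intro v
    have h := Q_spinRho x (v, 0)
    rw [negSqProd_apply, negSqProd_apply, hsnd] at h
    dsimp only at h
    refine (sq_eq_sq₀ (norm_nonneg _) (norm_nonneg _)).1 ?_
    linarith
  obtain ⟨φ, hφ⟩ := exists_isometry_of_norm_fst_eq (spinRho (negSqProd n) x) hnorm
  obtain ⟨a, ha⟩ := exists_pinRho_eq φ
  have ha' : ∀ v, spinRho (negSqProd n) x (v, 0) = spinRho (negSqProd n) (pinToSpin n a) (v, 0) := by
    intro v
    rw [spinRho_pinToSpin_inl, ha, hφ]
    exact Prod.ext rfl (hsnd v)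
  have hinv : ∀ w, spinRho (negSqProd n) (pinToSpin n a)⁻¹
      (spinRho (negSqProd n) (pinToSpin n a) w) = w := by
    intro w
    have : (spinRho (negSqProd n) (pinToSpin n a)⁻¹ * spinRho (negSqProd n) (pinToSpin n a)) w
        = w := by
      rw [← map_mul, inv_mul_cancel, map_one]; rfl
    exact this
  have hmul : ∀ w, spinRho (negSqProd n) ((pinToSpin n a)⁻¹ * x) w =
      spinRho (negSqProd n) (pinToSpin n a)⁻¹ (spinRho (negSqProd n) x w) := by
    intro w
    rw [map_mul]; rfl
  have h0 : spinRho (negSqProd n) (pinToSpin n a)⁻¹ (0, 1) = (0, 1) ∨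
      spinRho (negSqProd n) (pinToSpin n a)⁻¹ (0, 1) = (0, -1) := by
    have h1 : (pinToSpin n a)⁻¹ = pinToSpin n a⁻¹ :=
      inv_eq_of_mul_eq_one_right (by rw [← map_mul, mul_inv_cancel, map_one])
    rw [h1]
    exact spinRho_pinToSpin_inr a⁻¹
  have hneg : ((0, -1) : EuclideanSpace ℝ (Fin n) × ℝ) = -(0, 1) := by simp
  have hker : spinRho (negSqProd n) ((pinToSpin n a)⁻¹ * x) = 1 := by
    refine spinRho_eq_one (fun v => ?_) ?_
    · rw [hmul, ha', hinv]
    · rw [hmul, ← hw]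
      have hw' : w = (0, 1) ∨ w = (0, -1) :=
        (mul_self_eq_one_iff.1 hw2).imp (fun h => Prod.ext hx h) (fun h => Prod.ext hx h)
      rcases hw' with h | h <;> rcases h0 with h' | h' <;> rw [h] <;>
        simp only [hneg, map_neg, h', neg_neg, true_or, or_true]
  rcases eq_one_or_neg_one_of_spinRho_eq_one hker with h | h
  · exact ⟨a, (inv_mul_eq_one.1 (Subtype.ext h))⟩
  · obtain ⟨m, hm⟩ := exists_coe_pinToSpin_eq_neg_one hn
    refine ⟨a * m, ?_⟩
    rw [map_mul]
    have : pinToSpin n m = (pinToSpin n a)⁻¹ * x := Subtype.ext (hm.trans h.symm)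
    rw [this, mul_inv_cancel_left]

/-! ### A local section of `Spin(n + 1) → Sⁿ` -/

/-- The Euclidean norm on `ℝⁿ × ℝ`. -/
noncomputable def prodNorm (w : EuclideanSpace ℝ (Fin n) × ℝ) : ℝ := √(-negSqProd n w)

theorem prodNorm_sq (w : EuclideanSpace ℝ (Fin n) × ℝ) :
    prodNorm w ^ 2 = -negSqProd n w := by
  rw [prodNorm, Real.sq_sqrt]
  rw [negSqProd_apply]
  nlinarith [sq_nonneg ‖w.1‖, mul_self_nonneg w.2]

theorem prodNorm_pos {w : EuclideanSpace ℝ (Fin n) × ℝ} (hw : w ≠ 0) : 0 < prodNorm w := by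
  refine Real.sqrt_pos.2 ?_
  rw [negSqProd_apply]
  by_contra! h
  refine hw (Prod.ext ?_ ?_)
  · refine norm_eq_zero.1 (pow_eq_zero_iff two_ne_zero |>.1 ?_)
    nlinarith [sq_nonneg ‖w.1‖, mul_self_nonneg w.2]
  · refine mul_self_eq_zero.1 ?_
    nlinarith [sq_nonneg ‖w.1‖, mul_self_nonneg w.2]

theorem continuous_prodNorm : Continuous (prodNorm (n := n)) := by
  unfold prodNorm
  simp only [negSqProd_apply]
  fun_prop

/-- The direction of the bisector of `e₀ = (0, 1)` and `w`. -/
noncomputable def bisector (w : EuclideanSpace ℝ (Fin n) × ℝ) : EuclideanSpace ℝ (Fin n) × ℝ :=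
  w + prodNorm w • (0, 1)

theorem continuous_bisector : Continuous (bisector (n := n)) := by
  unfold bisector
  have := continuous_prodNorm (n := n)
  fun_prop

theorem prodNorm_bisector_sq (w : EuclideanSpace ℝ (Fin n) × ℝ) :
    prodNorm (bisector w) ^ 2 = 2 * prodNorm w * (prodNorm w + w.2) := by
  have h := prodNorm_sq w
  rw [prodNorm_sq, negSqProd_apply, bisector]
  rw [negSqProd_apply] at h
  simp
  linarith

/-- The rotation of `ℝⁿ × ℝ` that takes `e₀ = (0, 1)` to the direction of `w`, as the product of
the unit vectors `bisector w` and `e₀`, up to sign. -/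
theorem exists_spin_section :
    ∃ s : {w : EuclideanSpace ℝ (Fin n) × ℝ // bisector w ≠ 0} → SpinSucc n, Continuous s ∧
      ∀ w, spinRho (negSqProd n) (s w) (0, 1) = (prodNorm w.1)⁻¹ • w.1 := by
  have hQ : ∀ w : {w : EuclideanSpace ℝ (Fin n) × ℝ // bisector w ≠ 0},
      negSqProd n ((prodNorm (bisector w.1))⁻¹ • bisector w.1) = -1 := by
    intro w
    have h := prodNorm_pos w.2
    have h' := prodNorm_sq (bisector w.1)
    rw [QuadraticMap.map_smul, smul_eq_mul]
    field_simp
    linarith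
  have he : negSqProd n (0, 1) = -1 := by simp
  refine ⟨fun w => ⟨ι _ ((prodNorm (bisector w.1))⁻¹ • bisector w.1) * ι _ (0, 1),
    spinGroup.mem_iff.2 ⟨mul_mem (ι_mem_pinGroup (hQ w)) (ι_mem_pinGroup he),
      ι_mul_ι_mem_evenOdd_zero _ _ _⟩⟩, ?_, ?_⟩
  · refine Continuous.subtype_mk
      (Continuous.mul ((continuous_ι (negSqProd n)).comp ?_) continuous_const) _
    refine Continuous.smul (Continuous.inv₀ ?_ fun w => (prodNorm_pos w.2).ne') ?_
    · exact continuous_prodNorm.comp (continuous_bisector.comp continuous_subtype_val)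
    · exact continuous_bisector.comp continuous_subtype_val
  · intro w
    apply ι_injective (negSqProd n)
    rw [ι_spinRho (Q := negSqProd n)]
    dsimp only
    set a := (prodNorm (bisector w.1))⁻¹ • bisector w.1 with ha
    have h1 : ι (negSqProd n) (0, 1) * ι (negSqProd n) (0, 1) = -1 := by
      rw [ι_sq_scalar, he, map_neg, map_one]
    rw [star_mul, star_ι, star_ι, neg_mul_neg]
    have h2 : ι (negSqProd n) a * ι (negSqProd n) (0, 1) * ι (negSqProd n) (0, 1) *
        (ι (negSqProd n) (0, 1) * ι (negSqProd n) a) =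
        -(ι (negSqProd n) a * ι (negSqProd n) (0, 1) * ι (negSqProd n) a) := by
      rw [mul_assoc (ι (negSqProd n) a), h1, mul_neg_one, neg_mul, mul_assoc]
    rw [h2, ι_mul_ι_mul_ι, hQ, polar_negSqProd, ← map_neg]
    refine congrArg _ ?_
    have hb := prodNorm_pos w.2
    have hb2 := prodNorm_bisector_sq w.1
    have hN : prodNorm w.1 ≠ 0 := by
      intro h
      rw [h, mul_zero, zero_mul] at hb2
      exact hb.ne' (pow_eq_zero_iff two_ne_zero |>.1 hb2)
    have hN' : prodNorm w.1 + w.1.2 ≠ 0 := by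
      intro h
      rw [h, mul_zero] at hb2
      exact hb.ne' (pow_eq_zero_iff two_ne_zero |>.1 hb2)
    have ha2 : (prodNorm (bisector w.1))⁻¹ * a.2 = (2 * prodNorm w.1)⁻¹ := by
      rw [ha]
      have : (bisector w.1).2 = w.1.2 + prodNorm w.1 := by simp [bisector]
      rw [Prod.smul_snd, smul_eq_mul, ← mul_assoc, ← mul_inv, ← sq, hb2, this]
      field_simp
      ring
    have : (-2 * ⟪a.1, (0 : EuclideanSpace ℝ (Fin n))⟫ - 2 * (a.2 * 1)) • a =
        -(prodNorm w.1)⁻¹ • bisector w.1 := by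
      conv_lhs => rw [inner_zero_right]
      nth_rewrite 2 [ha]
      rw [smul_smul]
      congr 1
      rw [show (-2 * 0 - 2 * (a.2 * 1)) * (prodNorm (bisector w.1))⁻¹ =
        -2 * ((prodNorm (bisector w.1))⁻¹ * a.2) by ring, ha2]
      field_simp
    rw [this, bisector, smul_add, smul_smul, neg_mul, inv_mul_cancel₀ hN]
    module

end
end OrbPin

namespace OrbPin
open Set Topology
open scoped RealInnerProductSpace

/-! ### Square roots of positive definite operators -/

section Sqrt

variable {F : Type*} [NormedAddCommGroup F] [InnerProductSpace ℝ F] [FiniteDimensional ℝ F]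

/-- The symmetric positive definite operators. -/
def posDef (F : Type*) [NormedAddCommGroup F] [InnerProductSpace ℝ F] : Set (F →L[ℝ] F) :=
  {S | (S : F →ₗ[ℝ] F).IsSymmetric ∧ ∀ v, v ≠ 0 → 0 < ⟪S v, v⟫}

theorem exists_posDef_mul_self {G : F →L[ℝ] F} (hG : G ∈ posDef F) :
    ∃ S ∈ posDef F, S * S = G := by
  have hsym := hG.1
  let b := hsym.eigenvectorBasis rfl
  let μ := hsym.eigenvalues rfl
  have hμ : ∀ i, G (b i) = μ i • b i := fun i => hsym.apply_eigenvectorBasis rfl i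
  have hpos : ∀ i, 0 < μ i := by
    intro i
    have h := hG.2 (b i) (b.orthonormal.ne_zero i)
    rw [hμ, real_inner_smul_left, real_inner_self_eq_norm_sq, b.orthonormal.1 i] at h
    simpa using h
  let S : F →L[ℝ] F := LinearMap.toContinuousLinearMap
    (b.toBasis.constr ℝ fun i => √(μ i) • b i)
  have hS : ∀ i, S (b i) = √(μ i) • b i := by
    intro i
    have := b.toBasis.constr_basis ℝ (fun i => √(μ i) • b i) i
    rw [b.coe_toBasis] at this
    exact this
  have hSv : ∀ v, S v = ∑ i, ⟪b i, v⟫ • √(μ i) • b i := by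
    intro v
    conv_lhs => rw [← b.sum_repr' v]
    simp only [map_sum, map_smul, hS]
  have hin : ∀ v w, ⟪S v, w⟫ = ∑ i, √(μ i) * (⟪b i, v⟫ * ⟪b i, w⟫) := by
    intro v w
    rw [hSv, sum_inner]
    refine Finset.sum_congr rfl fun i _ => ?_
    rw [real_inner_smul_left, real_inner_smul_left]
    ring
  refine ⟨S, ⟨fun v w => ?_, fun v hv => ?_⟩, ?_⟩
  · change ⟪S v, w⟫ = ⟪v, S w⟫
    rw [real_inner_comm (S w) v, hin, hin]
    exact Finset.sum_congr rfl fun i _ => by ring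
  · rw [hin]
    have hex : ∃ i, ⟪b i, v⟫ ≠ 0 := by
      by_contra! h
      refine hv ?_
      rw [← b.sum_repr' v]
      simp [h]
    obtain ⟨i, hi⟩ := hex
    refine Finset.sum_pos' (fun j _ => mul_nonneg (Real.sqrt_nonneg _) (mul_self_nonneg _))
      ⟨i, Finset.mem_univ _, mul_pos (Real.sqrt_pos.2 (hpos i)) ?_⟩
    exact lt_of_le_of_ne (mul_self_nonneg _) (Ne.symm (mul_self_ne_zero.2 hi))
  · have : (S * S : F →L[ℝ] F).toLinearMap = (G : F →ₗ[ℝ] F) := by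
      refine b.toBasis.ext fun i => ?_
      rw [b.coe_toBasis]
      change S (S (b i)) = G (b i)
      rw [hS, map_smul, hS, hμ, smul_smul, Real.mul_self_sqrt (hpos i).le]
    exact ContinuousLinearMap.coe_injective this

/-- A Lipschitz estimate for the square root, from the eigenvectors of the difference. -/
theorem norm_sub_le_of_posDef {S T : F →L[ℝ] F} (hS : S ∈ posDef F) (hT : T ∈ posDef F) {m : ℝ}
    (hm : 0 < m) (hSm : ∀ v, m * ‖v‖ ^ 2 ≤ ⟪S v, v⟫) :
    ‖T - S‖ ≤ Module.finrank ℝ F * (‖T * T - S * S‖ / m) := by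
  have hsym : ((T - S : F →L[ℝ] F) : F →ₗ[ℝ] F).IsSymmetric := hT.1.sub hS.1
  let b := hsym.eigenvectorBasis rfl
  let μ := hsym.eigenvalues rfl
  have hμ : ∀ i, (T - S) (b i) = μ i • b i := fun i => hsym.apply_eigenvectorBasis rfl i
  have hb : ∀ i, ‖b i‖ = 1 := b.orthonormal.1
  have hle : ∀ i, |μ i| ≤ ‖T * T - S * S‖ / m := by
    intro i
    have h1 : ⟪(T * T - S * S) (b i), b i⟫ = μ i * (⟪T (b i), b i⟫ + ⟪S (b i), b i⟫) := by
      have e1 : (T * T - S * S) (b i) = T ((T - S) (b i)) + (T - S) (S (b i)) := by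
        simp
      have e2 : ⟪(T - S) (S (b i)), b i⟫ = ⟪S (b i), (T - S) (b i)⟫ := hsym _ _
      rw [e1, inner_add_left, e2, hμ, map_smul, real_inner_smul_left, real_inner_smul_right]
      ring
    have hTp : 0 < ⟪T (b i), b i⟫ := hT.2 _ (b.orthonormal.ne_zero i)
    have hSp : m ≤ ⟪S (b i), b i⟫ := by simpa [hb] using hSm (b i)
    have h2 : |⟪(T * T - S * S) (b i), b i⟫| ≤ ‖T * T - S * S‖ := by
      refine (abs_real_inner_le_norm _ _).trans ?_
      rw [hb, mul_one]
      refine ((T * T - S * S).le_opNorm _).trans_eq ?_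
      rw [hb, mul_one]
    rw [le_div_iff₀ hm]
    refine le_trans ?_ h2
    rw [h1, abs_mul]
    refine mul_le_mul_of_nonneg_left ?_ (abs_nonneg _)
    exact le_trans (by linarith) (le_abs_self _)
  refine ContinuousLinearMap.opNorm_le_bound _ (by positivity) fun v => ?_
  have hv : (T - S) v = ∑ i, ⟪b i, v⟫ • μ i • b i := by
    conv_lhs => rw [← b.sum_repr' v]
    simp only [map_sum, map_smul, hμ]
  rw [hv]
  refine (norm_sum_le _ _).trans ?_
  have : ∀ i ∈ Finset.univ, ‖⟪b i, v⟫ • μ i • b i‖ ≤ ‖T * T - S * S‖ / m * ‖v‖ := by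
    intro i _
    rw [norm_smul, norm_smul, hb, mul_one, mul_comm, Real.norm_eq_abs, Real.norm_eq_abs]
    refine mul_le_mul (hle i) ?_ (abs_nonneg _) (by positivity)
    refine (abs_real_inner_le_norm _ _).trans_eq ?_
    rw [hb, one_mul]
  refine (Finset.sum_le_sum this).trans_eq ?_
  rw [Finset.sum_const, nsmul_eq_mul, Finset.card_univ, Fintype.card_fin, mul_assoc]

theorem exists_lower_bound_of_posDef {S : F →L[ℝ] F} (hS : S ∈ posDef F) :
    ∃ m > 0, ∀ v, m * ‖v‖ ^ 2 ≤ ⟪S v, v⟫ := by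
  rcases subsingleton_or_nontrivial F with h | h
  · exact ⟨1, one_pos, fun v => by simp [Subsingleton.elim v 0]⟩
  have hne : (Metric.sphere (0 : F) 1).Nonempty := NormedSpace.sphere_nonempty.2 zero_le_one
  obtain ⟨w, hw, hmin⟩ := (isCompact_sphere (0 : F) 1).exists_isMinOn hne
    (f := fun v => ⟪S v, v⟫) (by fun_prop)
  have hw1 : ‖w‖ = 1 := by simpa using hw
  refine ⟨⟪S w, w⟫, hS.2 w (fun h => by rw [h, norm_zero] at hw1; exact zero_ne_one hw1),
    fun v => ?_⟩
  by_cases hv : v = 0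
  · simp [hv]
  have hv' : ‖v‖ ≠ 0 := norm_ne_zero_iff.2 hv
  have := hmin (a := ‖v‖⁻¹ • v) (by simp [norm_smul, hv'])
  simp only [mem_ofPred_eq, map_smul, real_inner_smul_left, real_inner_smul_right] at this
  calc ⟪S w, w⟫ * ‖v‖ ^ 2 ≤ (‖v‖⁻¹ * (‖v‖⁻¹ * ⟪S v, v⟫)) * ‖v‖ ^ 2 := by gcongr
    _ = ⟪S v, v⟫ := by field_simp

theorem posDef_mul_self_injOn : InjOn (fun S : F →L[ℝ] F => S * S) (posDef F) := by
  intro S hS T hT h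
  obtain ⟨m, hm, hSm⟩ := exists_lower_bound_of_posDef hS
  have := norm_sub_le_of_posDef hS hT hm hSm
  dsimp only at h
  rw [h, sub_self, norm_zero, zero_div, mul_zero, norm_le_zero_iff, sub_eq_zero] at this
  exact this.symm

open Classical in
/-- The positive definite square root of a positive definite operator (and `1` for other
operators). -/
noncomputable def posSqrt (G : F →L[ℝ] F) : F →L[ℝ] F :=
  if h : G ∈ posDef F then (exists_posDef_mul_self h).choose else 1

theorem posSqrt_mem {G : F →L[ℝ] F} (hG : G ∈ posDef F) : posSqrt G ∈ posDef F := by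
  rw [posSqrt, dif_pos hG]
  exact (exists_posDef_mul_self hG).choose_spec.1

theorem posSqrt_mul_self {G : F →L[ℝ] F} (hG : G ∈ posDef F) : posSqrt G * posSqrt G = G := by
  rw [posSqrt, dif_pos hG]
  exact (exists_posDef_mul_self hG).choose_spec.2

theorem eq_posSqrt {G S : F →L[ℝ] F} (hG : G ∈ posDef F) (hS : S ∈ posDef F) (h : S * S = G) :
    S = posSqrt G :=
  posDef_mul_self_injOn hS (posSqrt_mem hG) (h.trans (posSqrt_mul_self hG).symm)

/-- Divided by the lower bound of the square root `S` of `G`, the distance of an operator from `G`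
bounds the distance of its square root from `S`. -/
theorem continuousOn_posSqrt : ContinuousOn (posSqrt (F := F)) (posDef F) := by
  intro G hG
  obtain ⟨m, hm, hSm⟩ := exists_lower_bound_of_posDef (posSqrt_mem hG)
  rw [ContinuousWithinAt, tendsto_iff_norm_sub_tendsto_zero]
  have hlim : Filter.Tendsto (fun G' : F →L[ℝ] F => Module.finrank ℝ F * (‖G' - G‖ / m))
      (𝓝[posDef F] G) (𝓝 0) := by
    have : Continuous fun G' : F →L[ℝ] F => Module.finrank ℝ F * (‖G' - G‖ / m) := by fun_prop
    have h := this.tendsto G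
    simp only [sub_self, norm_zero, zero_div, mul_zero] at h
    exact h.mono_left nhdsWithin_le_nhds
  refine squeeze_zero' (Filter.Eventually.of_forall fun _ => norm_nonneg _) ?_ hlim
  filter_upwards [self_mem_nhdsWithin] with G' hG'
  have := norm_sub_le_of_posDef (posSqrt_mem hG) (posSqrt_mem hG') hm hSm
  rwa [posSqrt_mul_self hG, posSqrt_mul_self hG'] at this

omit [FiniteDimensional ℝ F] in
theorem posDef_injective {S : F →L[ℝ] F} (hS : S ∈ posDef F) : Function.Injective S := by
  rw [injective_iff_map_eq_zero]
  intro v hv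
  by_contra h
  have := hS.2 v h
  rw [hv, inner_zero_left] at this
  exact lt_irrefl _ this

theorem posDef_isUnit {S : F →L[ℝ] F} (hS : S ∈ posDef F) : IsUnit S := by
  have h : Function.Injective (S : F →ₗ[ℝ] F) := posDef_injective hS
  let e := (LinearEquiv.ofInjectiveEndo (S : F →ₗ[ℝ] F) h).toContinuousLinearEquiv
  exact ⟨⟨e, e.symm, by ext v; exact e.apply_symm_apply v, by ext v; exact e.symm_apply_apply v⟩,
    rfl⟩

end Sqrt
end OrbPin

namespace OrbPin
open Set Topology
open scoped RealInnerProductSpace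

namespace ChartFamily

/-! ### The retraction of linear frames onto orthonormal frames -/

variable {n : ℕ} {X : Type u} [TopologicalSpace X]
  {K : ChartFamily (EuclideanSpace ℝ (Fin n)) X}

/-- The Gram operator of a linear frame: the scalar product of the metric, transported to `ℝⁿ` by
the frame, is `⟪gram h e v, w⟫`. -/
noncomputable def gram (h : K.Metric) :
    K.Frame → EuclideanSpace ℝ (Fin n) →L[ℝ] EuclideanSpace ℝ (Fin n) :=
  Quotient.lift (fun c => InnerProductSpace.continuousLinearMapOfBilin
      ((h.inner c.1 c.2.1.1).bilinearComp c.2.1.2 c.2.1.2)) (by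
    rintro ⟨i, ⟨x, A⟩, hx, hA⟩ ⟨j, ⟨y, B⟩, hy, hB⟩ ⟨κ, hκ, hs, hxy, hd⟩
    dsimp only at hκ hs hxy hd
    subst hxy hd
    refine ContinuousLinearMap.ext fun v => ext_inner_right ℝ fun w => ?_
    rw [InnerProductSpace.continuousLinearMapOfBilin_apply,
      InnerProductSpace.continuousLinearMapOfBilin_apply]
    exact (h.invariant i j κ hκ x hs (A v) (A w)).symm)

theorem inner_gram_mkFrame (h : K.Metric) (i : K.ι) (q : K.LocalFrame i)
    (v w : EuclideanSpace ℝ (Fin n)) :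
    ⟪gram h (K.mkFrame i q) v, w⟫ = h.inner i q.1.1 (q.1.2 v) (q.1.2 w) :=
  InnerProductSpace.continuousLinearMapOfBilin_apply _ _ _

theorem gram_mem_posDef (h : K.Metric) (e : K.Frame) : gram h e ∈ posDef _ := by
  obtain ⟨i, q, rfl⟩ := K.exists_mkFrame_eq e
  refine ⟨fun v w => ?_, fun v hv => ?_⟩
  · change ⟪gram h (K.mkFrame i q) v, w⟫ = ⟪v, gram h (K.mkFrame i q) w⟫
    rw [real_inner_comm (gram h (K.mkFrame i q) w) v, inner_gram_mkFrame, inner_gram_mkFrame]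
    exact h.symm i _ q.2.1 _ _
  · rw [inner_gram_mkFrame]
    refine h.pos i _ q.2.1 _ fun h0 => hv (q.2.2.1 ?_)
    rw [h0, map_zero]

theorem mem_orthonormalFrames_iff (h : K.Metric) (e : K.Frame) :
    e ∈ K.orthonormalFrames (negSq n) h ↔ ∀ v, ⟪gram h e v, v⟫ = ‖v‖ ^ 2 := by
  constructor
  · rintro ⟨⟨i, q⟩, rfl, hc⟩ v
    refine (inner_gram_mkFrame h i q v v).trans ((hc v).trans ?_)
    rw [negSq_apply, neg_neg]
  · intro he
    obtain ⟨i, q, rfl⟩ := K.exists_mkFrame_eq e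
    refine ⟨⟨i, q⟩, rfl, fun v => ?_⟩
    rw [negSq_apply, neg_neg, ← he v, inner_gram_mkFrame]

theorem gram_eq_one {h : K.Metric} {e : K.Frame}
    (he : e ∈ K.orthonormalFrames (negSq n) h) : gram h e = 1 := by
  rw [mem_orthonormalFrames_iff] at he
  have hsym : ((gram h e : EuclideanSpace ℝ (Fin n) →ₗ[ℝ] EuclideanSpace ℝ (Fin n)) -
      LinearMap.id).IsSymmetric :=
    (gram_mem_posDef h e).1.sub (LinearMap.IsSymmetric.id)
  have h0 := (LinearMap.IsSymmetric.inner_map_self_eq_zero hsym).1 (fun v => by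
    change ⟪gram h e v - v, v⟫ = 0
    rw [inner_sub_left, he, real_inner_self_eq_norm_sq, sub_self])
  refine ContinuousLinearMap.ext fun v => sub_eq_zero.1 ?_
  exact congrArg (fun f => f v) h0

theorem inner_gram_act (h : K.Metric)
    (L : EuclideanSpace ℝ (Fin n) ≃L[ℝ] EuclideanSpace ℝ (Fin n)) (e : K.Frame)
    (v w : EuclideanSpace ℝ (Fin n)) :
    ⟪gram h (Frame.act L e) v, w⟫ = ⟪gram h e (L v), L w⟫ := by
  obtain ⟨i, q, rfl⟩ := K.exists_mkFrame_eq e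
  rw [Frame.act_mkFrame, inner_gram_mkFrame, inner_gram_mkFrame]
  rfl

theorem act_mem_orthonormalFrames {h : K.Metric} {e : K.Frame}
    {L : EuclideanSpace ℝ (Fin n) ≃L[ℝ] EuclideanSpace ℝ (Fin n)} (hL : ∀ v, ‖L v‖ = ‖v‖)
    (he : e ∈ K.orthonormalFrames (negSq n) h) :
    Frame.act L e ∈ K.orthonormalFrames (negSq n) h := by
  rw [mem_orthonormalFrames_iff] at he ⊢
  intro v
  rw [inner_gram_act, he, hL]

theorem continuous_gram (h : K.Metric) : Continuous (gram h) := by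
  rw [Frame.continuous_iff]
  intro i
  rw [continuous_clm_apply]
  intro v
  let b := EuclideanSpace.basisFun (Fin n) ℝ
  have hsum : ∀ q, gram h (K.mkFrame i q) v =
      ∑ k, h.inner i q.1.1 (q.1.2 v) (q.1.2 (b k)) • b k := by
    intro q
    rw [← b.sum_repr' (gram h (K.mkFrame i q) v)]
    refine Finset.sum_congr rfl fun k _ => ?_
    rw [real_inner_comm, inner_gram_mkFrame]
  simp only [hsum]
  refine continuous_finsetSum _ fun k _ => ?_
  have h1 : Continuous fun q : K.LocalFrame i => h.inner i q.1.1 :=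
    (h.continuousOn i).comp_continuous (continuous_fst.comp continuous_subtype_val)
      fun q => q.2.1
  have h2 : Continuous fun q : K.LocalFrame i => q.1.2 :=
    continuous_snd.comp continuous_subtype_val
  exact ((h1.clm_apply (h2.clm_apply continuous_const)).clm_apply
    (h2.clm_apply continuous_const)).smul continuous_const

/-- The linear automorphism `(gram h e)^(-1/2)`. -/
noncomputable def orthonormalizer (h : K.Metric) (e : K.Frame) :
    EuclideanSpace ℝ (Fin n) ≃L[ℝ] EuclideanSpace ℝ (Fin n) :=
  ContinuousLinearEquiv.ofUnit (posDef_isUnit (posSqrt_mem (gram_mem_posDef h e))).unit⁻¹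

theorem coe_orthonormalizer (h : K.Metric) (e : K.Frame) :
    (orthonormalizer h e : EuclideanSpace ℝ (Fin n) →L[ℝ] EuclideanSpace ℝ (Fin n)) =
      Ring.inverse (posSqrt (gram h e)) := by
  have hu := posDef_isUnit (posSqrt_mem (gram_mem_posDef h e))
  have : Ring.inverse (posSqrt (gram h e)) = ((hu.unit⁻¹ : Units _) : _ →L[ℝ] _) := by
    conv_lhs => rw [← hu.unit_spec]
    exact Ring.inverse_unit _
  rw [this]
  rfl

theorem posSqrt_orthonormalizer (h : K.Metric) (e : K.Frame) (v : EuclideanSpace ℝ (Fin n)) :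
    posSqrt (gram h e) (orthonormalizer h e v) = v := by
  have hu := posDef_isUnit (posSqrt_mem (gram_mem_posDef h e))
  have h1 : posSqrt (gram h e) *
      (orthonormalizer h e : EuclideanSpace ℝ (Fin n) →L[ℝ] EuclideanSpace ℝ (Fin n)) = 1 := by
    rw [coe_orthonormalizer, Ring.mul_inverse_cancel _ hu]
  exact congrArg (fun f => f v) h1

theorem orthonormalizer_posSqrt (h : K.Metric) (e : K.Frame) (v : EuclideanSpace ℝ (Fin n)) :
    orthonormalizer h e (posSqrt (gram h e) v) = v := by
  have hu := posDef_isUnit (posSqrt_mem (gram_mem_posDef h e))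
  have h1 : (orthonormalizer h e : EuclideanSpace ℝ (Fin n) →L[ℝ] EuclideanSpace ℝ (Fin n)) *
      posSqrt (gram h e) = 1 := by
    rw [coe_orthonormalizer, Ring.inverse_mul_cancel _ hu]
  exact congrArg (fun f => f v) h1

/-- The orthonormal factor `e (gram h e)^(-1/2)` in the polar decomposition of a linear frame. -/
noncomputable def polarFrame (h : K.Metric) (e : K.Frame) : K.Frame :=
  Frame.act (orthonormalizer h e) e

theorem continuous_polarFrame (h : K.Metric) : Continuous (polarFrame h) := by
  have h1 : Continuous fun e =>
      (orthonormalizer h e : EuclideanSpace ℝ (Fin n) →L[ℝ] EuclideanSpace ℝ (Fin n)) := by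
    simp only [coe_orthonormalizer]
    rw [continuous_iff_continuousAt]
    intro e
    have hu := posDef_isUnit (posSqrt_mem (gram_mem_posDef h e))
    have h2 : ContinuousAt Ring.inverse (posSqrt (gram h e)) := by
      conv in posSqrt _ => rw [← hu.unit_spec]
      exact NormedRing.inverse_continuousAt _
    have h3 : Continuous fun e => posSqrt (gram h e) :=
      continuousOn_posSqrt.comp_continuous (continuous_gram h) (gram_mem_posDef h)
    exact ContinuousAt.comp (f := fun e => posSqrt (gram h e)) h2 h3.continuousAt
  have h2 := Frame.continuous_act (K := K) (L := fun e => orthonormalizer h e) h1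
  have h3 : Continuous fun e : K.Frame => (e, e) := continuous_id.prodMk continuous_id
  have h4 := h2.comp h3
  exact h4.congr fun e => rfl

theorem polarFrame_mem (h : K.Metric) (e : K.Frame) :
    polarFrame h e ∈ K.orthonormalFrames (negSq n) h := by
  rw [mem_orthonormalFrames_iff]
  intro v
  have hG := gram_mem_posDef h e
  have h1 : gram h e (orthonormalizer h e v) = posSqrt (gram h e) v := by
    have := congrArg (fun f => f (orthonormalizer h e v)) (posSqrt_mul_self hG)
    rw [← this, mul_apply_eq_comp, posSqrt_orthonormalizer]
  have hs : ∀ v w, ⟪posSqrt (gram h e) v, w⟫ = ⟪v, posSqrt (gram h e) w⟫ := (posSqrt_mem hG).1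
  rw [polarFrame, inner_gram_act, h1, hs, posSqrt_orthonormalizer, real_inner_self_eq_norm_sq]

theorem polarFrame_eq_self {h : K.Metric} {e : K.Frame}
    (he : e ∈ K.orthonormalFrames (negSq n) h) : polarFrame h e = e := by
  have h1 : posSqrt (gram h e) = 1 := by
    refine (eq_posSqrt (gram_mem_posDef h e) ?_ ?_).symm
    · rw [← gram_eq_one he]; exact gram_mem_posDef h e
    · rw [gram_eq_one he, one_mul]
  have h2 : orthonormalizer h e = 1 := by
    ext1
    funext v
    have := posSqrt_orthonormalizer h e v
    rwa [h1] at this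
  rw [polarFrame, h2, Frame.act_one]

/-- Polar decomposition commutes with orthogonal maps, by uniqueness of the square root. -/
theorem polarFrame_act (h : K.Metric) (e : K.Frame)
    {L : EuclideanSpace ℝ (Fin n) ≃L[ℝ] EuclideanSpace ℝ (Fin n)} (hL : ∀ v, ‖L v‖ = ‖v‖) :
    polarFrame h (Frame.act L e) = Frame.act L (polarFrame h e) := by
  have hin : ∀ v w, ⟪L v, L w⟫ = ⟪v, w⟫ := fun v w =>
    (LinearMap.norm_map_iff_inner_map_map L).1 hL v w
  have hin' : ∀ v w, ⟪L.symm v, w⟫ = ⟪v, L w⟫ := fun v w => by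
    rw [← hin, L.apply_symm_apply]
  have hG := gram_mem_posDef h e
  have hS := posSqrt_mem hG
  let T : EuclideanSpace ℝ (Fin n) →L[ℝ] EuclideanSpace ℝ (Fin n) :=
    (L.symm : _ →L[ℝ] _) ∘L posSqrt (gram h e) ∘L (L : _ →L[ℝ] _)
  have hTa : ∀ v, T v = L.symm (posSqrt (gram h e) (L v)) := fun v => rfl
  have hT : T = posSqrt (gram h (Frame.act L e)) := by
    refine eq_posSqrt (gram_mem_posDef h _) ⟨fun v w => ?_, fun v hv => ?_⟩ ?_
    · change ⟪T v, w⟫ = ⟪v, T w⟫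
      rw [hTa, hTa, hin', real_inner_comm (L.symm _) v, hin', real_inner_comm (L v)]
      exact hS.1 _ _
    · rw [hTa, hin']
      exact hS.2 _ fun h0 => hv (L.injective (by rw [h0, map_zero]))
    · refine ContinuousLinearMap.ext fun v => ext_inner_right ℝ fun w => ?_
      rw [inner_gram_act]
      change ⟪T (T v), w⟫ = _
      rw [hTa, hTa, hin', L.apply_symm_apply]
      conv_rhs => rw [← posSqrt_mul_self hG]
      rfl
  rw [polarFrame, polarFrame, Frame.act_act, Frame.act_act]
  congr 1
  ext1
  funext v
  change L (orthonormalizer h (Frame.act L e) v) = orthonormalizer h e (L v)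
  have h1 := posSqrt_orthonormalizer h (Frame.act L e) v
  rw [← hT, hTa, L.symm_apply_eq] at h1
  rw [← h1, orthonormalizer_posSqrt]

end ChartFamily
end OrbPin

namespace OrbPin
open Set Topology

/-- Continuity of a map on a set of frames is checked on the local frames of each chart. -/
theorem ChartFamily.Frame.continuous_subtype {E : Type} [NormedAddCommGroup E] [NormedSpace ℝ E]
    {X : Type u} [TopologicalSpace X] {K : ChartFamily E X} {Z : Type*}
    [TopologicalSpace Z] {V : Set K.Frame} {g : V → Z}
    (hg : ∀ i, Continuous fun q : {q : K.LocalFrame i // K.mkFrame i q ∈ V} =>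
      g ⟨K.mkFrame i q.1, q.2⟩) : Continuous g := by
  rw [continuous_iff_continuousAt]
  rintro ⟨e, he⟩
  obtain ⟨i, q, rfl⟩ := K.exists_mkFrame_eq e
  have ho : IsOpenMap (V.restrictPreimage (K.mkFrame i)) :=
    (K.isOpenMap_mkFrame i).restrictPreimage V
  have hc : Continuous (V.restrictPreimage (K.mkFrame i)) :=
    (K.continuous_mkFrame i).restrictPreimage
  have h := ho.map_nhds_eq (hc.continuousAt (x := ⟨q, he⟩))
  have h' : V.restrictPreimage (K.mkFrame i) ⟨q, he⟩ = ⟨K.mkFrame i q, he⟩ := rfl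
  rw [ContinuousAt, ← h', ← h, Filter.tendsto_map'_iff]
  exact (hg i).continuousAt (x := ⟨q, he⟩)

/-! ### Transitions of the total space cover transitions of the base -/

section Base

variable {n : ℕ} {X : Type u} [TopologicalSpace X] {N : Orbifold n X}
variable {Y : Type u} [TopologicalSpace Y] {B : CircleBundle N Y}

theorem map_fst_of_transition {i j : N.ι}
    {κ : OpenPartialHomeomorph (EuclideanSpace ℝ (Fin n) × ℝ) (EuclideanSpace ℝ (Fin n) × ℝ)}
    (hκ : B.total.IsTransition i j κ) {z : EuclideanSpace ℝ (Fin n) × ℝ} (hz : z ∈ κ.source) :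
    z.1 ∈ N.dom i ∧ (κ z).1 ∈ N.dom j ∧ N.map j (κ z).1 = N.map i z.1 := by
  have h1 : z.1 ∈ N.dom i := (hκ.source_subset hz).1
  have h2 : (κ z).1 ∈ N.dom j := (hκ.target_subset (κ.map_source hz)).1
  have h := congrArg B.proj (hκ.map_eq z hz)
  exact ⟨h1, h2, (B.proj_triv j _ h2 _).symm.trans (h.trans (B.proj_triv i _ h1 _))⟩

/-- The fibres of an orbifold chart are orbits, hence finite. -/
theorem finite_fiber (N : Orbifold n X) (j : N.ι) (p : X) :
    {y | y ∈ N.dom j ∧ N.map j y = p}.Finite := by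
  rcases eq_empty_or_nonempty {y | y ∈ N.dom j ∧ N.map j y = p} with h | ⟨y, hy, rfl⟩
  · rw [h]; exact finite_empty
  · refine (finite_range fun g => N.act j g y).subset ?_
    rintro z ⟨hz, h⟩
    exact (N.map_eq_iff j y hy z hz).1 h.symm

/-- Along a connected piece of a fibre, a transition of the total space does not change the base
point, since the fibres of the charts of the base are finite. -/
theorem fst_transition_eq {i j : N.ι}
    {κ : OpenPartialHomeomorph (EuclideanSpace ℝ (Fin n) × ℝ) (EuclideanSpace ℝ (Fin n) × ℝ)}
    (hκ : B.total.IsTransition i j κ) {x : EuclideanSpace ℝ (Fin n)} {I : Set ℝ}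
    (hI : IsPreconnected I) (hxI : ∀ t ∈ I, (x, t) ∈ κ.source) {t t' : ℝ} (ht : t ∈ I)
    (ht' : t' ∈ I) : (κ (x, t)).1 = (κ (x, t')).1 := by
  have hT := finite_fiber N j (N.map i x)
  have hc : ContinuousOn (fun t => (κ (x, t)).1) I :=
    continuous_fst.comp_continuousOn (κ.continuousOn.comp (by fun_prop) hxI)
  exact hI.constant_of_mapsTo hT.isDiscrete hc
      (fun t ht => (map_fst_of_transition hκ (hxI t ht)).2) ht ht'

/-- A transition of the total space covers a transition of the base. -/
theorem exists_base_transition {i j : N.ι}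
    {κ : OpenPartialHomeomorph (EuclideanSpace ℝ (Fin n) × ℝ) (EuclideanSpace ℝ (Fin n) × ℝ)}
    (hκ : B.total.IsTransition i j κ) {x : EuclideanSpace ℝ (Fin n)} {t : ℝ}
    (hz : (x, t) ∈ κ.source) :
    ∃ μ : OpenPartialHomeomorph (EuclideanSpace ℝ (Fin n)) (EuclideanSpace ℝ (Fin n)),
      N.toChartFamily.IsTransition i j μ ∧ x ∈ μ.source ∧
      (∀ᶠ z in 𝓝 (x, t), (κ z).1 = μ z.1) ∧ μ x = (κ (x, t)).1 ∧
      ∀ w, (fderiv ℝ κ (x, t) w).1 = fderiv ℝ μ x w.1 := by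
  -- products of balls on which `κ` and its inverse are defined
  obtain ⟨ε, hε, hball⟩ := Metric.isOpen_iff.1 κ.open_source _ hz
  obtain ⟨δ, hδ, hball'⟩ := Metric.isOpen_iff.1 κ.open_target _ (κ.map_source hz)
  obtain ⟨⟨y, s⟩, hys⟩ : ∃ w, w = κ (x, t) := ⟨_, rfl⟩
  rw [← hys] at hball'
  rw [← ball_prod_same] at hball hball'
  have hys' : κ.symm (y, s) = (x, t) := by rw [hys, κ.left_inv hz]
  have hf : ∀ x' ∈ Metric.ball x ε, ∀ t' ∈ Metric.ball t ε, (κ (x', t')).1 = (κ (x', t)).1 :=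
    fun x' hx' t' ht' => fst_transition_eq hκ (convex_ball t ε).isPreconnected
      (fun t hI => hball ⟨hx', hI⟩) ht' (Metric.mem_ball_self hε)
  have hf' : ∀ y' ∈ Metric.ball y δ, ∀ s' ∈ Metric.ball s δ,
      (κ.symm (y', s')).1 = (κ.symm (y', s)).1 :=
    fun y' hy' s' hs' => fst_transition_eq hκ.symm (convex_ball s δ).isPreconnected
      (fun t hI => hball' ⟨hy', hI⟩) hs' (Metric.mem_ball_self hδ)
  have hm : ∀ x' ∈ Metric.ball x ε, (x', t) ∈ κ.source :=
    fun x' hx' => hball ⟨hx', Metric.mem_ball_self hε⟩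
  have hm' : ∀ y' ∈ Metric.ball y δ, (y', s) ∈ κ.target :=
    fun y' hy' => hball' ⟨hy', Metric.mem_ball_self hδ⟩
  have hsm : ContDiffOn ℝ ∞ (fun x' => (κ (x', t)).1) (Metric.ball x ε) :=
    contDiff_fst.comp_contDiffOn (hκ.contDiffOn.comp (by fun_prop) hm)
  have hsm' : ContDiffOn ℝ ∞ (fun y' => (κ.symm (y', s)).1) (Metric.ball y δ) :=
    contDiff_fst.comp_contDiffOn (hκ.contDiffOn_symm.comp (by fun_prop) hm')
  have hinv : ∀ x' ∈ Metric.ball x ε, κ (x', t) ∈ Metric.ball y δ ×ˢ Metric.ball s δ →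
      (κ.symm ((κ (x', t)).1, s)).1 = x' := by
    intro x' hx' h
    rw [← hf' _ h.1 _ h.2]
    change (κ.symm (κ (x', t))).1 = x'
    rw [κ.left_inv (hm x' hx')]
  have hinv' : ∀ y' ∈ Metric.ball y δ, κ.symm (y', s) ∈ Metric.ball x ε ×ˢ Metric.ball t ε →
      (κ ((κ.symm (y', s)).1, t)).1 = y' := by
    intro y' hy' h
    rw [← hf _ h.1 _ h.2]
    change (κ (κ.symm (y', s))).1 = y'
    rw [κ.right_inv (hm' y' hy')]
  let S : Set (EuclideanSpace ℝ (Fin n)) := Metric.ball x ε ∩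
    (fun x' => κ (x', t)) ⁻¹' (Metric.ball y δ ×ˢ Metric.ball s δ)
  let T : Set (EuclideanSpace ℝ (Fin n)) := Metric.ball y δ ∩
    (fun y' => κ.symm (y', s)) ⁻¹' (Metric.ball x ε ×ˢ Metric.ball t ε)
  have hSo : IsOpen S := (κ.continuousOn.comp (by fun_prop) hm).isOpen_inter_preimage
    Metric.isOpen_ball (Metric.isOpen_ball.prod Metric.isOpen_ball)
  have hTo : IsOpen T := (κ.symm.continuousOn.comp (by fun_prop) hm').isOpen_inter_preimage
    Metric.isOpen_ball (Metric.isOpen_ball.prod Metric.isOpen_ball)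
  have hso : IsOpen (S ∩ (fun x' => (κ (x', t)).1) ⁻¹' T) :=
    (hsm.continuousOn.mono inter_subset_left).isOpen_inter_preimage hSo hTo
  have hto : IsOpen (T ∩ (fun y' => (κ.symm (y', s)).1) ⁻¹' S) :=
    (hsm'.continuousOn.mono inter_subset_left).isOpen_inter_preimage hTo hSo
  let μ : OpenPartialHomeomorph (EuclideanSpace ℝ (Fin n)) (EuclideanSpace ℝ (Fin n)) :=
    { toFun := fun x' => (κ (x', t)).1
      invFun := fun y' => (κ.symm (y', s)).1
      source := S ∩ (fun x' => (κ (x', t)).1) ⁻¹' T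
      target := T ∩ (fun y' => (κ.symm (y', s)).1) ⁻¹' S
      map_source' := fun x' hx' => by
        refine ⟨hx'.2, ?_⟩
        rw [mem_preimage, hinv x' hx'.1.1 hx'.1.2]
        exact hx'.1
      map_target' := fun y' hy' => by
        refine ⟨hy'.2, ?_⟩
        rw [mem_preimage, hinv' y' hy'.1.1 hy'.1.2]
        exact hy'.1
      left_inv' := fun x' hx' => hinv x' hx'.1.1 hx'.1.2
      right_inv' := fun y' hy' => hinv' y' hy'.1.1 hy'.1.2
      open_source := hso
      open_target := hto
      continuousOn_toFun := hsm.continuousOn.mono fun _ h => h.1.1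
      continuousOn_invFun := hsm'.continuousOn.mono fun _ h => h.1.1 }
  have hxS : x ∈ μ.source := by
    refine ⟨⟨Metric.mem_ball_self hε, ?_⟩, ?_, ?_⟩
    · rw [mem_preimage, ← hys]
      exact ⟨Metric.mem_ball_self hδ, Metric.mem_ball_self hδ⟩
    · change (κ (x, t)).1 ∈ _
      rw [← hys]; exact Metric.mem_ball_self hδ
    · change κ.symm ((κ (x, t)).1, s) ∈ Metric.ball x ε ×ˢ Metric.ball t ε
      rw [← hys, hys']
      exact ⟨Metric.mem_ball_self hε, Metric.mem_ball_self hε⟩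
  have hev : ∀ᶠ z in 𝓝 (x, t), (κ z).1 = μ z.1 := by
    have : Metric.ball x ε ×ˢ Metric.ball t ε ∈ 𝓝 (x, t) :=
      prod_mem_nhds (Metric.ball_mem_nhds x hε) (Metric.ball_mem_nhds t hε)
    filter_upwards [this] with z hz using hf z.1 hz.1 z.2 hz.2
  have hμ : N.toChartFamily.IsTransition i j μ :=
    { source_subset := fun x' hx' => (hκ.source_subset (hm x' hx'.1.1)).1
      target_subset := fun y' hy' => (hκ.target_subset (hm' y' hy'.1.1)).1
      contDiffOn := hsm.mono fun _ h => h.1.1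
      contDiffOn_symm := hsm'.mono fun _ h => h.1.1
      map_eq := fun x' hx' => (map_fst_of_transition hκ (hm x' hx'.1.1)).2.2 }
  refine ⟨μ, hμ, hxS, hev, rfl, fun w => ?_⟩
  have h1 : HasFDerivAt (fun z => (κ z).1)
      ((ContinuousLinearMap.fst ℝ _ _).comp (fderiv ℝ κ (x, t))) (x, t) :=
    (hκ.differentiableAt hz).hasFDerivAt.fst
  have h2 : HasFDerivAt (fun z : EuclideanSpace ℝ (Fin n) × ℝ => μ z.1)
      ((fderiv ℝ μ x).comp (ContinuousLinearMap.fst ℝ _ _)) (x, t) :=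
    HasFDerivAt.comp (x, t) (hμ.differentiableAt hxS).hasFDerivAt hasFDerivAt_fst
  exact congrArg (fun f => f w) (h1.unique (h2.congr_of_eventuallyEq hev))

/-! ### Vertical frames and the frames below them -/

/-- The endomorphism of `ℝⁿ` induced by an endomorphism of `ℝⁿ × ℝ`. -/
noncomputable def baseLin
    (A : (EuclideanSpace ℝ (Fin n) × ℝ) →L[ℝ] (EuclideanSpace ℝ (Fin n) × ℝ)) :
    EuclideanSpace ℝ (Fin n) →L[ℝ] EuclideanSpace ℝ (Fin n) :=
  (ContinuousLinearMap.fst ℝ _ _).comp (A.comp (ContinuousLinearMap.inl ℝ _ _))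

theorem baseLin_apply (A : (EuclideanSpace ℝ (Fin n) × ℝ) →L[ℝ] (EuclideanSpace ℝ (Fin n) × ℝ))
    (v : EuclideanSpace ℝ (Fin n)) : baseLin A v = (A (v, 0)).1 := rfl

theorem continuous_baseLin : Continuous (baseLin (n := n)) := by
  unfold baseLin
  fun_prop

theorem fst_apply_of_vertical
    {A : (EuclideanSpace ℝ (Fin n) × ℝ) →L[ℝ] (EuclideanSpace ℝ (Fin n) × ℝ)}
    (hv : (A (0, 1)).1 = 0) (w : EuclideanSpace ℝ (Fin n) × ℝ) :
    (A w).1 = baseLin A w.1 := by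
  have : w = (w.1, 0) + w.2 • (0, 1) := by simp
  rw [baseLin_apply]
  conv_lhs => rw [this]
  rw [map_add, map_smul, Prod.fst_add, Prod.smul_fst, hv, smul_zero, add_zero]

theorem bijective_baseLin
    {A : (EuclideanSpace ℝ (Fin n) × ℝ) →L[ℝ] (EuclideanSpace ℝ (Fin n) × ℝ)}
    (hA : Function.Bijective A) (hv : (A (0, 1)).1 = 0) : Function.Bijective (baseLin A) := by
  have hsurj : Function.Surjective (baseLin A) := by
    intro v
    obtain ⟨w, hw⟩ := hA.2 (v, 0)
    exact ⟨w.1, by rw [← fst_apply_of_vertical hv, hw]⟩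
  have hinj : Function.Injective (baseLin A).toLinearMap :=
    LinearMap.injective_iff_surjective.2 hsurj
  exact ⟨hinj, hsurj⟩

/-- The frame of the base below a vertical frame. -/
noncomputable def baseLocal {i : N.ι} (q : B.total.LocalFrame i) (hv : (q.1.2 (0, 1)).1 = 0) :
    N.LocalFrame i :=
  ⟨(q.1.1.1, baseLin q.1.2), q.2.1.1, bijective_baseLin q.2.2 hv⟩

theorem frameOver_iff_exists {e : B.total.Frame} {d : N.Frame} :
    FrameOver B e d ↔ ∃ i, ∃ (q : B.total.LocalFrame i) (hv : (q.1.2 (0, 1)).1 = 0),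
      e = B.total.mkFrame i q ∧ d = N.mkFrame i (baseLocal q hv) := by
  constructor
  · rintro ⟨i, x, t, A, D, hx, hA, hD, rfl, rfl, h1, h2⟩
    obtain rfl : baseLin A = D := ContinuousLinearMap.ext h1
    exact ⟨i, ⟨((x, t), A), ⟨hx, trivial⟩, hA⟩, h2, rfl, rfl⟩
  · rintro ⟨i, ⟨⟨⟨x, t⟩, A⟩, hx, hA⟩, hv, rfl, rfl⟩
    exact ⟨i, x, t, A, baseLin A, hx.1, hA, bijective_baseLin hA hv, rfl, rfl, fun _ => rfl, hv⟩

/-- Being vertical and the class of the frame below do not depend on the chart. -/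
theorem frameOver_mkFrame_iff {i : N.ι} (q : B.total.LocalFrame i) (d : N.Frame) :
    FrameOver B (B.total.mkFrame i q) d ↔
      ∃ hv : (q.1.2 (0, 1)).1 = 0, d = N.mkFrame i (baseLocal q hv) := by
  rw [frameOver_iff_exists]
  constructor
  · rintro ⟨j, q', hv', h, rfl⟩
    obtain ⟨κ, hκ, hs, hxy, hd⟩ := Quotient.exact h.symm
    obtain ⟨⟨⟨x', t'⟩, A'⟩, hx', hA'⟩ := q'
    obtain ⟨⟨⟨x, t⟩, A⟩, hx, hA⟩ := q
    dsimp only at hκ hs hxy hd hv'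
    obtain ⟨μ, hμ, hxs, -, hμx, hμd⟩ := exists_base_transition hκ hs
    have hv : (A (0, 1)).1 = 0 := by
      rw [hd]
      change (fderiv ℝ κ (x', t') (A' (0, 1))).1 = 0
      rw [hμd, hv', map_zero]
    refine ⟨hv, Quotient.sound ⟨μ, hμ, hxs, ?_, ?_⟩⟩
    · exact hμx.trans (congrArg Prod.fst hxy)
    · refine ContinuousLinearMap.ext fun v => ?_
      change baseLin A v = fderiv ℝ μ x' (baseLin A' v)
      rw [baseLin_apply, hd, baseLin_apply]
      exact hμd _
  · rintro ⟨hv, rfl⟩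
    exact ⟨i, q, hv, rfl, rfl⟩

theorem FrameOver.unique {e : B.total.Frame} {d d' : N.Frame} (h : FrameOver B e d)
    (h' : FrameOver B e d') : d = d' := by
  obtain ⟨i, q, rfl⟩ := B.total.exists_mkFrame_eq e
  obtain ⟨_, rfl⟩ := (frameOver_mkFrame_iff q d).1 h
  obtain ⟨_, rfl⟩ := (frameOver_mkFrame_iff q d').1 h'
  rfl

theorem FrameOver.act {e : B.total.Frame} {d : N.Frame} (h : FrameOver B e d)
    {L : (EuclideanSpace ℝ (Fin n) × ℝ) ≃L[ℝ] (EuclideanSpace ℝ (Fin n) × ℝ)}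
    {l : EuclideanSpace ℝ (Fin n) ≃L[ℝ] EuclideanSpace ℝ (Fin n)}
    (hL : ∀ v, (L (v, 0)).1 = l v) (hL' : (L (0, 1)).1 = 0) :
    FrameOver B (ChartFamily.Frame.act L e) (ChartFamily.Frame.act l d) := by
  obtain ⟨i, q, hv, rfl, rfl⟩ := frameOver_iff_exists.1 h
  have hv' : (q.1.2 (L (0, 1))).1 = 0 := by
    rw [fst_apply_of_vertical hv, hL', map_zero]
  refine (frameOver_mkFrame_iff _ _).2 ⟨hv', ?_⟩
  refine (ChartFamily.Frame.act_mkFrame _ _ _).trans (congrArg (N.mkFrame i) ?_)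
  refine Subtype.ext (Prod.ext rfl (ContinuousLinearMap.ext fun v => ?_))
  change baseLin q.1.2 (l v) = (q.1.2 (L (v, 0))).1
  rw [fst_apply_of_vertical hv, hL]

variable (B) in
/-- The vertical frames of the total space: those whose last vector is tangent to the fibre. -/
def verticalFrames : Set B.total.Frame := {e | ∃ d, FrameOver B e d}

/-- The frame of the base below a vertical frame. -/
noncomputable def baseFrame (e : verticalFrames B) : N.Frame := e.2.choose

theorem frameOver_baseFrame (e : verticalFrames B) : FrameOver B e.1 (baseFrame e) :=
  e.2.choose_spec

theorem baseFrame_eq {e : verticalFrames B} {d : N.Frame} (h : FrameOver B e.1 d) :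
    baseFrame e = d := (frameOver_baseFrame e).unique h

theorem mkFrame_mem_verticalFrames {i : N.ι} {q : B.total.LocalFrame i} :
    B.total.mkFrame i q ∈ verticalFrames B ↔ (q.1.2 (0, 1)).1 = 0 :=
  ⟨fun ⟨d, h⟩ => ((frameOver_mkFrame_iff q d).1 h).1,
    fun h => ⟨_, (frameOver_mkFrame_iff q _).2 ⟨h, rfl⟩⟩⟩

theorem continuous_baseFrame : Continuous (baseFrame (B := B)) := by
  refine ChartFamily.Frame.continuous_subtype fun i => ?_
  have h : ∀ q : {q : B.total.LocalFrame i // B.total.mkFrame i q ∈ verticalFrames B},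
      baseFrame ⟨B.total.mkFrame i q.1, q.2⟩ =
        N.mkFrame i (baseLocal q.1 (mkFrame_mem_verticalFrames.1 q.2)) := fun q =>
    baseFrame_eq ((frameOver_mkFrame_iff _ _).2 ⟨_, rfl⟩)
  simp only [h]
  refine (N.continuous_mkFrame i).comp (Continuous.subtype_mk (Continuous.prodMk ?_ ?_) _)
  · exact continuous_fst.comp (continuous_fst.comp
      (continuous_subtype_val.comp continuous_subtype_val))
  · exact continuous_baseLin.comp (continuous_snd.comp
      (continuous_subtype_val.comp continuous_subtype_val))

end Base
end OrbPin

namespace OrbPin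
open Set Topology
open ChartFamily

/-! ### Restriction of frame coverings -/

/-- The restriction of a covering of a set of frames to an invariant subset. -/
def FrameCover.restrict {E : Type} [NormedAddCommGroup E] [NormedSpace ℝ E]
    {X : Type u} [TopologicalSpace X] {K : ChartFamily E X}
    {Γ : Type} [Monoid Γ] [TopologicalSpace Γ] {ρ : Γ →* (E ≃L[ℝ] E)} {S : Set K.Frame}
    (F : FrameCover K ρ S) (T : Set K.Frame) (hTS : T ⊆ S)
    (hT : ∀ e ∈ T, ∀ a, Frame.act (ρ a) e ∈ T) : FrameCover K ρ T where
  P := {p : F.P // (F.proj p : K.Frame) ∈ T}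
  act p a := ⟨F.act p.1 a, by rw [F.proj_act]; exact hT _ p.2 a⟩
  proj p := ⟨F.proj p.1, p.2⟩
  act_one p := Subtype.ext (F.act_one p.1)
  act_mul p a b := Subtype.ext (F.act_mul p.1 a b)
  continuous_act := Continuous.subtype_mk (F.continuous_act.comp
    ((continuous_subtype_val.comp continuous_fst).prodMk continuous_snd)) _
  isCoveringMap := by
    have h := F.isCoveringMap.restrictPreimage {e : S | (e : K.Frame) ∈ T}
    let H : {e : S | (e : K.Frame) ∈ T} ≃ₜ T :=
      { toFun := fun e => ⟨e.1.1, e.2⟩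
        invFun := fun e => ⟨⟨e.1, hTS e.2⟩, e.2⟩
        left_inv := fun _ => rfl
        right_inv := fun _ => rfl
        continuous_toFun := by fun_prop
        continuous_invFun := by fun_prop }
    exact h.homeomorph_comp H
  two_sheeted e := by
    rw [← F.two_sheeted ⟨e.1, hTS e.2⟩]
    exact Nat.card_congr
      { toFun := fun p => ⟨p.1.1, Subtype.ext (congrArg (fun e : T => e.1) p.2)⟩
        invFun := fun p => ⟨⟨p.1, by
          have h : (F.proj p.1 : K.Frame) = e.1 := congrArg Subtype.val p.2
          exact (congrArg (fun x => x ∈ T) h).mpr e.2⟩,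
          Subtype.ext (congrArg (fun e : S => e.1) p.2)⟩
        left_inv := fun _ => rfl
        right_inv := fun _ => rfl }
  proj_act p a := F.proj_act p.1 a
  free_ker p a ha hp := F.free_ker p.1 a ha (congrArg Subtype.val hp)

/-! ### The vertical line in the coordinates of a frame -/

section Vertical

variable {n : ℕ} {X : Type u} [TopologicalSpace X] {N : Orbifold n X}
variable {Y : Type u} [TopologicalSpace Y] {B : CircleBundle N Y}

variable (B) in
theorem exists_mkFrame_eq_total (e : B.total.Frame) :
    ∃ (i : N.ι) (q : B.total.LocalFrame i), B.total.mkFrame i q = e :=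
  B.total.exists_mkFrame_eq e

theorem inverse_apply_of_bijective {E : Type} [NormedAddCommGroup E] [NormedSpace ℝ E]
    [CompleteSpace E] {A : E →L[ℝ] E} (hA : Function.Bijective A) (w : E) :
    A (Ring.inverse A w) = w ∧ Ring.inverse A (A w) = w := by
  have hu : IsUnit A := ContinuousLinearMap.isUnit_iff_bijective.2 hA
  exact ⟨congrArg (fun f => f w) (Ring.mul_inverse_cancel A hu),
    congrArg (fun f => f w) (Ring.inverse_mul_cancel A hu)⟩

/-- The differential of a transition of the total space preserves the vertical direction. -/
theorem fderiv_transition_vertical {i j : N.ι}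
    {κ : OpenPartialHomeomorph (EuclideanSpace ℝ (Fin n) × ℝ) (EuclideanSpace ℝ (Fin n) × ℝ)}
    (hκ : B.total.IsTransition i j κ) {z : EuclideanSpace ℝ (Fin n) × ℝ} (hz : z ∈ κ.source) :
    ∃ c : ℝ, c ≠ 0 ∧ fderiv ℝ κ z (0, 1) = c • (0, 1) := by
  obtain ⟨μ, -, -, -, -, hd⟩ := exists_base_transition hκ hz
  have h1 : (fderiv ℝ κ z (0, 1)).1 = 0 := by
    rw [hd, map_zero]
  have h2 : fderiv ℝ κ z (0, 1) = (fderiv ℝ κ z (0, 1)).2 • (0, 1) :=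
    Prod.ext (by simpa using h1) (by simp)
  refine ⟨_, fun h => ?_, h2⟩
  rw [h, zero_smul] at h2
  have h3 := (hκ.bijective_fderiv hz).1 (h2.trans (map_zero _).symm)
  exact one_ne_zero (congrArg Prod.snd h3)

/-- The vector `w` of the model space whose value under a frame is vertical and that has last
coordinate `1`. It is the junk value `0` if there is no such vector. -/
noncomputable def slopeVector : B.total.Frame → EuclideanSpace ℝ (Fin n) × ℝ :=
  Quotient.lift (fun c => (Ring.inverse c.2.1.2 (0, 1)).2⁻¹ • Ring.inverse c.2.1.2 (0, 1)) (by
    rintro ⟨i, ⟨z, A⟩, hz, hA⟩ ⟨j, ⟨z', A'⟩, hz', hA'⟩ ⟨κ, hκ, hs, hxy, hd⟩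
    dsimp only at hκ hs hxy hd ⊢
    obtain ⟨c, hc, hcd⟩ := fderiv_transition_vertical hκ hs
    have h1 : Ring.inverse A (0, 1) = c • Ring.inverse A' (0, 1) := by
      apply hA'.1
      rw [map_smul, (inverse_apply_of_bijective hA' _).1, ← hcd, hd]
      change fderiv ℝ κ z (A (Ring.inverse A (0, 1))) = _
      rw [(inverse_apply_of_bijective hA _).1]
    rw [h1, Prod.smul_snd, smul_smul, smul_eq_mul, mul_inv, mul_right_comm, inv_mul_cancel₀ hc,
      one_mul])

theorem slopeVector_mkFrame {i : N.ι} (q : B.total.LocalFrame i) :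
    slopeVector (B.total.mkFrame i q) =
      (Ring.inverse q.1.2 (0, 1)).2⁻¹ • Ring.inverse q.1.2 (0, 1) := rfl

theorem slopeVector_mkFrame_ne_zero_iff {i : N.ι} (q : B.total.LocalFrame i) :
    (slopeVector (B.total.mkFrame i q)).2 ≠ 0 ↔ (Ring.inverse q.1.2 (0, 1)).2 ≠ 0 := by
  rw [slopeVector_mkFrame, Prod.smul_snd, smul_eq_mul]
  constructor
  · rintro h h'
    rw [h', mul_zero] at h
    exact h rfl
  · intro h
    rw [inv_mul_cancel₀ h]
    exact one_ne_zero

theorem slopeVector_snd {e : B.total.Frame} (he : (slopeVector e).2 ≠ 0) :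
    (slopeVector e).2 = 1 := by
  obtain ⟨i, q, rfl⟩ := exists_mkFrame_eq_total B e
  rw [slopeVector_mkFrame_ne_zero_iff] at he
  rw [slopeVector_mkFrame, Prod.smul_snd, smul_eq_mul, inv_mul_cancel₀ he]

theorem continuous_inverse_localFrame (i : N.ι) : Continuous fun q : B.total.LocalFrame i =>
    Ring.inverse q.1.2 ((0, 1) : EuclideanSpace ℝ (Fin n) × ℝ) := by
  have h : Continuous fun q : B.total.LocalFrame i => Ring.inverse q.1.2 := by
    rw [continuous_iff_continuousAt]
    intro q
    obtain ⟨u, hu⟩ := ContinuousLinearMap.isUnit_iff_bijective.2 q.2.2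
    have h2 : ContinuousAt Ring.inverse q.1.2 := by
      rw [← hu]
      exact NormedRing.inverse_continuousAt _
    exact h2.comp (f := fun q : B.total.LocalFrame i => q.1.2)
        (continuous_snd.comp continuous_subtype_val).continuousAt
  exact h.clm_apply continuous_const

theorem isOpen_slopeVector_ne_zero : IsOpen {e : B.total.Frame | (slopeVector e).2 ≠ 0} := by
  rw [← B.total.isOpenQuotientMap_frame_mk.isQuotientMap.isOpen_preimage, isOpen_sigma_iff]
  intro i
  have h : IsOpen {q : B.total.LocalFrame i |
      (Ring.inverse q.1.2 ((0, 1) : EuclideanSpace ℝ (Fin n) × ℝ)).2 ≠ 0} :=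
    isOpen_ne_fun (continuous_snd.comp (continuous_inverse_localFrame i)) continuous_const
  convert h using 1
  ext q
  exact slopeVector_mkFrame_ne_zero_iff q

theorem continuous_slopeVector :
    Continuous fun e : {e : B.total.Frame | (slopeVector e).2 ≠ 0} => slopeVector e.1 := by
  refine Frame.continuous_subtype fun i => ?_
  have h := (continuous_inverse_localFrame (B := B) i).comp (continuous_subtype_val
    (p := fun q => B.total.mkFrame i q ∈ {e : B.total.Frame | (slopeVector e).2 ≠ 0}))
  refine (Continuous.smul (Continuous.inv₀ (continuous_snd.comp h) fun q => ?_) h)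
  exact (slopeVector_mkFrame_ne_zero_iff q.1).1 q.2

theorem act_mkFrame_mem_verticalFrames {i : N.ι} {q : B.total.LocalFrame i}
    {L : (EuclideanSpace ℝ (Fin n) × ℝ) ≃L[ℝ] (EuclideanSpace ℝ (Fin n) × ℝ)} :
    Frame.act L (B.total.mkFrame i q) ∈ verticalFrames B ↔ (q.1.2 (L (0, 1))).1 = 0 :=
  mkFrame_mem_verticalFrames (B := B) (i := i)
    (q := ⟨(q.1.1, q.1.2.comp L.toContinuousLinearMap), q.2.1, q.2.2.comp L.bijective⟩)

theorem slopeVector_act_mkFrame_ne_zero {i : N.ι} {q : B.total.LocalFrame i}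
    {L : (EuclideanSpace ℝ (Fin n) × ℝ) ≃L[ℝ] (EuclideanSpace ℝ (Fin n) × ℝ)} {r : ℝ}
    (hr : r ≠ 0) (hL : L (0, 1) = r • Ring.inverse q.1.2 (0, 1)) :
    (slopeVector (Frame.act L (B.total.mkFrame i q))).2 ≠ 0 := by
  have hbij : Function.Bijective (q.1.2.comp L.toContinuousLinearMap) := q.2.2.comp L.bijective
  refine (slopeVector_mkFrame_ne_zero_iff (B := B)
    (⟨(q.1.1, q.1.2.comp L.toContinuousLinearMap), q.2.1, hbij⟩ : B.total.LocalFrame i)).2 ?_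
  have h1 : Ring.inverse (q.1.2.comp L.toContinuousLinearMap) (0, 1) = r⁻¹ • (0, 1) := by
    apply hbij.1
    rw [(inverse_apply_of_bijective hbij _).1, map_smul]
    change _ = _ • q.1.2 (L (0, 1))
    rw [hL, map_smul, (inverse_apply_of_bijective q.2.2 _).1, inv_smul_smul₀ hr]
  change (Ring.inverse (q.1.2.comp L.toContinuousLinearMap) (0, 1)).2 ≠ 0
  rw [h1]
  simpa using hr

/-- A linear map that sends the last vector into the line of the slope vector turns a frame into
a vertical one. -/
theorem act_mem_verticalFrames_of_slopeVector {e : B.total.Frame}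
    {L : (EuclideanSpace ℝ (Fin n) × ℝ) ≃L[ℝ] (EuclideanSpace ℝ (Fin n) × ℝ)} {c : ℝ}
    (hL : L (0, 1) = c • slopeVector e) : Frame.act L e ∈ verticalFrames B := by
  obtain ⟨i, q, rfl⟩ := exists_mkFrame_eq_total B e
  refine act_mkFrame_mem_verticalFrames.2 ?_
  rw [hL, slopeVector_mkFrame, map_smul, map_smul, (inverse_apply_of_bijective q.2.2 _).1]
  simp

/-- The linear maps between vertical frames preserve the line spanned by the last vector. -/
theorem fst_eq_zero_of_mem_verticalFrames {e : B.total.Frame}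
    {L : (EuclideanSpace ℝ (Fin n) × ℝ) ≃L[ℝ] (EuclideanSpace ℝ (Fin n) × ℝ)}
    (he : e ∈ verticalFrames B) (he' : Frame.act L e ∈ verticalFrames B) : (L (0, 1)).1 = 0 := by
  obtain ⟨i, q, rfl⟩ := exists_mkFrame_eq_total B e
  have h1 : (q.1.2 (0, 1)).1 = 0 := mkFrame_mem_verticalFrames.1 he
  have h2 : (q.1.2 (L (0, 1))).1 = 0 := act_mkFrame_mem_verticalFrames.1 he'
  rw [fst_apply_of_vertical h1] at h2
  exact (bijective_baseLin q.2.2 h1).1 (h2.trans (map_zero _).symm)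

/-- Every frame can be rotated, continuously near a given one, to a vertical frame. -/
theorem exists_spin_vertical (e₀ : B.total.Frame) : ∃ (U : Set B.total.Frame)
    (u : U → SpinSucc n), IsOpen U ∧ e₀ ∈ U ∧ Continuous u ∧
      ∀ e : U, Frame.act (spinRho (negSqProd n) (u e)) e.1 ∈ verticalFrames B := by
  obtain ⟨s, hs, hsw⟩ := exists_spin_section (n := n)
  have hb : ∀ w : EuclideanSpace ℝ (Fin n) × ℝ, 0 < w.2 → bisector w ≠ 0 := by
    intro w hw h
    have h1 := congrArg Prod.snd h
    have h2 : 0 ≤ prodNorm w := Real.sqrt_nonneg _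
    simp [bisector] at h1
    linarith
  -- rotate the vertical line of `e₀` to the last axis
  obtain ⟨u₁, hu₁⟩ : ∃ u₁ : SpinSucc n,
      (slopeVector (Frame.act (spinRho (negSqProd n) u₁) e₀)).2 ≠ 0 := by
    obtain ⟨i, q, rfl⟩ := exists_mkFrame_eq_total B e₀
    set w := Ring.inverse q.1.2 ((0, 1) : EuclideanSpace ℝ (Fin n) × ℝ) with hw
    have hqw : q.1.2 w = (0, 1) := (inverse_apply_of_bijective q.2.2 _).1
    have hw0 : w ≠ 0 := by
      intro h
      rw [h, map_zero] at hqw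
      exact zero_ne_one (congrArg Prod.snd hqw)
    obtain ⟨w', hw', c, hc, hcw⟩ : ∃ w', bisector w' ≠ 0 ∧ ∃ c : ℝ, c ≠ 0 ∧ w' = c • w := by
      rcases le_or_gt 0 w.2 with h | h
      · refine ⟨w, fun h0 => ?_, 1, one_ne_zero, (one_smul _ _).symm⟩
        have h1 := congrArg Prod.snd h0
        have h2 := prodNorm_pos hw0
        simp [bisector] at h1
        linarith
      · exact ⟨-w, hb _ (by simpa using h), -1, by norm_num, by simp⟩
    have hw'0 : w' ≠ 0 := by
      rw [hcw]
      exact smul_ne_zero hc hw0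
    refine ⟨s ⟨w', hw'⟩, ?_⟩
    refine slopeVector_act_mkFrame_ne_zero
      (mul_ne_zero (inv_ne_zero (prodNorm_pos hw'0).ne') hc) ?_
    rw [hsw, mul_smul, ← hcw]
  have hact : Continuous (Frame.act (K := B.total) (spinRho (negSqProd n) u₁)) :=
    (Frame.continuous_act (T := Unit) (L := fun _ => spinRho (negSqProd n) u₁)
      continuous_const).comp (Continuous.prodMk_right ())
  let U : Set B.total.Frame :=
    Frame.act (spinRho (negSqProd n) u₁) ⁻¹' {e | (slopeVector e).2 ≠ 0}
  let f : U → {e : B.total.Frame | (slopeVector e).2 ≠ 0} := fun e => ⟨_, e.2⟩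
  have hf : Continuous f := Continuous.subtype_mk (hact.comp continuous_subtype_val) _
  have hfb : ∀ e : U, bisector (slopeVector (f e).1) ≠ 0 := fun e =>
    hb _ (by rw [slopeVector_snd (f e).2]; exact one_pos)
  refine ⟨U, fun e => u₁ * s ⟨slopeVector (f e).1, hfb e⟩,
    isOpen_slopeVector_ne_zero.preimage hact, hu₁, ?_, fun e => ?_⟩
  · exact continuous_const.mul (hs.comp (Continuous.subtype_mk
      (continuous_slopeVector.comp hf) _))
  · rw [map_mul, ← Frame.act_act]
    exact act_mem_verticalFrames_of_slopeVector (hsw _)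

end Vertical
end OrbPin

namespace OrbPin
open Set Topology ChartFamily

/-! ### The covering of the frames of the total space associated with a pin structure -/

section Associated

variable {n : ℕ} {X : Type u} [TopologicalSpace X] {N : Orbifold n X} {h : N.Metric}
variable {Y : Type u} [TopologicalSpace Y] (B : CircleBundle N Y) (π : PinMinusStructure N h)

/-- Triples `(e, u, p)` of a frame `e` of the total space, an element `u` of `Spin(n + 1)` that
rotates `e` to a vertical frame, and a point `p` of the pin structure over the
orthonormalization of the frame of the base below it. -/
def PreCover : Type u :=
  {z : B.total.Frame × SpinSucc n × π.P // ∃ d,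
    FrameOver B (Frame.act (spinRho (negSqProd n) z.2.1) z.1) d ∧
      polarFrame h d = (π.proj z.2.2 : N.Frame)}

instance : TopologicalSpace (PreCover B π) := inferInstanceAs (TopologicalSpace (Subtype _))

variable {B π}

theorem FrameOver.act_pinToSpin {e : B.total.Frame} {d : N.Frame} (hd : FrameOver B e d)
    (a : PinMinus n) : FrameOver B (Frame.act (spinRho (negSqProd n) (pinToSpin n a)) e)
      (Frame.act (pinRho (negSq n) a) d) := by
  refine hd.act (fun v => ?_) ?_
  · rw [spinRho_pinToSpin_inl]
  · rcases spinRho_pinToSpin_inr a with h | h <;> rw [h]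

/-- The right action of `Pin⁻(n)` on the triples. -/
noncomputable def PreCover.act (z : PreCover B π) (a : PinMinus n) : PreCover B π :=
  ⟨(z.1.1, z.1.2.1 * pinToSpin n a, π.act z.1.2.2 a), by
    obtain ⟨d, hd, hp⟩ := z.2
    refine ⟨Frame.act (pinRho (negSq n) a) d, ?_, ?_⟩
    · rw [map_mul, ← Frame.act_act]
      exact hd.act_pinToSpin a
    · rw [polarFrame_act h d (norm_pinRho a), hp, π.proj_act]⟩

theorem PreCover.act_one (z : PreCover B π) : z.act 1 = z :=
  Subtype.ext (Prod.ext rfl (Prod.ext (by simp [PreCover.act]) (π.act_one _)))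

theorem PreCover.act_mul (z : PreCover B π) (a b : PinMinus n) :
    z.act (a * b) = (z.act a).act b :=
  Subtype.ext (Prod.ext rfl (Prod.ext (by simp [PreCover.act, mul_assoc]) (π.act_mul _ _ _)))

theorem PreCover.continuous_act (a : PinMinus n) : Continuous fun z : PreCover B π => z.act a := by
  have h1 : Continuous fun z : PreCover B π => z.1 := continuous_subtype_val
  refine Continuous.subtype_mk (h1.fst.prodMk (Continuous.prodMk ?_ ?_)) _
  · exact h1.snd.fst.mul continuous_const
  · exact π.continuous_act.comp (h1.snd.snd.prodMk continuous_const)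

variable (B π) in
/-- Triples in the same orbit of `Pin⁻(n)` are identified. -/
def coverSetoid : Setoid (PreCover B π) where
  r z w := ∃ a, w = z.act a
  iseqv :=
    { refl := fun z => ⟨1, z.act_one.symm⟩
      symm := by
        rintro z w ⟨a, rfl⟩
        exact ⟨a⁻¹, by rw [← z.act_mul, mul_inv_cancel, z.act_one]⟩
      trans := by
        rintro z w x ⟨a, rfl⟩ ⟨b, rfl⟩
        exact ⟨a * b, (z.act_mul a b).symm⟩ }

variable (B π) in
/-- The total space of the covering of the frame bundle associated with a pin structure. -/
abbrev Cover : Type u := Quotient (coverSetoid B π)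

theorem isOpenQuotientMap_cover_mk : IsOpenQuotientMap (Quotient.mk (coverSetoid B π)) := by
  refine ⟨Quotient.mk_surjective, continuous_quotient_mk', fun W hW => ?_⟩
  rw [← isQuotientMap_quotient_mk'.isOpen_preimage]
  have : Quotient.mk (coverSetoid B π) ⁻¹' (Quotient.mk (coverSetoid B π) '' W) =
      ⋃ a, (fun z : PreCover B π => z.act a) ⁻¹' W := by
    ext z
    rw [mem_iUnion]
    constructor
    · rintro ⟨w, hw, h⟩
      obtain ⟨a, rfl⟩ := Quotient.exact h.symm
      exact ⟨a, hw⟩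
    · rintro ⟨a, ha⟩
      exact ⟨_, ha, (Quotient.sound ⟨a, rfl⟩ : Quotient.mk (coverSetoid B π) z = _).symm⟩
  exact this ▸ isOpen_iUnion fun a => hW.preimage (PreCover.continuous_act a)

/-- The frame under a point of the covering. -/
def Cover.proj : Cover B π → B.total.Frame :=
  Quotient.lift (fun z => z.1.1) (by rintro z w ⟨a, rfl⟩; rfl)

theorem Cover.continuous_proj : Continuous (Cover.proj (B := B) (π := π)) :=
  continuous_quot_lift _ (continuous_fst.comp continuous_subtype_val)

/-- The right action of `Spin(n + 1)` on the triples. -/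
noncomputable def PreCover.spinAct (z : PreCover B π) (a : SpinSucc n) : PreCover B π :=
  ⟨(Frame.act (spinRho (negSqProd n) a) z.1.1, a⁻¹ * z.1.2.1, z.1.2.2), by
    obtain ⟨d, hd, hp⟩ := z.2
    refine ⟨d, ?_, hp⟩
    rw [Frame.act_act, ← map_mul, mul_inv_cancel_left]
    exact hd⟩

/-- The right action of `Spin(n + 1)` on the covering. -/
noncomputable def Cover.act (c : Cover B π) (a : SpinSucc n) : Cover B π :=
  Quotient.map (fun z : PreCover B π => z.spinAct a) (by
    rintro z w ⟨b, rfl⟩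
    exact ⟨b, Subtype.ext (Prod.ext rfl (Prod.ext (mul_assoc _ _ _).symm rfl))⟩) c

theorem continuous_act_spinRho {T : Type*} [TopologicalSpace T] {u : T → SpinSucc n}
    (hu : Continuous u) {e : T → B.total.Frame} (he : Continuous e) :
    Continuous fun t => Frame.act (spinRho (negSqProd n) (u t)) (e t) := by
  have hL : Continuous fun t => (spinRho (negSqProd n) (u t)).toContinuousLinearMap :=
    continuous_spinRho.comp hu
  have h1 := Frame.continuous_act (K := B.total) hL
  have h2 : Continuous fun t => (t, e t) := continuous_id.prodMk he
  have h3 := h1.comp h2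
  exact h3

theorem PreCover.continuous_spinAct :
    Continuous fun z : PreCover B π × SpinSucc n => z.1.spinAct z.2 := by
  have h1 : Continuous fun z : PreCover B π × SpinSucc n => z.1.1 :=
    continuous_subtype_val.comp continuous_fst
  refine Continuous.subtype_mk (Continuous.prodMk ?_ (Continuous.prodMk ?_ h1.snd.snd)) _
  · exact continuous_act_spinRho continuous_snd h1.fst
  · exact (continuous_inv_spin.comp continuous_snd).mul h1.snd.fst

theorem Cover.continuous_act : Continuous fun z : Cover B π × SpinSucc n => z.1.act z.2 := by
  have h1 := (isOpenQuotientMap_cover_mk (B := B) (π := π)).prodMap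
    (IsOpenQuotientMap.id (X := SpinSucc n))
  rw [← h1.continuous_comp_iff]
  exact continuous_quotient_mk'.comp PreCover.continuous_spinAct

/-! ### Trivializations of the covering over rotations to vertical frames -/

/-- Over a set of frames that are rotated to vertical ones by `u`, the points of the covering
correspond to points of the pin structure. -/
theorem Cover.exists_mk_eq (hn : n ≠ 0) (c : Cover B π) (u : SpinSucc n)
    (hu : Frame.act (spinRho (negSqProd n) u) c.proj ∈ verticalFrames B) :
    ∃ p, ∃ hp : ∃ d, FrameOver B (Frame.act (spinRho (negSqProd n) u) c.proj) d ∧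
      polarFrame h d = (π.proj p : N.Frame), c = Quotient.mk _ ⟨(c.proj, u, p), hp⟩ := by
  obtain ⟨z, rfl⟩ := Quotient.mk_surjective c
  obtain ⟨a, ha⟩ := exists_pinToSpin_eq hn (x := z.1.2.1⁻¹ * u) (by
    obtain ⟨d, hd, -⟩ := z.2
    refine fst_eq_zero_of_mem_verticalFrames (B := B) ⟨d, hd⟩ ?_
    rw [Frame.act_act, ← map_mul, mul_inv_cancel_left]
    exact hu)
  have hz : (z.act a).1.2.1 = u := by
    change z.1.2.1 * pinToSpin n a = u
    rw [ha, mul_inv_cancel_left]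
  obtain ⟨⟨⟨e, u', p⟩, hp⟩, hw⟩ : ∃ w, w = z.act a := ⟨_, rfl⟩
  have hu' : u' = u := by rw [← hw] at hz; exact hz
  have he : e = z.1.1 := congrArg (fun w : PreCover B π => w.1.1) hw
  subst hu' he
  exact ⟨p, hp, (Quotient.sound ⟨a, hw⟩ : Quotient.mk (coverSetoid B π) z = _)⟩

theorem Cover.mk_eq_mk_iff {e : B.total.Frame} {u : SpinSucc n} {p p' : π.P} {hp hp'} :
    (Quotient.mk (coverSetoid B π) ⟨(e, u, p), hp⟩ = Quotient.mk _ ⟨(e, u, p'), hp'⟩) ↔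
      p = p' := by
  constructor
  · intro h
    obtain ⟨a, ha⟩ := Quotient.exact h
    have h1 : u = u * pinToSpin n a := congrArg (fun w : PreCover B π => w.1.2.1) ha
    have h2 : p' = π.act p a := congrArg (fun w : PreCover B π => w.1.2.2) ha
    have h3 : a = 1 := pinToSpin_injective (by rw [map_one]; simpa using h1.symm)
    rw [h2, h3, π.act_one]
  · rintro rfl
    rfl

/-- The point of the pin structure that corresponds to a point of the covering over a frame that
is rotated to a vertical one by `u`. -/
noncomputable def Cover.fiberCoord (hn : n ≠ 0) (c : Cover B π) (u : SpinSucc n)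
    (hu : Frame.act (spinRho (negSqProd n) u) c.proj ∈ verticalFrames B) : π.P :=
  (c.exists_mk_eq hn u hu).choose

theorem Cover.fiberCoord_spec (hn : n ≠ 0) (c : Cover B π) (u : SpinSucc n)
    (hu : Frame.act (spinRho (negSqProd n) u) c.proj ∈ verticalFrames B) :
    ∃ hp, c = Quotient.mk (coverSetoid B π) ⟨(c.proj, u, c.fiberCoord hn u hu), hp⟩ :=
  (c.exists_mk_eq hn u hu).choose_spec

theorem Cover.fiberCoord_eq (hn : n ≠ 0) {c : Cover B π} {u : SpinSucc n}
    (hu : Frame.act (spinRho (negSqProd n) u) c.proj ∈ verticalFrames B) {p : π.P} {e hp}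
    (hc : c = Quotient.mk (coverSetoid B π) ⟨(e, u, p), hp⟩) : c.fiberCoord hn u hu = p := by
  obtain ⟨hp', h⟩ := c.fiberCoord_spec hn u hu
  have he : c.proj = e := by rw [hc]; rfl
  subst he
  exact Cover.mk_eq_mk_iff.1 (h.symm.trans hc)

theorem Cover.continuous_fiberCoord (hn : n ≠ 0) {U : Set B.total.Frame} {u : U → SpinSucc n}
    (hu : Continuous u)
    (huv : ∀ e : U, Frame.act (spinRho (negSqProd n) (u e)) e.1 ∈ verticalFrames B) :
    Continuous fun c : Cover.proj (B := B) (π := π) ⁻¹' U =>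
      c.1.fiberCoord hn (u ⟨_, c.2⟩) (huv ⟨_, c.2⟩) := by
  let V : Set (Cover B π) := Cover.proj ⁻¹' U
  have hq : IsOpenQuotientMap (V.restrictPreimage (Quotient.mk (coverSetoid B π))) :=
    ⟨Quotient.mk_surjective.restrictPreimage _,
      isOpenQuotientMap_cover_mk.continuous.restrictPreimage,
      isOpenQuotientMap_cover_mk.isOpenMap.restrictPreimage _⟩
  rw [← hq.continuous_comp_iff]
  let U' := Quotient.mk (coverSetoid B π) ⁻¹' V
  have hex : ∀ z : U', ∃ a, pinToSpin n a = z.1.1.2.1⁻¹ * u ⟨z.1.1.1, z.2⟩ := by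
    intro z
    refine exists_pinToSpin_eq hn ?_
    obtain ⟨d, hd, -⟩ := z.1.2
    refine fst_eq_zero_of_mem_verticalFrames (B := B) ⟨d, hd⟩ ?_
    rw [Frame.act_act, ← map_mul, mul_inv_cancel_left]
    exact huv ⟨z.1.1.1, z.2⟩
  choose b hb using hex
  have h0 : Continuous fun z : U' => z.1.1 := continuous_subtype_val.comp continuous_subtype_val
  have hbc : Continuous b := by
    rw [isEmbedding_pinToSpin.continuous_iff]
    have : Continuous fun z : U' => z.1.1.2.1⁻¹ * u ⟨z.1.1.1, z.2⟩ :=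
      (continuous_inv_spin.comp h0.snd.fst).mul (hu.comp (Continuous.subtype_mk h0.fst _))
    exact this.congr fun z => (hb z).symm
  refine (π.continuous_act.comp (h0.snd.snd.prodMk hbc)).congr fun z => ?_
  refine (Cover.fiberCoord_eq hn (huv ⟨z.1.1.1, z.2⟩) (e := z.1.1.1) (hp := ?_)
    (Quotient.sound ⟨b z, ?_⟩)).symm
  · have h1 := (z.1.act (b z)).2
    have h2 : (z.1.act (b z)).1 = (z.1.1.1, u ⟨z.1.1.1, z.2⟩, π.act z.1.1.2.2 (b z)) := by
      change (_, _ * pinToSpin n (b z), _) = _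
      rw [hb, mul_inv_cancel_left]
    rw [h2] at h1
    exact h1
  · have h1 : z.1.1.2.1 * pinToSpin n (b z) = u ⟨z.1.1.1, z.2⟩ := by
      rw [hb, mul_inv_cancel_left]
    exact Subtype.ext (Prod.ext rfl (Prod.ext h1.symm rfl))

theorem Cover.isEvenlyCovered (hn : n ≠ 0) (e : B.total.Frame) :
    ∃ d, IsEvenlyCovered (Cover.proj (B := B) (π := π)) e (π.proj ⁻¹' {d}) := by
  obtain ⟨U, u, hU, he, hu, huv⟩ := exists_spin_vertical e
  let f : U → N.orthonormalFrames (negSq n) h := fun e =>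
    ⟨polarFrame h (baseFrame ⟨_, huv e⟩), polarFrame_mem h _⟩
  have hrot : Continuous fun e : U => Frame.act (spinRho (negSqProd n) (u e)) e.1 :=
    continuous_act_spinRho hu continuous_subtype_val
  have hf : Continuous f := Continuous.subtype_mk ((continuous_polarFrame h).comp
    (continuous_baseFrame.comp (Continuous.subtype_mk hrot _))) _
  have hpre : ∀ z : {z : U × π.P // π.proj z.2 = f z.1}, ∃ d,
      FrameOver B (Frame.act (spinRho (negSqProd n) (u z.1.1)) z.1.1.1) d ∧
        polarFrame h d = (π.proj z.1.2 : N.Frame) := fun z =>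
    ⟨_, frameOver_baseFrame ⟨_, huv z.1.1⟩, by rw [z.2]⟩
  refine ⟨f ⟨e, he⟩, isEvenlyCovered_of_pullback π.isCoveringMap Cover.continuous_proj hU he f
    (fun c => c.1.fiberCoord hn (u ⟨_, c.2⟩) (huv ⟨_, c.2⟩))
    (fun z => Quotient.mk _ ⟨(z.1.1.1, u z.1.1, z.1.2), hpre z⟩) hf
    (Cover.continuous_fiberCoord hn hu huv) ?_ ?_ (fun _ => rfl) ?_ ?_⟩
  · have h0 : Continuous fun z : {z : U × π.P // π.proj z.2 = f z.1} => z.1 :=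
      continuous_subtype_val
    exact continuous_quotient_mk'.comp (Continuous.subtype_mk
      ((continuous_subtype_val.comp h0.fst).prodMk ((hu.comp h0.fst).prodMk h0.snd)) _)
  · intro c
    obtain ⟨⟨d, hd, hp⟩, -⟩ := c.1.fiberCoord_spec hn (u ⟨_, c.2⟩) (huv ⟨_, c.2⟩)
    refine Subtype.ext (hp.symm.trans ?_)
    exact congrArg (polarFrame h) (baseFrame_eq (e := ⟨_, huv ⟨_, c.2⟩⟩) hd).symm
  · intro z
    exact Cover.fiberCoord_eq hn _ rfl
  · intro c
    obtain ⟨hp, h⟩ := c.1.fiberCoord_spec hn (u ⟨_, c.2⟩) (huv ⟨_, c.2⟩)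
    exact h.symm

variable (B π) in
/-- The covering of the frames of the total space associated with a pin structure of the base. -/
noncomputable def associatedCover (hn : n ≠ 0) :
    FrameCover B.total (spinRho (negSqProd n)) univ where
  P := Cover B π
  act := Cover.act
  proj c := ⟨c.proj, trivial⟩
  act_one c := by
    obtain ⟨z, rfl⟩ := Quotient.mk_surjective c
    refine congrArg (Quotient.mk _) (Subtype.ext (Prod.ext ?_ (Prod.ext ?_ rfl)))
    · change Frame.act (spinRho (negSqProd n) 1) _ = _
      rw [map_one, Frame.act_one]
    · change 1⁻¹ * _ = _
      rw [inv_one, one_mul]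
  act_mul c a b := by
    obtain ⟨z, rfl⟩ := Quotient.mk_surjective c
    refine congrArg (Quotient.mk _) (Subtype.ext (Prod.ext ?_ (Prod.ext ?_ rfl)))
    · change Frame.act _ _ = Frame.act _ (Frame.act _ _)
      rw [map_mul, Frame.act_act]
    · change (a * b)⁻¹ * _ = b⁻¹ * (a⁻¹ * _)
      rw [mul_inv_rev, mul_assoc]
  continuous_act := Cover.continuous_act
  isCoveringMap := by
    have h1 : IsCoveringMap (Cover.proj (B := B) (π := π)) := fun e => by
      obtain ⟨d, hd⟩ := Cover.isEvenlyCovered (B := B) (π := π) hn e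
      exact hd.to_isEvenlyCovered_preimage
    exact h1.homeomorph_comp (Homeomorph.Set.univ _).symm
  two_sheeted e := by
    obtain ⟨d, hd⟩ := Cover.isEvenlyCovered (B := B) (π := π) hn e.1
    rw [← π.two_sheeted d, Nat.card_congr hd.fiberHomeomorph.toEquiv]
    refine Nat.card_congr (Equiv.setCongr ?_)
    ext c
    exact Subtype.ext_iff
  proj_act c a := by
    obtain ⟨z, rfl⟩ := Quotient.mk_surjective c
    rfl
  free_ker c a ha hc := by
    obtain ⟨z, rfl⟩ := Quotient.mk_surjective c
    obtain ⟨b, hb⟩ := Quotient.exact hc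
    have h1 : z.1.2.1 = a⁻¹ * z.1.2.1 * pinToSpin n b :=
      congrArg (fun w : PreCover B π => w.1.2.1) hb
    have h2 : z.1.2.2 = π.act z.1.2.2 b := congrArg (fun w : PreCover B π => w.1.2.2) hb
    have h3 : spinRho (negSqProd n) (pinToSpin n b) = 1 := by
      have h4 := congrArg (spinRho (negSqProd n)) h1
      rw [map_mul, map_mul, map_inv, ha, inv_one, one_mul] at h4
      simpa using h4.symm
    have h4 : pinRho (negSq n) b = 1 := by
      ext1
      funext v
      have h5 := spinRho_pinToSpin_inl b v
      rw [h3] at h5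
      exact (congrArg Prod.fst h5).symm
    have h5 : b = 1 := π.free_ker _ b h4 h2.symm
    rw [h5, map_one, mul_one] at h1
    exact inv_eq_one.1 (by simpa using h1.symm)

/-- Every pin structure of the base induces a spin structure of the total space. -/
theorem exists_spinStructure (hn : n ≠ 0) (o : B.total.Orientation) (g : B.total.Metric) :
    ∃ σ : SpinStructure B o g, AreInduced σ π := by
  have hpos : ∀ e ∈ B.total.positiveFrames o, ∀ a,
      Frame.act (spinRho (negSqProd n) a) e ∈ B.total.positiveFrames o := fun e he a =>
    (o.sgn_act_of_pos _ _ (det_spinRho_pos a)).trans he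
  have horth : ∀ e ∈ B.total.orthonormalFrames (negSqProd n) g, ∀ a,
      Frame.act (spinRho (negSqProd n) a) e ∈ B.total.orthonormalFrames (negSqProd n) g := by
    rintro _ ⟨⟨i, q⟩, rfl, hq⟩ a
    refine ⟨⟨i, (q.1.1, q.1.2.comp (spinRho (negSqProd n) a).toContinuousLinearMap), q.2.1,
      q.2.2.comp (spinRho (negSqProd n) a).bijective⟩, rfl, fun v => ?_⟩
    refine (hq _).trans ?_
    rw [← Q_spinRho a v]
    rfl
  let τ : TopSpinStructure B o :=
    (associatedCover B π hn).restrict (B.total.positiveFrames o) (subset_univ _) hpos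
  let σ : SpinStructure B o g := τ.restrict _ inter_subset_left
    fun e he a => ⟨hpos e he.1 a, horth e he.2 a⟩
  have hv : ∀ e : verticalFrames B,
      Frame.act (spinRho (negSqProd n) 1) e.1 ∈ verticalFrames B := fun e => by
    rw [map_one, Frame.act_one]
    exact e.2
  have hval : @Continuous τ.P (Cover B π) τ.top _ Subtype.val := continuous_subtype_val
  refine ⟨σ, τ, ⟨Subtype.val, continuous_subtype_val, fun _ => rfl, fun _ _ => rfl⟩,
    fun p => Cover.fiberCoord hn p.1.1 1 (hv ⟨_, by
      obtain ⟨d, -, hd⟩ := p.2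
      exact ⟨d, hd⟩⟩), ?_, ?_, ?_⟩
  · refine (Cover.continuous_fiberCoord (B := B) (π := π) hn (u := fun _ => 1)
      continuous_const hv).comp (Continuous.subtype_mk
        (hval.comp continuous_subtype_val) fun p => ?_)
    obtain ⟨d, -, hd⟩ := p.2
    exact ⟨d, hd⟩
  · intro p
    obtain ⟨d, hd, hpd⟩ := p.2
    obtain ⟨⟨d', hd', hp⟩, -⟩ := Cover.fiberCoord_spec hn p.1.1 1 (hv ⟨_, d, hpd⟩)
    rw [map_one, Frame.act_one] at hd'
    rw [FrameOver.unique hd' hpd, polarFrame_eq_self hd] at hp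
    rw [← hp]
    exact hpd
  · intro p q a hq
    obtain ⟨d, hd, hpd⟩ := p.2
    obtain ⟨hp, h⟩ := Cover.fiberCoord_spec hn p.1.1 1 (hv ⟨_, d, hpd⟩)
    have hq' : q.1.1 = Cover.act p.1.1 (pinToSpin n a) := congrArg Subtype.val hq
    obtain ⟨w, hw⟩ : ∃ w : PreCover B π, w.1 = (Frame.act (spinRho (negSqProd n) (pinToSpin n a))
        p.1.1.proj, 1, π.act (Cover.fiberCoord hn p.1.1 1 (hv ⟨_, d, hpd⟩)) a) := by
      refine ⟨PreCover.act (PreCover.spinAct ⟨_, hp⟩ (pinToSpin n a)) a, ?_⟩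
      refine Prod.ext rfl (Prod.ext ?_ rfl)
      change (pinToSpin n a)⁻¹ * 1 * pinToSpin n a = 1
      rw [mul_one, inv_mul_cancel]
    refine Cover.fiberCoord_eq hn _ (hp := hw ▸ w.2) ?_
    rw [hq']
    refine (congrArg (fun c => Cover.act c (pinToSpin n a)) h).trans (Quotient.sound ⟨a, ?_⟩)
    refine Subtype.ext (Prod.ext rfl (Prod.ext ?_ rfl))
    change 1 = (pinToSpin n a)⁻¹ * 1 * pinToSpin n a
    rw [mul_one, inv_mul_cancel]

end Associated
end OrbPin

namespace OrbPin
open Set Topology ChartFamily Filter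

/-! ### Rigidity of orbifold charts -/

/-- If a continuous map agrees at every point of an open set with one of finitely many continuous
maps, then near any point of this set there are open sets on which it agrees with a fixed one. -/
theorem exists_frequently_eventually_eq {α ι Z : Type*} [TopologicalSpace α] [BaireSpace α]
    [TopologicalSpace Z] [T2Space Z] [Finite ι] {W : Set α} (hW : IsOpen W) {x : α} (hx : x ∈ W)
    {a : ι → α → Z} {b : α → Z} (ha : ∀ g, ContinuousOn (a g) W) (hb : ContinuousOn b W)
    (h : ∀ y ∈ W, ∃ g, a g y = b y) :
    ∃ g, ∃ᶠ y in 𝓝 x, y ∈ W ∧ ∀ᶠ z in 𝓝 y, a g z = b z := by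
  let C : Option ι → Set α := fun o => o.elim Wᶜ fun g => closure {y | y ∈ W ∧ a g y = b y}
  have hC : ∀ o, IsClosed (C o) := by
    rintro (_ | g)
    · exact hW.isClosed_compl
    · exact isClosed_closure
  have hU : ⋃ o, C o = univ := by
    refine eq_univ_of_forall fun y => mem_iUnion.2 ?_
    by_cases hy : y ∈ W
    · obtain ⟨g, hg⟩ := h y hy
      exact ⟨some g, subset_closure ⟨hy, hg⟩⟩
    · exact ⟨none, hy⟩
  have hd := dense_iUnion_interior_of_closed hC hU x
  rw [closure_iUnion_of_finite, mem_iUnion] at hd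
  obtain ⟨o, ho⟩ := hd
  cases o with
  | none =>
    have : x ∈ C none := closure_minimal interior_subset (hC none) ho
    exact absurd hx this
  | some g =>
    refine ⟨g, ?_⟩
    have h1 := (mem_closure_iff_frequently.1 ho).and_eventually (hW.mem_nhds hx)
    refine h1.mono fun y hy => ⟨hy.2, ?_⟩
    filter_upwards [isOpen_interior.mem_nhds hy.1, hW.mem_nhds hy.2] with z hz hzW
    have hz' : ∃ᶠ w in 𝓝 z, w ∈ W ∧ a g w = b w :=
      mem_closure_iff_frequently.1 (interior_subset hz)
    have hcl : IsClosed {p : Z × Z | p.1 = p.2} := isClosed_diagonal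
    have ht : Tendsto (fun w => (a g w, b w)) (𝓝 z) (𝓝 (a g z, b z)) :=
      ((ha g).continuousAt (hW.mem_nhds hzW)).prodMk_nhds (hb.continuousAt (hW.mem_nhds hzW))
    exact hcl.mem_of_frequently_of_tendsto (hz'.mono fun w hw => hw.2) ht

namespace Orbifold

variable {n : ℕ} {X : Type u} [TopologicalSpace X] (N : Orbifold n X) {i : N.ι}

theorem differentiableAt_act (g : N.grp i) {x : EuclideanSpace ℝ (Fin n)} (hx : x ∈ N.dom i) :
    DifferentiableAt ℝ (N.act i g) x :=
  ((N.act_smooth i g).differentiableOn (by simp)).differentiableAt ((N.isOpen_dom i).mem_nhds hx)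

theorem continuousOn_fderiv_act (g : N.grp i) :
    ContinuousOn (fderiv ℝ (N.act i g)) (N.dom i) :=
  (N.act_smooth i g).continuousOn_fderiv_of_isOpen (N.isOpen_dom i) (by simp)

theorem fderiv_act_mul (g k : N.grp i) {x : EuclideanSpace ℝ (Fin n)} (hx : x ∈ N.dom i) :
    fderiv ℝ (N.act i (g * k)) x =
      (fderiv ℝ (N.act i g) (N.act i k x)).comp (fderiv ℝ (N.act i k) x) := by
  have h : N.act i (g * k) =ᶠ[𝓝 x] N.act i g ∘ N.act i k := by
    filter_upwards [(N.isOpen_dom i).mem_nhds hx] with y hy using N.act_mul i g k y hy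
  rw [h.fderiv_eq, fderiv_comp x (N.differentiableAt_act g (N.act_mem i k x hx))
    (N.differentiableAt_act k hx)]

theorem fderiv_act_one {x : EuclideanSpace ℝ (Fin n)} (hx : x ∈ N.dom i) :
    fderiv ℝ (N.act i 1) x = ContinuousLinearMap.id ℝ _ := by
  have h : N.act i 1 =ᶠ[𝓝 x] id := by
    filter_upwards [(N.isOpen_dom i).mem_nhds hx] with y hy using N.act_one i y hy
  rw [h.fderiv_eq, fderiv_id]

/-- A group element with trivial `1`-jet at a point acts trivially near it. The sum of the powers
of `g` is an invariant map, and it is a local diffeomorphism. -/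
theorem act_eventually_eq {g : N.grp i} {x : EuclideanSpace ℝ (Fin n)} (hx : x ∈ N.dom i)
    (hgx : N.act i g x = x)
    (hd : fderiv ℝ (N.act i g) x = ContinuousLinearMap.id ℝ _) :
    ∀ᶠ y in 𝓝 x, N.act i g y = y := by
  have hpow : ∀ k : ℕ, N.act i (g ^ k) x = x ∧
      fderiv ℝ (N.act i (g ^ k)) x = ContinuousLinearMap.id ℝ _ := by
    intro k
    induction k with
    | zero => rw [pow_zero, N.act_one i x hx, N.fderiv_act_one hx]; exact ⟨rfl, rfl⟩
    | succ k ih =>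
      rw [pow_succ, N.act_mul i _ _ x hx, N.fderiv_act_mul _ _ hx, hgx, hd, ih.1, ih.2]
      exact ⟨rfl, rfl⟩
  set m := orderOf g with hm
  have hm0 : (m : ℝ) ≠ 0 := by exact_mod_cast (orderOf_pos g).ne'
  let φ : EuclideanSpace ℝ (Fin n) → EuclideanSpace ℝ (Fin n) :=
    fun y => ∑ k ∈ Finset.range m, N.act i (g ^ k) y
  have hφg : ∀ y ∈ N.dom i, φ (N.act i g y) = φ y := by
    intro y hy
    have h1 : φ (N.act i g y) = ∑ k ∈ Finset.range m, N.act i (g ^ (k + 1)) y :=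
      Finset.sum_congr rfl fun k _ => by rw [pow_succ, N.act_mul i _ _ y hy]
    have h2 := Finset.sum_range_succ (fun k => N.act i (g ^ k) y) m
    have h3 := Finset.sum_range_succ' (fun k => N.act i (g ^ k) y) m
    rw [h2, hm, pow_orderOf_eq_one, pow_zero] at h3
    rw [h1]
    exact (add_right_cancel h3).symm
  let e : EuclideanSpace ℝ (Fin n) ≃L[ℝ] EuclideanSpace ℝ (Fin n) :=
    ContinuousLinearEquiv.smulLeft (Units.mk0 (m : ℝ) hm0)
  have hφ : HasStrictFDerivAt φ e.toContinuousLinearMap x := by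
    have h1 : HasStrictFDerivAt φ (∑ k ∈ Finset.range m, fderiv ℝ (N.act i (g ^ k)) x) x :=
      HasStrictFDerivAt.fun_sum fun k _ =>
        ((N.act_smooth i (g ^ k)).contDiffAt ((N.isOpen_dom i).mem_nhds hx)).hasStrictFDerivAt
          (by simp)
    convert h1 using 1
    rw [Finset.sum_congr rfl fun k _ => (hpow k).2, Finset.sum_const, Finset.card_range]
    refine ContinuousLinearMap.ext fun v => ?_
    change (m : ℝ) • v = m • v
    exact Nat.cast_smul_eq_nsmul ℝ m v
  let P := hφ.toOpenPartialHomeomorph φ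
  have hxP : x ∈ P.source := hφ.mem_toOpenPartialHomeomorph_source
  have h1 : ∀ᶠ y in 𝓝 x, N.act i g y ∈ P.source := by
    have := (N.differentiableAt_act g hx).continuousAt
    refine this.eventually_mem ?_
    rw [hgx]
    exact P.open_source.mem_nhds hxP
  filter_upwards [h1, P.open_source.mem_nhds hxP, (N.isOpen_dom i).mem_nhds hx] with y h1 h2 h3
  exact P.injOn h1 h2 (hφg y h3)

/-- Rigidity: a group element with trivial `1`-jet at one point is trivial. -/
theorem eq_one_of_fderiv_eq_id {g : N.grp i} {x : EuclideanSpace ℝ (Fin n)} (hx : x ∈ N.dom i)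
    (hgx : N.act i g x = x)
    (hd : fderiv ℝ (N.act i g) x = ContinuousLinearMap.id ℝ _) : g = 1 := by
  let S : Set (EuclideanSpace ℝ (Fin n)) := {y | y ∈ N.dom i ∧ ∀ᶠ z in 𝓝 y, N.act i g z = z}
  have hS : IsOpen S := by
    rw [isOpen_iff_mem_nhds]
    rintro y ⟨hy, h⟩
    filter_upwards [(N.isOpen_dom i).mem_nhds hy, h.eventually_nhds] with z h1 h2 using ⟨h1, h2⟩
  have hsub : N.dom i ⊆ S := by
    refine (N.dom_connected i).isPreconnected.subset_of_closure_inter_subset hS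
      ⟨x, hx, hx, N.act_eventually_eq hx hgx hd⟩ ?_
    rintro y ⟨hyS, hy⟩
    have hfr : ∃ᶠ z in 𝓝 y, z ∈ S := mem_closure_iff_frequently.1 hyS
    refine ⟨hy, N.act_eventually_eq hy ?_ ?_⟩
    · have ht : Tendsto (fun z => (N.act i g z, z)) (𝓝 y) (𝓝 (N.act i g y, y)) :=
        (N.differentiableAt_act g hy).continuousAt.prodMk_nhds tendsto_id
      exact isClosed_diagonal.mem_of_frequently_of_tendsto
        (hfr.mono fun z hz => hz.2.self_of_nhds) ht
    · refine (isClosed_singleton (x := ContinuousLinearMap.id ℝ (EuclideanSpace ℝ (Fin n)))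
        ).mem_of_frequently_of_tendsto (hfr.mono fun z hz => ?_)
        ((N.continuousOn_fderiv_act g).continuousAt ((N.isOpen_dom i).mem_nhds hy))
      have h1 : N.act i g =ᶠ[𝓝 z] id := hz.2
      rw [h1.fderiv_eq, fderiv_id]
      rfl
  exact N.act_effective i g fun y hy => (hsub hy).2.self_of_nhds

/-- The points of a chart with trivial isotropy group are dense. -/
theorem frequently_free {x : EuclideanSpace ℝ (Fin n)} (hx : x ∈ N.dom i) :
    ∃ᶠ y in 𝓝 x, y ∈ N.dom i ∧ ∀ g, N.act i g y = y → g = 1 := by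
  intro hcon
  have hcon' : ∀ᶠ y in 𝓝 x, ∃ g : {g : N.grp i // g ≠ 1}, N.act i g.1 y = y := by
    filter_upwards [hcon, (N.isOpen_dom i).mem_nhds hx] with y hy hyd
    by_contra! h
    exact hy ⟨hyd, fun g hg => by_contra fun h1 => h ⟨g, h1⟩ hg⟩
  obtain ⟨W, hW, hWo, hxW⟩ := eventually_nhds_iff.1
    (hcon'.and ((N.isOpen_dom i).mem_nhds hx))
  obtain ⟨g, hg⟩ := exists_frequently_eventually_eq hWo hxW
    (a := fun g : {g : N.grp i // g ≠ 1} => N.act i g.1) (b := id)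
    (fun g => (N.act_smooth i g.1).continuousOn.mono fun y hy => (hW y hy).2) continuousOn_id
    (fun y hy => (hW y hy).1)
  obtain ⟨y, hy, hgy⟩ := hg.exists
  refine g.2 (N.eq_one_of_fderiv_eq_id (hW y hy).2 hgy.self_of_nhds ?_)
  have h1 : N.act i g.1 =ᶠ[𝓝 y] id := hgy
  rw [h1.fderiv_eq, fderiv_id]

/-- A smooth lift of the identity of the orbifold has everywhere the `1`-jet of a group
element. -/
theorem exists_act_jet_eq {f : EuclideanSpace ℝ (Fin n) → EuclideanSpace ℝ (Fin n)}
    {W : Set (EuclideanSpace ℝ (Fin n))} (hW : IsOpen W) (hWi : W ⊆ N.dom i)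
    (hf : ContDiffOn ℝ ∞ f W) (hfi : ∀ y ∈ W, f y ∈ N.dom i)
    (hmap : ∀ y ∈ W, N.map i (f y) = N.map i y) {x : EuclideanSpace ℝ (Fin n)} (hx : x ∈ W) :
    ∃ g, N.act i g x = f x ∧ fderiv ℝ (N.act i g) x = fderiv ℝ f x := by
  obtain ⟨g, hg⟩ := exists_frequently_eventually_eq hW hx (a := N.act i) (b := f)
    (fun g => (N.act_smooth i g).continuousOn.mono hWi) hf.continuousOn
    (fun y hy => (N.map_eq_iff i y (hWi hy) _ (hfi y hy)).1 (hmap y hy).symm)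
  refine ⟨g, ?_, ?_⟩
  · have ht : Tendsto (fun z => (N.act i g z, f z)) (𝓝 x) (𝓝 (N.act i g x, f x)) :=
      (N.differentiableAt_act g (hWi hx)).continuousAt.prodMk_nhds
        (hf.continuousOn.continuousAt (hW.mem_nhds hx))
    exact isClosed_diagonal.mem_of_frequently_of_tendsto
      (hg.mono fun z hz => hz.2.self_of_nhds) ht
  · have h1 : ContinuousAt (fderiv ℝ (N.act i g)) x :=
      (N.continuousOn_fderiv_act g).continuousAt ((N.isOpen_dom i).mem_nhds (hWi hx))
    have h2 : ContinuousAt (fderiv ℝ f) x :=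
      (hf.continuousOn_fderiv_of_isOpen hW (by simp)).continuousAt (hW.mem_nhds hx)
    exact isClosed_diagonal.mem_of_frequently_of_tendsto
      (hg.mono fun z hz => EventuallyEq.fderiv_eq hz.2) (h1.prodMk_nhds h2)

/-- The class map from the frames of a chart to the frames of an orbifold is locally injective:
the group acts freely on the frames. -/
theorem exists_injOn_mkFrame (q₀ : N.LocalFrame i) :
    ∃ W : Set (N.LocalFrame i), IsOpen W ∧ q₀ ∈ W ∧ InjOn (N.mkFrame i) W := by
  let F : N.grp i → N.LocalFrame i → EuclideanSpace ℝ (Fin n) ×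
      (EuclideanSpace ℝ (Fin n) →L[ℝ] EuclideanSpace ℝ (Fin n)) :=
    fun g q => (N.act i g q.1.1, (fderiv ℝ (N.act i g) q.1.1).comp q.1.2)
  have hF : ∀ g, Continuous (F g) := by
    intro g
    have h1 : Continuous fun q : N.LocalFrame i => q.1 := continuous_subtype_val
    refine Continuous.prodMk ?_ (Continuous.clm_comp ?_ h1.snd)
    · exact (N.act_smooth i g).continuousOn.comp_continuous h1.fst fun q => q.2.1
    · exact (N.continuousOn_fderiv_act g).comp_continuous h1.fst fun q => q.2.1
  have hne : ∀ g : N.grp i, g ≠ 1 → F g q₀ ≠ q₀.1 := by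
    intro g hg h
    have h1 : N.act i g q₀.1.1 = q₀.1.1 := congrArg Prod.fst h
    have h2 : (fderiv ℝ (N.act i g) q₀.1.1).comp q₀.1.2 = q₀.1.2 := congrArg Prod.snd h
    refine hg (N.eq_one_of_fderiv_eq_id q₀.2.1 h1 (ContinuousLinearMap.ext fun v => ?_))
    obtain ⟨w, rfl⟩ := q₀.2.2.2 v
    exact congrArg (fun L => L w) h2
  have hev : ∀ᶠ p in 𝓝 q₀ ×ˢ 𝓝 q₀, ∀ g : N.grp i, g ≠ 1 → F g p.1 ≠ p.2.1 := by
    rw [eventually_all]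
    intro g
    by_cases hg : g = 1
    · exact Eventually.of_forall fun p h => absurd hg h
    · have h1 : ∀ᶠ p in 𝓝 q₀ ×ˢ 𝓝 q₀, F g p.1 ≠ p.2.1 := by
        rw [← nhds_prod_eq]
        have hc : Continuous fun p : N.LocalFrame i × N.LocalFrame i => (F g p.1, p.2.1) :=
          ((hF g).comp continuous_fst).prodMk (continuous_subtype_val.comp continuous_snd)
        exact (hc.continuousAt (x := (q₀, q₀))).eventually_mem
          (isClosed_diagonal.isOpen_compl.mem_nhds (hne g hg))
      filter_upwards [h1] with p hp _ using hp
  obtain ⟨W, hW, hWo, hq⟩ : ∃ W : Set (N.LocalFrame i), (∀ p ∈ W, ∀ p' ∈ W,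
      ∀ g : N.grp i, g ≠ 1 → F g p ≠ p'.1) ∧ IsOpen W ∧ q₀ ∈ W := by
    obtain ⟨t, ht, h⟩ := Filter.mem_prod_same_iff.1 hev
    obtain ⟨W, hWt, hWo, hq⟩ := mem_nhds_iff.1 ht
    exact ⟨W, fun p hp p' hp' => h (mk_mem_prod (hWt hp) (hWt hp')), hWo, hq⟩
  refine ⟨W, hWo, hq, fun p hp p' hp' h => ?_⟩
  obtain ⟨κ, hκ, hs, hxy, hd⟩ := Quotient.exact h
  dsimp only at hκ hs hxy hd
  obtain ⟨g, hg, hgd⟩ := N.exists_act_jet_eq κ.open_source hκ.source_subset hκ.contDiffOn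
    (fun y hy => hκ.target_subset (κ.map_source hy)) hκ.map_eq hs
  have hFg : F g p = p'.1 := by
    refine Prod.ext (hg.trans hxy) ?_
    change (fderiv ℝ (N.act i g) p.1.1).comp p.1.2 = p'.1.2
    rw [hgd, hd]
  have hg1 : g = 1 := by_contra fun h1 => hW p hp p' hp' g h1 hFg
  subst hg1
  refine Subtype.ext (hFg ▸ Prod.ext (N.act_one i _ p.2.1).symm ?_)
  change p.1.2 = (fderiv ℝ (N.act i 1) p.1.1).comp p.1.2
  rw [N.fderiv_act_one p.2.1]
  rfl

end Orbifold
end OrbPin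

namespace OrbPin
open Set Topology ChartFamily Filter

/-! ### Transitions of the total space over transitions of the base -/

theorem eventually_eq_of_mem_range_intCast {α : Type*} [TopologicalSpace α] {f : α → ℝ} {x : α}
    (hf : ContinuousAt f x) (h : ∀ᶠ y in 𝓝 x, f y ∈ range ((↑) : ℤ → ℝ)) :
    ∀ᶠ y in 𝓝 x, f y = f x := by
  have h1 : ∀ᶠ y in 𝓝 x, f y ∈ Metric.ball (f x) 1 :=
    hf.eventually_mem (Metric.ball_mem_nhds _ one_pos)
  obtain ⟨m, hm⟩ := h.self_of_nhds
  filter_upwards [h, h1] with y hy hy1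
  obtain ⟨k, hk⟩ := hy
  rw [Metric.mem_ball, ← hk, ← hm, Int.dist_cast_real, Int.dist_eq] at hy1
  rw [← hk, ← hm]
  have h2 : |k - m| < 1 := by exact_mod_cast hy1
  rw [sub_eq_zero.1 (Int.abs_lt_one_iff.1 h2)]

theorem coe_eq_coe_iff_mem_range {s t : ℝ} :
    (s : UnitAddCircle) = t ↔ s - t ∈ range ((↑) : ℤ → ℝ) := by
  rw [← sub_eq_zero, ← AddCircle.coe_sub, AddCircle.coe_eq_zero_iff]
  simp

namespace CircleBundle

variable {n : ℕ} {X : Type u} [TopologicalSpace X] {N : Orbifold n X}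
variable {Y : Type u} [TopologicalSpace Y] (B : CircleBundle N Y) {i j : N.ι}

theorem eps_one (i : N.ι) : B.eps i 1 = 1 := by
  have h := B.eps_mul i 1 1
  rw [mul_one] at h
  exact (mul_eq_left (a := B.eps i 1)).1 h.symm

theorem rot_one {x : EuclideanSpace ℝ (Fin n)} (hx : x ∈ N.dom i) : B.rot i 1 x = 0 := by
  have h := B.rot_mul i 1 1 x hx
  rw [mul_one, B.eps_one, one_smul, N.act_one i x hx] at h
  exact (add_eq_left (a := B.rot i 1 x)).1 h.symm

theorem continuousOn_rot (g : N.grp i) : ContinuousOn (B.rot i g) (N.dom i) := by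
  intro x hx
  obtain ⟨α, hα, h⟩ := B.rot_smooth i g x hx
  have h1 : ContinuousAt (fun y => (α y : UnitAddCircle)) x :=
    (AddCircle.continuous_mk' (1 : ℝ)).continuousAt.comp hα.continuousAt
  exact (h1.congr (h.mono fun y hy => hy.symm)).continuousWithinAt

/-- The rotation angle of an affine lift of a transition is smooth on a neighbourhood of each
point: two such lifts differ by a locally constant angle, because they do so over the points with
trivial isotropy group, which are dense. -/
theorem exists_smooth_lift {μ : OpenPartialHomeomorph (EuclideanSpace ℝ (Fin n))
    (EuclideanSpace ℝ (Fin n))} (hμ : N.IsTransition i j μ) {x : EuclideanSpace ℝ (Fin n)}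
    (hx : x ∈ μ.source) :
    ∃ (W : Set (EuclideanSpace ℝ (Fin n))) (ε : ℤˣ) (α : EuclideanSpace ℝ (Fin n) → ℝ),
      IsOpen W ∧ x ∈ W ∧ W ⊆ μ.source ∧ ContDiffOn ℝ ∞ α W ∧
      ∀ y ∈ W, ∀ s, B.triv j (μ y) (ε • s + (α y : UnitAddCircle)) = B.triv i y s := by
  obtain ⟨ε, α, hα, htriv⟩ := B.affine i j μ hμ x hx
  have hα1 : ∀ᶠ y in 𝓝 x, ContinuousAt α y :=
    ((hα.of_le (by simp : (1 : WithTop ℕ∞) ≤ ∞)).eventually (by simp)).mono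
      fun y hy => hy.continuousAt
  obtain ⟨W, hW, hWo, hxW⟩ := eventually_nhds_iff.1
    ((hα1.and htriv).and (μ.open_source.mem_nhds hx))
  refine ⟨W, ε, α, hWo, hxW, fun y hy => (hW y hy).2, fun y hy => ?_, fun y hy => (hW y hy).1.2⟩
  obtain ⟨ε', α', hα', htriv'⟩ := B.affine i j μ hμ y (hW y hy).2
  have hα1' : ∀ᶠ z in 𝓝 y, ContinuousAt α' z :=
    ((hα'.of_le (by simp : (1 : WithTop ℕ∞) ≤ ∞)).eventually (by simp)).mono
      fun y hy => hy.continuousAt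
  have hint : ∀ᶠ z in 𝓝 y, α z - α' z ∈ range ((↑) : ℤ → ℝ) := by
    filter_upwards [hα1'.eventually_nhds, htriv'.eventually_nhds, hWo.mem_nhds hy]
      with z hz1 hz2 hzW
    have hzi : z ∈ N.dom i := hμ.source_subset (hW z hzW).2
    refine Int.isClosedEmbedding_coe_real.isClosed_range.mem_of_frequently_of_tendsto ?_
      ((hW z hzW).1.1.sub hz1.self_of_nhds)
    refine ((N.frequently_free hzi).and_eventually
      (hz2.and (hWo.mem_nhds hzW))).mono ?_
    rintro w ⟨⟨hwi, hfree⟩, hw2, hwW⟩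
    have h1 := (hW w hwW).1.2 (ε⁻¹ • ((α' w : UnitAddCircle) - α w))
    rw [smul_inv_smul, sub_add_cancel] at h1
    have h2 := hw2 0
    rw [smul_zero, zero_add, h1] at h2
    obtain ⟨g, hg, hg'⟩ := (B.triv_eq_iff i w hwi w hwi _ _).1 h2.symm
    rw [hfree g hg, B.eps_one, B.rot_one hwi, one_smul, add_zero] at hg'
    refine coe_eq_coe_iff_mem_range.1 ?_
    have h3 : (α' w : UnitAddCircle) - α w = 0 := by
      rw [← smul_inv_smul ε ((α' w : UnitAddCircle) - α w), ← hg', smul_zero]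
    exact (sub_eq_zero.1 h3).symm
  have hc := eventually_eq_of_mem_range_intCast
    ((hW y hy).1.1.sub hα'.continuousAt) hint
  have h4 : ContDiffAt ℝ ∞ α y := by
    refine (hα'.add (contDiffAt_const (c := α y - α' y))).congr_of_eventuallyEq ?_
    filter_upwards [hc] with z hz
    change α z = α' z + (α y - α' y)
    have : α z - α' z = α y - α' y := hz
    linarith
  exact h4.contDiffWithinAt

/-- Transitions of the base lift to the total space. -/
theorem exists_total_transition {μ : OpenPartialHomeomorph (EuclideanSpace ℝ (Fin n))
    (EuclideanSpace ℝ (Fin n))} (hμ : N.IsTransition i j μ) {x : EuclideanSpace ℝ (Fin n)}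
    (hx : x ∈ μ.source) (t : ℝ) :
    ∃ κ : OpenPartialHomeomorph (EuclideanSpace ℝ (Fin n) × ℝ) (EuclideanSpace ℝ (Fin n) × ℝ),
      B.total.IsTransition i j κ ∧ (x, t) ∈ κ.source ∧ ∀ z, (κ z).1 = μ z.1 := by
  obtain ⟨W, ε, α, hW, hxW, hWs, hα, htriv⟩ := B.exists_smooth_lift hμ hx
  have hε : (((ε : ℤ) : ℝ)) * ((ε : ℤ) : ℝ) = 1 := by
    rcases Int.units_eq_one_or ε with h | h <;> simp [h]
  have hTo : IsOpen (μ.target ∩ μ.symm ⁻¹' W) :=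
    μ.symm.continuousOn.isOpen_inter_preimage μ.open_target hW
  have hf : ContDiffOn ℝ ∞ (fun z : EuclideanSpace ℝ (Fin n) × ℝ =>
      (μ z.1, ((ε : ℤ) : ℝ) * z.2 + α z.1)) (W ×ˢ univ) := by
    refine ContDiffOn.prodMk ?_ (ContDiffOn.add ?_ ?_)
    · exact hμ.contDiffOn.comp contDiffOn_fst fun z hz => hWs hz.1
    · exact contDiffOn_const.mul contDiffOn_snd
    · exact hα.comp contDiffOn_fst fun z hz => hz.1
  have hf' : ContDiffOn ℝ ∞ (fun z : EuclideanSpace ℝ (Fin n) × ℝ =>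
      (μ.symm z.1, ((ε : ℤ) : ℝ) * (z.2 - α (μ.symm z.1))))
      ((μ.target ∩ μ.symm ⁻¹' W) ×ˢ univ) := by
    have h1 : ContDiffOn ℝ ∞ (fun z : EuclideanSpace ℝ (Fin n) × ℝ => μ.symm z.1)
        ((μ.target ∩ μ.symm ⁻¹' W) ×ˢ univ) :=
      hμ.contDiffOn_symm.comp contDiffOn_fst fun z hz => hz.1.1
    refine ContDiffOn.prodMk h1 (contDiffOn_const.mul (contDiffOn_snd.sub ?_))
    exact hα.comp h1 fun z hz => hz.1.2
  let κ : OpenPartialHomeomorph (EuclideanSpace ℝ (Fin n) × ℝ) (EuclideanSpace ℝ (Fin n) × ℝ) :=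
    { toFun := fun z => (μ z.1, ((ε : ℤ) : ℝ) * z.2 + α z.1)
      invFun := fun z => (μ.symm z.1, ((ε : ℤ) : ℝ) * (z.2 - α (μ.symm z.1)))
      source := W ×ˢ univ
      target := (μ.target ∩ μ.symm ⁻¹' W) ×ˢ univ
      map_source' := by
        rintro ⟨y, s⟩ ⟨hy, -⟩
        refine ⟨⟨μ.map_source (hWs hy), ?_⟩, trivial⟩
        change μ.symm (μ y) ∈ W
        rw [μ.left_inv (hWs hy)]
        exact hy
      map_target' := fun z hz => ⟨hz.1.2, trivial⟩
      left_inv' := by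
        rintro ⟨y, s⟩ ⟨hy, -⟩
        refine Prod.ext (μ.left_inv (hWs hy)) ?_
        dsimp only
        rw [μ.left_inv (hWs hy), add_sub_cancel_right, ← mul_assoc, hε, one_mul]
      right_inv' := by
        rintro ⟨y, s⟩ ⟨hy, -⟩
        refine Prod.ext (μ.right_inv hy.1) ?_
        dsimp only
        rw [← mul_assoc, hε, one_mul, sub_add_cancel]
      open_source := hW.prod isOpen_univ
      open_target := hTo.prod isOpen_univ
      continuousOn_toFun := hf.continuousOn
      continuousOn_invFun := hf'.continuousOn }
  refine ⟨κ, ?_, ⟨hxW, trivial⟩, fun _ => rfl⟩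
  exact
    { source_subset := fun z hz => ⟨hμ.source_subset (hWs hz.1), trivial⟩
      target_subset := fun z hz => ⟨hμ.target_subset hz.1.1, trivial⟩
      contDiffOn := hf
      contDiffOn_symm := hf'
      map_eq := by
        rintro ⟨y, s⟩ ⟨hy, -⟩
        rw [show B.total.map i (y, s) = B.triv i y (s : UnitAddCircle) from rfl, ← htriv y hy s]
        change B.triv j (μ y) ((((ε : ℤ) : ℝ) * s + α y : ℝ) : UnitAddCircle) = _
        rw [AddCircle.coe_add, ← zsmul_eq_mul, AddCircle.coe_zsmul, Units.smul_def] }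

/-- All vertical frames over a frame of the chart `i` can be represented in the chart `i`. -/
theorem exists_mkFrame_eq_of_frameOver {e : B.total.Frame} {w : N.LocalFrame i}
    (h : FrameOver B e (N.mkFrame i w)) :
    ∃ (q : B.total.LocalFrame i) (hv : (q.1.2 (0, 1)).1 = 0), B.total.mkFrame i q = e ∧
      baseLocal q hv = w := by
  obtain ⟨j, ⟨⟨⟨x, t⟩, A⟩, hx, hA⟩, hv, rfl, hd⟩ := frameOver_iff_exists.1 h
  obtain ⟨μ, hμ, hs, hxy, hd⟩ := Quotient.exact hd.symm
  dsimp only at hμ hs hxy hd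
  obtain ⟨κ, hκ, hκs, hκμ⟩ := B.exists_total_transition hμ hs t
  have hD : ∀ v, (fderiv ℝ κ (x, t) v).1 = fderiv ℝ μ x v.1 := by
    intro v
    have h1 : HasFDerivAt (fun z => (κ z).1)
        ((ContinuousLinearMap.fst ℝ _ _).comp (fderiv ℝ κ (x, t))) (x, t) :=
      (hκ.differentiableAt hκs).hasFDerivAt.fst
    have h2 : HasFDerivAt (fun z : EuclideanSpace ℝ (Fin n) × ℝ => μ z.1)
        ((fderiv ℝ μ x).comp (ContinuousLinearMap.fst ℝ _ _)) (x, t) :=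
      HasFDerivAt.comp (x, t) (hμ.differentiableAt hs).hasFDerivAt hasFDerivAt_fst
    rw [funext hκμ] at h1
    exact congrArg (fun f => f v) (h1.unique h2)
  refine ⟨⟨(κ (x, t), (fderiv ℝ κ (x, t)).comp A), hκ.target_subset (κ.map_source hκs),
    (hκ.bijective_fderiv hκs).comp hA⟩, ?_, ?_, ?_⟩
  · change (fderiv ℝ κ (x, t) (A (0, 1))).1 = 0
    rw [hD]
    exact (congrArg _ hv).trans (map_zero _)
  · exact (Quotient.sound ⟨κ, hκ, hκs, rfl, rfl⟩ : (⟦_⟧ : B.total.Frame) = ⟦_⟧).symm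
  · refine Subtype.ext (Prod.ext ((hκμ _).trans hxy) (ContinuousLinearMap.ext fun v => ?_))
    rw [hd]
    exact hD _

/-- A vertical frame of the chart `i` over a given frame of the base is determined by its class,
up to a translation of the fibre coordinate by an integer. -/
theorem eq_of_mkFrame_eq {q q' : B.total.LocalFrame i} {hv : (q.1.2 (0, 1)).1 = 0}
    {hv' : (q'.1.2 (0, 1)).1 = 0} (hbase : baseLocal q hv = baseLocal q' hv')
    (h : B.total.mkFrame i q = B.total.mkFrame i q') :
    (q.1.1.2 : UnitAddCircle) = q'.1.1.2 ∧ q.1.2 = q'.1.2 := by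
  obtain ⟨⟨z₀, A⟩, hx, hA⟩ := q
  obtain ⟨⟨z₀', A'⟩, hx', hA'⟩ := q'
  obtain ⟨κ, hκ, hs, hxy, hd⟩ := Quotient.exact h
  dsimp only at hκ hs hxy hd hv hv' ⊢
  have hx1 : z₀.1 = z₀'.1 := congrArg (fun q : N.LocalFrame i => q.1.1) hbase
  have hD : baseLin A = baseLin A' := congrArg (fun q : N.LocalFrame i => q.1.2) hbase
  have hdom : ∀ z ∈ κ.source, z.1 ∈ N.dom i := fun z hz => (hκ.source_subset hz).1
  obtain ⟨g, hg⟩ := exists_frequently_eventually_eq κ.open_source hs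
    (Z := EuclideanSpace ℝ (Fin n) × UnitAddCircle)
    (a := fun (g : N.grp i) z => (N.act i g z.1, B.eps i g • (z.2 : UnitAddCircle) + B.rot i g z.1))
    (b := fun z => ((κ z).1, ((κ z).2 : UnitAddCircle)))
    (fun g => by
      have h1 : Continuous fun z : EuclideanSpace ℝ (Fin n) × ℝ => (z.2 : UnitAddCircle) :=
        (AddCircle.continuous_mk' (1 : ℝ)).comp continuous_snd
      have h2 : Continuous fun z : EuclideanSpace ℝ (Fin n) × ℝ =>
          B.eps i g • (z.2 : UnitAddCircle) := h1.zsmul _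
      have h3 : ContinuousOn (fun z : EuclideanSpace ℝ (Fin n) × ℝ => B.rot i g z.1) κ.source :=
        (B.continuousOn_rot g).comp continuousOn_fst hdom
      exact ((N.act_smooth i g).continuousOn.comp continuousOn_fst hdom).prodMk
        (h2.continuousOn.add h3))
    (by
      have h1 := κ.continuousOn
      exact (continuous_fst.comp_continuousOn h1).prodMk
        ((AddCircle.continuous_mk' (1 : ℝ)).comp_continuousOn
          (continuous_snd.comp_continuousOn h1)))
    (fun z hz => by
      have h1 := map_fst_of_transition hκ hz
      obtain ⟨g, hg, hg'⟩ := (B.triv_eq_iff i _ h1.1 _ h1.2.1 _ _).1 (hκ.map_eq z hz).symm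
      exact ⟨g, Prod.ext hg hg'⟩)
  have hκc : ContinuousAt κ z₀ := κ.continuousAt hs
  have hκd : ContinuousAt (fderiv ℝ κ) z₀ :=
    (hκ.contDiffOn.continuousOn_fderiv_of_isOpen κ.open_source (by simp)).continuousAt
      (κ.open_source.mem_nhds hs)
  have hz₀ : (N.dom i) ∈ 𝓝 z₀.1 := (N.isOpen_dom i).mem_nhds hx.1
  -- the `1`-jet of the group element at the base point is trivial
  have hgx : N.act i g z₀.1 = z₀.1 := by
    have h1 : ContinuousAt (fun z : EuclideanSpace ℝ (Fin n) × ℝ => (N.act i g z.1, (κ z).1)) z₀ :=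
      (((N.act_smooth i g).continuousOn.continuousAt hz₀).comp
        (f := Prod.fst) continuousAt_fst).prodMk (continuousAt_fst.comp hκc)
    have h2 := isClosed_diagonal.mem_of_frequently_of_tendsto
      (hg.mono fun z hz => (congrArg Prod.fst hz.2.self_of_nhds :)) h1
    have h3 : N.act i g z₀.1 = (κ z₀).1 := h2
    rw [h3, hxy, hx1]
  have hgd : (fderiv ℝ (N.act i g) z₀.1).comp (ContinuousLinearMap.fst ℝ _ ℝ) =
      (ContinuousLinearMap.fst ℝ _ _).comp (fderiv ℝ κ z₀) := by
    have h1 : ContinuousAt (fun z : EuclideanSpace ℝ (Fin n) × ℝ =>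
        (fderiv ℝ (N.act i g) z.1).comp (ContinuousLinearMap.fst ℝ _ ℝ)) z₀ :=
      (((N.continuousOn_fderiv_act g).continuousAt hz₀).comp
        (f := Prod.fst) continuousAt_fst).clm_comp continuousAt_const
    have h2 : ContinuousAt (fun z =>
        (ContinuousLinearMap.fst ℝ (EuclideanSpace ℝ (Fin n)) ℝ).comp (fderiv ℝ κ z)) z₀ :=
      continuousAt_const.clm_comp hκd
    refine isClosed_diagonal.mem_of_frequently_of_tendsto
      (hg.mono fun z hz => ?_) (h1.prodMk h2)
    have h3 : HasFDerivAt (fun z => (κ z).1)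
        ((ContinuousLinearMap.fst ℝ _ _).comp (fderiv ℝ κ z)) z :=
      (hκ.differentiableAt hz.1).hasFDerivAt.fst
    have h4 : HasFDerivAt (fun z : EuclideanSpace ℝ (Fin n) × ℝ => N.act i g z.1)
        ((fderiv ℝ (N.act i g) z.1).comp (ContinuousLinearMap.fst ℝ _ _)) z :=
      HasFDerivAt.comp z (N.differentiableAt_act g (hdom z hz.1)).hasFDerivAt hasFDerivAt_fst
    exact h4.unique (h3.congr_of_eventuallyEq (hz.2.mono fun w hw => congrArg Prod.fst hw))
  have hgid : fderiv ℝ (N.act i g) z₀.1 = ContinuousLinearMap.id ℝ _ := by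
    refine ContinuousLinearMap.ext fun v => ?_
    obtain ⟨w, rfl⟩ := (bijective_baseLin hA hv).2 v
    refine (congrArg (fun L => L (A (w, 0))) hgd).trans ?_
    refine Eq.trans ?_ (congrArg (fun L => L w) hD.symm)
    rw [baseLin_apply, hd]
    rfl
  have hg1 : g = 1 := N.eq_one_of_fderiv_eq_id hx.1 hgx hgid
  subst hg1
  have hint : ∀ z ∈ κ.source, (N.act i 1 z.1, B.eps i 1 • (z.2 : UnitAddCircle) + B.rot i 1 z.1) =
      ((κ z).1, ((κ z).2 : UnitAddCircle)) → (z.2 : UnitAddCircle) = (κ z).2 := by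
    intro z hz h
    have h1 := congrArg Prod.snd h
    dsimp only at h1
    rwa [B.eps_one, one_smul, B.rot_one (hdom z hz), add_zero] at h1
  constructor
  · have h1 : ContinuousAt (fun z : EuclideanSpace ℝ (Fin n) × ℝ =>
        ((z.2 : UnitAddCircle), ((κ z).2 : UnitAddCircle))) z₀ :=
      ((AddCircle.continuous_mk' (1 : ℝ)).continuousAt.comp
        (f := Prod.snd) continuousAt_snd).prodMk
        ((AddCircle.continuous_mk' (1 : ℝ)).continuousAt.comp
          (f := fun z => (κ z).2) (continuousAt_snd.comp hκc))
    have h2 : (z₀.2 : UnitAddCircle) = (κ z₀).2 := isClosed_diagonal.mem_of_frequently_of_tendsto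
      (hg.mono fun z hz => hint z hz.1 hz.2.self_of_nhds) h1
    rw [h2, hxy]
  · have hsnd : (ContinuousLinearMap.snd ℝ (EuclideanSpace ℝ (Fin n)) ℝ).comp (fderiv ℝ κ z₀) =
        ContinuousLinearMap.snd ℝ _ _ := by
      have h2 : ContinuousAt (fun z =>
          (ContinuousLinearMap.snd ℝ (EuclideanSpace ℝ (Fin n)) ℝ).comp (fderiv ℝ κ z)) z₀ :=
        continuousAt_const.clm_comp hκd
      refine (isClosed_singleton (x := ContinuousLinearMap.snd ℝ (EuclideanSpace ℝ (Fin n)) ℝ)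
        ).mem_of_frequently_of_tendsto (hg.mono fun z hz => ?_) h2
      have h3 : HasFDerivAt (fun z => (κ z).2)
          ((ContinuousLinearMap.snd ℝ _ _).comp (fderiv ℝ κ z)) z :=
        (hκ.differentiableAt hz.1).hasFDerivAt.snd
      have h4 : ∀ᶠ w in 𝓝 z, (κ w).2 - w.2 = (κ z).2 - z.2 := by
        refine eventually_eq_of_mem_range_intCast
          (f := fun w : EuclideanSpace ℝ (Fin n) × ℝ => (κ w).2 - w.2)
          ((continuousAt_snd.comp (κ.continuousAt hz.1)).sub continuousAt_snd) ?_
        filter_upwards [hz.2, κ.open_source.mem_nhds hz.1] with w hw hws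
        exact coe_eq_coe_iff_mem_range.1 (hint w hws hw).symm
      have h5 : HasFDerivAt (fun w : EuclideanSpace ℝ (Fin n) × ℝ => w.2 + ((κ z).2 - z.2))
          (ContinuousLinearMap.snd ℝ _ _) z := hasFDerivAt_snd.add_const _
      refine h3.unique (h5.congr_of_eventuallyEq (h4.mono fun w hw => ?_))
      dsimp only
      linarith
    refine ContinuousLinearMap.ext fun v => ?_
    rw [hd]
    refine Prod.ext ?_ ?_
    · refine Eq.trans ?_ (congrArg (fun L => L (A v)) hgd)
      rw [hgid]
      rfl
    · exact (congrArg (fun L => L (A v)) hsnd).symm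

/-- Translations of the fibre coordinate by integers are transitions. -/
theorem mkFrame_eq_of_coe_eq {x : EuclideanSpace ℝ (Fin n)} {t t' : ℝ}
    {A : (EuclideanSpace ℝ (Fin n) × ℝ) →L[ℝ] (EuclideanSpace ℝ (Fin n) × ℝ)} {h h'}
    (ht : (t : UnitAddCircle) = t') :
    B.total.mkFrame i ⟨((x, t), A), h⟩ = B.total.mkFrame i ⟨((x, t'), A), h'⟩ := by
  let κ : OpenPartialHomeomorph (EuclideanSpace ℝ (Fin n) × ℝ) (EuclideanSpace ℝ (Fin n) × ℝ) :=
    { toFun := fun z => z + (0, t' - t)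
      invFun := fun z => z - (0, t' - t)
      source := N.dom i ×ˢ univ
      target := N.dom i ×ˢ univ
      map_source' := fun z hz => ⟨by simpa using hz.1, trivial⟩
      map_target' := fun z hz => ⟨by simpa using hz.1, trivial⟩
      left_inv' := fun z _ => add_sub_cancel_right _ _
      right_inv' := fun z _ => sub_add_cancel _ _
      open_source := (N.isOpen_dom i).prod isOpen_univ
      open_target := (N.isOpen_dom i).prod isOpen_univ
      continuousOn_toFun := by fun_prop
      continuousOn_invFun := by fun_prop }
  refine Quotient.sound ⟨κ, ?_, h.1, ?_, ?_⟩
  · exact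
      { source_subset := subset_rfl
        target_subset := subset_rfl
        contDiffOn := (contDiff_id.add contDiff_const).contDiffOn
        contDiffOn_symm := (contDiff_id.sub contDiff_const).contDiffOn
        map_eq := by
          rintro ⟨y, s⟩ -
          change B.triv i (y + 0) ((s + (t' - t) : ℝ) : UnitAddCircle) = B.triv i y s
          rw [add_zero, AddCircle.coe_add, AddCircle.coe_sub, ht, sub_self, add_zero] }
  · change (x, t) + (0, t' - t) = (x, t')
    simp
  · have h1 : fderiv ℝ κ (x, t) = ContinuousLinearMap.id ℝ _ :=
      ((hasFDerivAt_id (𝕜 := ℝ) (x, t)).add_const _).fderiv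
    exact (congrArg (fun L => ContinuousLinearMap.comp L A) h1).symm

end CircleBundle
end OrbPin

namespace OrbPin
open Set Topology ChartFamily Filter unitInterval

/-! ### Vertical frames over a frame of the base -/

section VerticalLinear

variable {n : ℕ}

theorem snd_ne_zero_of_vertical
    {A : (EuclideanSpace ℝ (Fin n) × ℝ) →L[ℝ] (EuclideanSpace ℝ (Fin n) × ℝ)}
    (hA : Function.Bijective A) (hv : (A (0, 1)).1 = 0) : (A (0, 1)).2 ≠ 0 := by
  intro h
  have h1 : A (0, 1) = A 0 := by rw [map_zero]; exact Prod.ext hv h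
  exact one_ne_zero (congrArg Prod.snd (hA.1 h1))

theorem bijective_of_vertical
    {A : (EuclideanSpace ℝ (Fin n) × ℝ) →L[ℝ] (EuclideanSpace ℝ (Fin n) × ℝ)}
    (hv : (A (0, 1)).1 = 0) (hb : Function.Bijective (baseLin A)) (hc : (A (0, 1)).2 ≠ 0) :
    Function.Bijective A := by
  have hinj : Function.Injective A.toLinearMap := by
    rw [← LinearMap.ker_eq_bot, LinearMap.ker_eq_bot']
    intro w hw
    have hw' : A w = 0 := hw
    have h1 : w.1 = 0 := by
      apply hb.1
      rw [← fst_apply_of_vertical hv, hw', map_zero]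
      rfl
    have h2 : w = w.2 • (0, 1) := Prod.ext (by simpa using h1) (by simp)
    rw [h2, map_smul] at hw'
    have h3 : w.2 * (A (0, 1)).2 = 0 := congrArg Prod.snd hw'
    rw [h2, (mul_eq_zero.1 h3).resolve_right hc, zero_smul]
  exact ⟨hinj, LinearMap.injective_iff_surjective.1 hinj⟩

/-- The map `(v, s) ↦ (D v, c s)`. -/
noncomputable def blockLin (D : EuclideanSpace ℝ (Fin n) →L[ℝ] EuclideanSpace ℝ (Fin n)) (c : ℝ) :
    (EuclideanSpace ℝ (Fin n) × ℝ) →L[ℝ] (EuclideanSpace ℝ (Fin n) × ℝ) :=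
  D.prodMap (c • ContinuousLinearMap.id ℝ ℝ)

theorem blockLin_apply (D : EuclideanSpace ℝ (Fin n) →L[ℝ] EuclideanSpace ℝ (Fin n)) (c : ℝ)
    (w : EuclideanSpace ℝ (Fin n) × ℝ) : blockLin D c w = (D w.1, c * w.2) := rfl

theorem baseLin_blockLin (D : EuclideanSpace ℝ (Fin n) →L[ℝ] EuclideanSpace ℝ (Fin n)) (c : ℝ) :
    baseLin (blockLin D c) = D := rfl

theorem continuous_blockLin (c : ℝ) : Continuous fun D => blockLin (n := n) D c :=
  continuous_id.prod_mapL ℝ continuous_const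

theorem blockLin_vertical (D : EuclideanSpace ℝ (Fin n) →L[ℝ] EuclideanSpace ℝ (Fin n)) (c : ℝ) :
    (blockLin D c (0, 1)).1 = 0 := by
  rw [blockLin_apply]
  exact map_zero D

theorem bijective_blockLin {D : EuclideanSpace ℝ (Fin n) →L[ℝ] EuclideanSpace ℝ (Fin n)}
    (hD : Function.Bijective D) {c : ℝ} (hc : c ≠ 0) : Function.Bijective (blockLin D c) :=
  bijective_of_vertical (blockLin_vertical D c) hD (by rw [blockLin_apply, mul_one]; exact hc)

/-- The linear path from a vertical map `A` to the block map with the same base part and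
vertical part `c`. -/
noncomputable def linePath (c : ℝ)
    (z : ℝ × ((EuclideanSpace ℝ (Fin n) × ℝ) →L[ℝ] (EuclideanSpace ℝ (Fin n) × ℝ))) :
    (EuclideanSpace ℝ (Fin n) × ℝ) →L[ℝ] (EuclideanSpace ℝ (Fin n) × ℝ) :=
  (1 - z.1) • z.2 + z.1 • blockLin (baseLin z.2) c

theorem continuous_linePath (c : ℝ) : Continuous (linePath (n := n) c) := by
  unfold linePath
  have h2 := (continuous_blockLin (n := n) c).comp
    ((continuous_baseLin (n := n)).comp (continuous_snd (X := ℝ)))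
  exact ((continuous_const.sub continuous_fst).smul continuous_snd).add (continuous_fst.smul h2)

variable {A : (EuclideanSpace ℝ (Fin n) × ℝ) →L[ℝ] (EuclideanSpace ℝ (Fin n) × ℝ)}

theorem linePath_zero (c : ℝ) : linePath c (0, A) = A := by
  refine ContinuousLinearMap.ext fun v => ?_
  change (1 - (0 : ℝ)) • A v + (0 : ℝ) • blockLin (baseLin A) c v = A v
  rw [sub_zero, one_smul, zero_smul, add_zero]

theorem linePath_one (c : ℝ) : linePath c (1, A) = blockLin (baseLin A) c := by
  refine ContinuousLinearMap.ext fun v => ?_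
  change (1 - (1 : ℝ)) • A v + (1 : ℝ) • blockLin (baseLin A) c v = _
  rw [sub_self, one_smul, zero_smul, zero_add]

theorem linePath_blockLin (D : EuclideanSpace ℝ (Fin n) →L[ℝ] EuclideanSpace ℝ (Fin n))
    (c r : ℝ) : linePath c (r, blockLin D c) = blockLin D c := by
  refine ContinuousLinearMap.ext fun v => ?_
  change (1 - r) • blockLin D c v + r • blockLin (baseLin (blockLin D c)) c v = _
  rw [baseLin_blockLin, ← add_smul, sub_add_cancel, one_smul]

theorem baseLin_linePath (c r : ℝ) : baseLin (linePath c (r, A)) = baseLin A := by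
  refine ContinuousLinearMap.ext fun v => ?_
  change (1 - r) • (A (v, 0)).1 + r • (A (v, 0)).1 = (A (v, 0)).1
  rw [← add_smul, sub_add_cancel, one_smul]

theorem linePath_vertical (hv : (A (0, 1)).1 = 0) (c r : ℝ) : (linePath c (r, A) (0, 1)).1 = 0 := by
  change (1 - r) • (A (0, 1)).1 + r • (A (0, 0)).1 = 0
  rw [hv, ← Prod.zero_eq_mk, map_zero]
  simp

theorem bijective_linePath (hA : Function.Bijective A) (hv : (A (0, 1)).1 = 0) {c : ℝ}
    (hc : 0 < (A (0, 1)).2 * c) {r : ℝ} (hr : r ∈ Icc (0 : ℝ) 1) :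
    Function.Bijective (linePath c (r, A)) := by
  refine bijective_of_vertical (linePath_vertical hv c r) ?_ ?_
  · rw [baseLin_linePath]
    exact bijective_baseLin hA hv
  · change (1 - r) * (A (0, 1)).2 + r * (c * 1) ≠ 0
    intro h
    have hc0 : c ≠ 0 := by
      rintro rfl
      simp at hc
    have h1 : (1 - r) * ((A (0, 1)).2 * c) + r * (c * c) = 0 := by
      linear_combination c * h
    have h2 : 0 < c * c := mul_self_pos.2 hc0
    rcases hr.2.lt_or_eq with h3 | h3
    · have := mul_pos (sub_pos.2 h3) hc
      have := mul_nonneg hr.1 h2.le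
      linarith
    · rw [h3] at h1
      linarith

end VerticalLinear

section VerticalOver

variable {n : ℕ} {X : Type u} [TopologicalSpace X] {N : Orbifold n X}
variable {Y : Type u} [TopologicalSpace Y] {B : CircleBundle N Y} {i : N.ι}

variable (B) in
/-- The vertical frame over a frame of a chart of the base that is the product with the multiple
`c` of the unit vector of the fibre, at the fibre coordinate `0`. -/
noncomputable def blockFrame (w : N.LocalFrame i) {c : ℝ} (hc : c ≠ 0) : B.total.LocalFrame i :=
  ⟨((w.1.1, 0), blockLin w.1.2 c), ⟨w.2.1, trivial⟩, bijective_blockLin w.2.2 hc⟩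

theorem frameOver_mkFrame {q : B.total.LocalFrame i} (hv : (q.1.2 (0, 1)).1 = 0) :
    FrameOver B (B.total.mkFrame i q) (N.mkFrame i (baseLocal q hv)) :=
  (frameOver_mkFrame_iff q _).2 ⟨hv, rfl⟩

theorem frameOver_blockFrame (w : N.LocalFrame i) {c : ℝ} (hc : c ≠ 0) :
    FrameOver B (B.total.mkFrame i (blockFrame B w hc)) (N.mkFrame i w) :=
  frameOver_mkFrame (q := blockFrame B w hc) (blockLin_vertical w.1.2 c)

theorem continuous_blockFrame {c : ℝ} (hc : c ≠ 0) :
    Continuous fun w : N.LocalFrame i => blockFrame B w hc := by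
  have h1 : Continuous fun w : N.LocalFrame i => w.1 := continuous_subtype_val
  refine Continuous.subtype_mk ((h1.fst.prodMk continuous_const).prodMk ?_) _
  exact (continuous_blockLin c).comp h1.snd

theorem sgn_blockFrame_neg (o : B.total.Orientation) (w : N.LocalFrame i) {c : ℝ} (hc : c ≠ 0) :
    o.sgn (B.total.mkFrame i (blockFrame B w (neg_ne_zero.2 hc))) =
      -o.sgn (B.total.mkFrame i (blockFrame B w hc)) := by
  let L : (EuclideanSpace ℝ (Fin n) × ℝ) ≃L[ℝ] (EuclideanSpace ℝ (Fin n) × ℝ) :=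
    (ContinuousLinearEquiv.refl ℝ _).prodCongr (ContinuousLinearEquiv.neg ℝ)
  have hdet : LinearMap.det (L : (EuclideanSpace ℝ (Fin n) × ℝ) →ₗ[ℝ] _) < 0 := by
    have h1 : (L : (EuclideanSpace ℝ (Fin n) × ℝ) →ₗ[ℝ] _) =
        LinearMap.prodMap LinearMap.id (-LinearMap.id) := rfl
    rw [h1, LinearMap.det_prodMap]
    simp
  rw [← o.sgn_act_of_neg L _ hdet]
  refine congrArg (fun q => o.sgn (B.total.mkFrame i q)) (Subtype.ext (Prod.ext rfl ?_))
  refine ContinuousLinearMap.ext fun v => Prod.ext rfl ?_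
  change -c * v.2 = c * -v.2
  ring

/-- The vertical frame of a chart at the time `r` of the linear path to a block frame. -/
noncomputable def lineFrame {x : EuclideanSpace ℝ (Fin n)} (hx : x ∈ N.dom i)
    {A : (EuclideanSpace ℝ (Fin n) × ℝ) →L[ℝ] (EuclideanSpace ℝ (Fin n) × ℝ)}
    (hA : Function.Bijective A) (hv : (A (0, 1)).1 = 0) {c : ℝ} (hc : 0 < (A (0, 1)).2 * c)
    (r : I) : B.total.LocalFrame i :=
  ⟨((x, 0), linePath c (r, A)), ⟨hx, trivial⟩, bijective_linePath hA hv hc r.2⟩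

theorem sgn_lineFrame (o : B.total.Orientation) {x : EuclideanSpace ℝ (Fin n)} (hx : x ∈ N.dom i)
    {A : (EuclideanSpace ℝ (Fin n) × ℝ) →L[ℝ] (EuclideanSpace ℝ (Fin n) × ℝ)}
    (hA : Function.Bijective A) (hv : (A (0, 1)).1 = 0) {c : ℝ} (hc : 0 < (A (0, 1)).2 * c)
    (r s : I) : o.sgn (B.total.mkFrame i (lineFrame hx hA hv hc r)) =
      o.sgn (B.total.mkFrame i (lineFrame hx hA hv hc s)) := by
  have h1 : Continuous fun r : I => B.total.mkFrame i (lineFrame hx hA hv hc r) := by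
    refine (B.total.continuous_mkFrame i).comp (Continuous.subtype_mk
      (continuous_const.prodMk ?_) _)
    exact (continuous_linePath c).comp (continuous_subtype_val.prodMk continuous_const)
  exact (o.locallyConstant.comp_continuous h1).apply_eq_of_preconnectedSpace r s

/-- Two vertical frames over the same frame of the base have the same orientation only if their
vertical vectors point in the same direction. -/
theorem mul_pos_of_sgn_eq (o : B.total.Orientation) {x : EuclideanSpace ℝ (Fin n)}
    (hx : x ∈ N.dom i)
    {A : (EuclideanSpace ℝ (Fin n) × ℝ) →L[ℝ] (EuclideanSpace ℝ (Fin n) × ℝ)}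
    (hA : Function.Bijective A) (hv : (A (0, 1)).1 = 0) {c : ℝ} (hc : c ≠ 0)
    (h : o.sgn (B.total.mkFrame i ⟨((x, 0), A), ⟨hx, trivial⟩, hA⟩) =
      o.sgn (B.total.mkFrame i (blockFrame B ⟨(x, baseLin A), hx, bijective_baseLin hA hv⟩ hc))) :
    0 < (A (0, 1)).2 * c := by
  by_contra hcon
  have hne := mul_ne_zero (snd_ne_zero_of_vertical hA hv) hc
  have hneg : 0 < (A (0, 1)).2 * -c := by
    rw [mul_neg]
    exact neg_pos.2 (lt_of_le_of_ne (not_lt.1 hcon) hne)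
  have h1 := sgn_lineFrame (B := B) o hx hA hv hneg 0 1
  have h2 : lineFrame (B := B) hx hA hv hneg 0 = ⟨((x, 0), A), ⟨hx, trivial⟩, hA⟩ :=
    Subtype.ext (Prod.ext rfl (linePath_zero _))
  have h3 : lineFrame (B := B) hx hA hv hneg 1 =
      blockFrame B ⟨(x, baseLin A), hx, bijective_baseLin hA hv⟩ (neg_ne_zero.2 hc) :=
    Subtype.ext (Prod.ext rfl (linePath_one _))
  rw [h2, h3, sgn_blockFrame_neg (hc := hc), h] at h1
  exact absurd h1 (by rcases Int.units_eq_one_or (o.sgn (B.total.mkFrame i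
    (blockFrame B ⟨(x, baseLin A), hx, bijective_baseLin hA hv⟩ hc))) with h | h <;>
      rw [h] <;> decide)

/-- Over a set of frames of a chart of the base on which the class map is injective, the vertical
frames have continuous coordinates, the coordinate of the fibre being taken modulo integers. -/
theorem exists_vertical_coordinates {W : Set (N.LocalFrame i)} (hW : IsOpen W)
    (hinj : InjOn (N.mkFrame i) W) :
    ∃ q : {e : B.total.Frame | ∃ w ∈ W, FrameOver B e (N.mkFrame i w)} → B.total.LocalFrame i,
      (∀ e, B.total.mkFrame i (q e) = e.1) ∧
      (∀ e, ∃ hv : ((q e).1.2 (0, 1)).1 = 0, baseLocal (q e) hv ∈ W) ∧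
      Continuous fun e => ((q e).1.1.1, (((q e).1.1.2 : ℝ) : UnitAddCircle), (q e).1.2) := by
  set V : Set B.total.Frame := {e | ∃ w ∈ W, FrameOver B e (N.mkFrame i w)} with hV
  have hex : ∀ e : V, ∃ q : B.total.LocalFrame i, B.total.mkFrame i q = e.1 ∧
      ∃ hv : (q.1.2 (0, 1)).1 = 0, baseLocal q hv ∈ W := by
    rintro ⟨e, w, hw, he⟩
    obtain ⟨q, hv, hq, hb⟩ := B.exists_mkFrame_eq_of_frameOver he
    exact ⟨q, hq, hv, hb ▸ hw⟩
  choose q hq hqW using hex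
  refine ⟨q, hq, hqW, ?_⟩
  rw [continuous_iff_continuousAt]
  intro e
  have hqe : B.total.mkFrame i (q e) ∈ V := (hq e).symm ▸ e.2
  have ho : IsOpenMap (V.restrictPreimage (B.total.mkFrame i)) :=
    (B.total.isOpenMap_mkFrame i).restrictPreimage V
  have hc : Continuous (V.restrictPreimage (B.total.mkFrame i)) :=
    (B.total.continuous_mkFrame i).restrictPreimage
  have hnhds := ho.map_nhds_eq (hc.continuousAt (x := ⟨q e, hqe⟩))
  have he' : V.restrictPreimage (B.total.mkFrame i) ⟨q e, hqe⟩ = e := Subtype.ext (hq e)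
  rw [he'] at hnhds
  have hvert : ∀ p : B.total.mkFrame i ⁻¹' V, (p.1.1.2 (0, 1)).1 = 0 := by
    rintro ⟨p, w, hw, hp⟩
    exact ((frameOver_mkFrame_iff p _).1 hp).1
  have hbase : Continuous fun p : B.total.mkFrame i ⁻¹' V => baseLocal p.1 (hvert p) := by
    have h1 : Continuous fun p : B.total.mkFrame i ⁻¹' V => p.1.1 :=
      continuous_subtype_val.comp continuous_subtype_val
    exact Continuous.subtype_mk (h1.fst.fst.prodMk (continuous_baseLin.comp h1.snd)) _
  have hev : ∀ᶠ p in 𝓝 (⟨q e, hqe⟩ : B.total.mkFrame i ⁻¹' V), baseLocal p.1 (hvert p) ∈ W :=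
    hbase.continuousAt.eventually_mem (hW.mem_nhds (hqW e).2)
  rw [ContinuousAt, ← hnhds, tendsto_map'_iff]
  have hlim : Continuous fun p : B.total.mkFrame i ⁻¹' V =>
      (p.1.1.1.1, ((p.1.1.1.2 : ℝ) : UnitAddCircle), p.1.1.2) := by
    have h1 : Continuous fun p : B.total.mkFrame i ⁻¹' V => p.1.1 :=
      continuous_subtype_val.comp continuous_subtype_val
    exact h1.fst.fst.prodMk (((AddCircle.continuous_mk' (1 : ℝ)).comp h1.fst.snd).prodMk h1.snd)
  have hfin := hlim.continuousAt (x := ⟨q e, hqe⟩)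
  have hval : ((q e).1.1.1, (((q e).1.1.2 : ℝ) : UnitAddCircle), (q e).1.2) =
      (fun p : B.total.mkFrame i ⁻¹' V =>
        (p.1.1.1.1, ((p.1.1.1.2 : ℝ) : UnitAddCircle), p.1.1.2)) ⟨q e, hqe⟩ := rfl
  rw [hval]
  refine Tendsto.congr' (hev.mono fun p hp => ?_) hfin
  obtain ⟨hv, hw⟩ := hqW (V.restrictPreimage (B.total.mkFrame i) p)
  have h1 : B.total.mkFrame i (q (V.restrictPreimage (B.total.mkFrame i) p)) =
      B.total.mkFrame i p.1 := hq _
  have h2 : baseLocal (q (V.restrictPreimage (B.total.mkFrame i) p)) hv =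
      baseLocal p.1 (hvert p) := by
    refine hinj hw hp ((frameOver_mkFrame hv).unique ?_)
    rw [h1]
    exact frameOver_mkFrame _
  obtain ⟨h3, h4⟩ := B.eq_of_mkFrame_eq h2 h1
  exact Prod.ext (congrArg (fun w : N.LocalFrame i => w.1.1) h2.symm)
    (Prod.ext h3.symm h4.symm)

end VerticalOver
end OrbPin

namespace OrbPin
open Set Topology ChartFamily Filter unitInterval

/-! ### Transport along the fibres -/

section Transport

variable {n : ℕ} {X : Type u} [TopologicalSpace X] {N : Orbifold n X}
variable {Y : Type u} [TopologicalSpace Y] {B : CircleBundle N Y} {o : B.total.Orientation}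

/-- If the local circle action over a chart lifts to the topological spin structure, the points
over vertical frames can be transported, continuously and within the frames over the same frame
of the base, to points over block frames: rotate the fibre coordinate to `0` by the lifted
action, and lift the linear path from the resulting frame to the block frame. -/
theorem exists_transport {τ : TopSpinStructure B o} {i : N.ι} (hτ : τ.LiftsLocalAction i)
    {W : Set (N.LocalFrame i)} (hW : IsOpen W) (hinj : InjOn (N.mkFrame i) W) {c : ℝ} (hc : c ≠ 0)
    (hpos : ∀ w ∈ W, o.sgn (B.total.mkFrame i (blockFrame B w hc)) = 1) :
    ∃ T : {p : τ.P | ∃ w ∈ W, FrameOver B (τ.proj p) (N.mkFrame i w)} → τ.P,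
      Continuous T ∧ ∀ p, ∀ w ∈ W, FrameOver B (τ.proj p.1) (N.mkFrame i w) →
        (τ.proj (T p) : B.total.Frame) = B.total.mkFrame i (blockFrame B w hc) ∧
        JoinedIn {r | FrameOver B (τ.proj r) (N.mkFrame i w)} p.1 (T p) ∧
        ((τ.proj p.1 : B.total.Frame) = B.total.mkFrame i (blockFrame B w hc) → T p = p.1) := by
  obtain ⟨κ, hκc, hκ0, hκadd, hκ⟩ := hτ
  obtain ⟨q', hq', hqW', hqc'⟩ := exists_vertical_coordinates (B := B) hW hinj
  set V : Set τ.P := {p | ∃ w ∈ W, FrameOver B (τ.proj p) (N.mkFrame i w)} with hV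
  let q : V → B.total.LocalFrame i := fun p => q' ⟨τ.proj p.1, p.2⟩
  have hq : ∀ p : V, B.total.mkFrame i (q p) = τ.proj p.1 := fun p => hq' _
  have hqv : ∀ p : V, ((q p).1.2 (0, 1)).1 = 0 := fun p => (hqW' _).1
  have hqW : ∀ p : V, baseLocal (q p) (hqv p) ∈ W := fun p => (hqW' _).2
  have hqc : Continuous fun p : V =>
      ((q p).1.1.1, (((q p).1.1.2 : ℝ) : UnitAddCircle), (q p).1.2) :=
    hqc'.comp (Continuous.subtype_mk (continuous_subtype_val.comp
      (τ.isCoveringMap.continuous.comp continuous_subtype_val)) _)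
  have hqw : ∀ p : V, ∀ w ∈ W, FrameOver B (τ.proj p.1) (N.mkFrame i w) →
      baseLocal (q p) (hqv p) = w := by
    intro p w hw hp
    refine hinj (hqW p) hw ((frameOver_mkFrame (hqv p)).unique ?_)
    rw [hq]
    exact hp
  -- the lifted circle action
  let z : V → ChartPullback τ i := fun p =>
    ⟨(((q p).1.1.1, (((q p).1.1.2 : ℝ) : UnitAddCircle), (q p).1.2), p.1),
      (q p).1.1.2, (q p).2.1, (q p).2.2, rfl, (hq p).symm⟩
  have hz : Continuous z := Continuous.subtype_mk (hqc.prodMk continuous_subtype_val) _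
  have hrot : ∀ (r : UnitAddCircle) (p : V), ∃ t : ℝ,
      (t : UnitAddCircle) = r + (((q p).1.1.2 : ℝ) : UnitAddCircle) ∧
      (τ.proj (κ r (z p)).1.2 : B.total.Frame) =
        B.total.mkFrame i ⟨(((q p).1.1.1, t), (q p).1.2), ⟨(q p).2.1.1, trivial⟩, (q p).2.2⟩ := by
    intro r p
    obtain ⟨t, hx, hA, ht, hp⟩ := (κ r (z p)).2
    have h1 := hκ r (z p)
    refine ⟨t, ht.trans (congrArg (fun w => w.2.1) h1), hp.trans ?_⟩
    refine congrArg (B.total.mkFrame i) (Subtype.ext (Prod.ext (Prod.ext ?_ rfl) ?_))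
    · exact congrArg (fun w => w.1) h1
    · exact congrArg (fun w => w.2.2) h1
  let R : V → τ.P := fun p => (κ (-(((q p).1.1.2 : ℝ) : UnitAddCircle)) (z p)).1.2
  have hRc : Continuous R := by
    have h1 : Continuous fun p : V => -(((q p).1.1.2 : ℝ) : UnitAddCircle) := hqc.snd.fst.neg
    have h2 := hκc.comp (h1.prodMk hz)
    exact continuous_snd.comp (continuous_subtype_val.comp h2)
  have hR : ∀ p : V, (τ.proj (R p) : B.total.Frame) =
      B.total.mkFrame i ⟨(((q p).1.1.1, 0), (q p).1.2), ⟨(q p).2.1.1, trivial⟩, (q p).2.2⟩ := by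
    intro p
    obtain ⟨t, ht, h⟩ := hrot (-(((q p).1.1.2 : ℝ) : UnitAddCircle)) p
    refine h.trans (B.mkFrame_eq_of_coe_eq ?_)
    rw [ht, neg_add_cancel, AddCircle.coe_zero]
  have hRj : ∀ p : V, JoinedIn
      {r | FrameOver B (τ.proj r) (N.mkFrame i (baseLocal (q p) (hqv p)))} p.1 (R p) := by
    intro p
    refine JoinedIn.ofLine (f := fun r : ℝ =>
      (κ ((-(r * (q p).1.1.2) : ℝ) : UnitAddCircle) (z p)).1.2) ?_ ?_ ?_ ?_
    · have h1 : Continuous fun r : ℝ => ((-(r * (q p).1.1.2) : ℝ) : UnitAddCircle) :=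
        (AddCircle.continuous_mk' (1 : ℝ)).comp (by fun_prop)
      have h2 := hκc.comp (h1.prodMk (continuous_const (y := z p)))
      exact (continuous_snd.comp (continuous_subtype_val.comp h2)).continuousOn
    · rw [zero_mul, neg_zero, AddCircle.coe_zero, hκ0]
    · rw [one_mul, AddCircle.coe_neg]
    · rintro _ ⟨r, -, rfl⟩
      obtain ⟨t, -, h⟩ := hrot ((-(r * (q p).1.1.2) : ℝ) : UnitAddCircle) p
      rw [Set.mem_ofPred_eq, h]
      exact frameOver_mkFrame (q := ⟨(((q p).1.1.1, t), (q p).1.2), ⟨(q p).2.1.1, trivial⟩,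
        (q p).2.2⟩) (hqv p)
  -- the linear path to the block frame
  have hcpos : ∀ p : V, 0 < ((q p).1.2 (0, 1)).2 * c := by
    intro p
    refine mul_pos_of_sgn_eq o (q p).2.1.1 (q p).2.2 (hqv p) hc ?_
    have h1 := hpos _ (hqW p)
    have h2 : o.sgn (τ.proj (R p)) = 1 := (τ.proj (R p)).2
    rw [hR p] at h2
    exact h2.trans h1.symm
  let F : I × V → B.total.LocalFrame i := fun x =>
    lineFrame (q x.2).2.1.1 (q x.2).2.2 (hqv x.2) (hcpos x.2) x.1
  have hF0 : ∀ p, F (0, p) =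
      ⟨(((q p).1.1.1, 0), (q p).1.2), ⟨(q p).2.1.1, trivial⟩, (q p).2.2⟩ := fun p =>
    Subtype.ext (Prod.ext rfl (linePath_zero _))
  have hF1 : ∀ p, F (1, p) = blockFrame B (baseLocal (q p) (hqv p)) hc := fun p =>
    Subtype.ext (Prod.ext rfl (linePath_one _))
  have hFpos : ∀ x, B.total.mkFrame i (F x) ∈ B.total.positiveFrames o := by
    intro x
    refine (sgn_lineFrame o _ _ _ (hcpos x.2) x.1 1).trans ?_
    exact (congrArg (fun q => o.sgn (B.total.mkFrame i q)) (hF1 x.2)).trans (hpos _ (hqW x.2))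
  have hFv : ∀ x, FrameOver B (B.total.mkFrame i (F x))
      (N.mkFrame i (baseLocal (q x.2) (hqv x.2))) := by
    intro x
    refine (frameOver_mkFrame_iff _ _).2 ⟨linePath_vertical (hqv x.2) c _, ?_⟩
    refine congrArg (N.mkFrame i) (Subtype.ext (Prod.ext rfl ?_))
    exact (baseLin_linePath c _).symm
  let H : C(I × V, B.total.positiveFrames o) := ⟨fun x => ⟨_, hFpos x⟩, by
    refine Continuous.subtype_mk ((B.total.continuous_mkFrame i).comp
      (Continuous.subtype_mk (Continuous.prodMk ?_ ?_) _)) _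
    · exact (hqc.fst.comp continuous_snd).prodMk continuous_const
    · exact (continuous_linePath c).comp ((continuous_subtype_val.comp continuous_fst).prodMk
        (hqc.snd.snd.comp continuous_snd))⟩
  have H0 : ∀ p, H (0, p) = τ.proj ((⟨R, hRc⟩ : C(V, τ.P)) p) := by
    intro p
    refine Subtype.ext ?_
    change B.total.mkFrame i (F (0, p)) = τ.proj (R p)
    rw [hF0, hR]
  let G := τ.isCoveringMap.liftHomotopy H ⟨R, hRc⟩ H0
  have hG : ∀ x, τ.proj (G x) = H x := fun x =>
    congrFun (τ.isCoveringMap.liftHomotopy_lifts H ⟨R, hRc⟩ H0) x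
  have hG0 : ∀ p, G (0, p) = R p := τ.isCoveringMap.liftHomotopy_zero H ⟨R, hRc⟩ H0
  refine ⟨fun p => G (1, p), G.continuous.comp (Continuous.prodMk_right 1), ?_⟩
  intro p w hw hp
  obtain rfl := hqw p w hw hp
  refine ⟨?_, (hRj p).trans ?_, fun h => ?_⟩
  · rw [hG]
    change B.total.mkFrame i (F (1, p)) = _
    rw [hF1]
  · rw [← hG0 p]
    refine ⟨⟨⟨fun r => G (r, p), G.continuous.comp (Continuous.prodMk_left p)⟩, rfl, rfl⟩,
      fun r => ?_⟩
    change FrameOver B (τ.proj (G (r, p))) _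
    rw [hG]
    exact hFv (r, p)
  · -- both steps are constant
    obtain ⟨h1, h2⟩ := B.eq_of_mkFrame_eq (hv := hqv p)
      (hv' := blockLin_vertical (baseLocal (q p) (hqv p)).1.2 c) (q' := blockFrame B _ hc)
      (Subtype.ext (Prod.ext rfl rfl)) ((hq p).trans h)
    have hRp : R p = p.1 := by
      change (κ (-(((q p).1.1.2 : ℝ) : UnitAddCircle)) (z p)).1.2 = p.1
      have h3 : (((q p).1.1.2 : ℝ) : UnitAddCircle) = 0 := h1
      rw [h3, neg_zero, hκ0]
    have hconst : (fun r => G (r, p)) = fun _ => R p := by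
      refine τ.isCoveringMap.eq_of_comp_eq (G.continuous.comp (Continuous.prodMk_left p))
        continuous_const ?_ (0 : I) (hG0 p)
      funext r
      refine (hG (r, p)).trans (Eq.trans (Subtype.ext ?_) (H0 p))
      change B.total.mkFrame i (F (r, p)) = B.total.mkFrame i (F (0, p))
      refine congrArg (B.total.mkFrame i) (Subtype.ext (Prod.ext rfl ?_))
      change linePath c (r, (q p).1.2) = linePath c (0, (q p).1.2)
      have h3 : (q p).1.2 = blockLin (baseLin (q p).1.2) c := h2
      rw [h3, linePath_blockLin, linePath_blockLin]
    exact (congrFun hconst 1).trans hRp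

/-- Near every frame of the base there are a continuous section to the positively oriented
vertical frames, and a transport of the points over vertical frames to points over this
section. -/
theorem exists_local_section {τ : TopSpinStructure B o} (hτ : ∀ i, τ.LiftsLocalAction i)
    (d₀ : N.Frame) : ∃ (U : Set N.Frame) (s : U → B.total.positiveFrames o)
      (T : {p : τ.P | ∃ d ∈ U, FrameOver B (τ.proj p) d} → τ.P),
      IsOpen U ∧ d₀ ∈ U ∧ Continuous s ∧ Continuous T ∧ (∀ d, FrameOver B (s d) d.1) ∧
      ∀ p, ∀ d : U, FrameOver B (τ.proj p.1) d.1 →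
        τ.proj (T p) = s d ∧ JoinedIn {r | FrameOver B (τ.proj r) d.1} p.1 (T p) ∧
        (τ.proj p.1 = s d → T p = p.1) := by
  obtain ⟨i, w₀, rfl⟩ := N.exists_mkFrame_eq d₀
  obtain ⟨W₀, hW₀, hw₀, hinj₀⟩ := N.exists_injOn_mkFrame w₀
  obtain ⟨c, hc, hsgn⟩ : ∃ (c : ℝ) (hc : c ≠ 0),
      o.sgn (B.total.mkFrame i (blockFrame B w₀ hc)) = 1 := by
    rcases Int.units_eq_one_or (o.sgn (B.total.mkFrame i (blockFrame B w₀ one_ne_zero)))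
      with h | h
    · exact ⟨1, one_ne_zero, h⟩
    · exact ⟨-1, neg_ne_zero.2 one_ne_zero, by
        rw [sgn_blockFrame_neg o w₀ one_ne_zero, h, neg_neg]⟩
  have hcont : Continuous fun w : N.LocalFrame i => B.total.mkFrame i (blockFrame B w hc) :=
    (B.total.continuous_mkFrame i).comp (continuous_blockFrame hc)
  let W := W₀ ∩ {w | o.sgn (B.total.mkFrame i (blockFrame B w hc)) = 1}
  have hW : IsOpen W := hW₀.inter ((o.locallyConstant.comp_continuous hcont).isOpen_fiber 1)
  have hinj : InjOn (N.mkFrame i) W := hinj₀.mono inter_subset_left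
  obtain ⟨T, hTc, hT⟩ := exists_transport (hτ i) hW hinj hc fun w hw => hw.2
  have hmk : IsOpenEmbedding fun w : W => N.mkFrame i w.1 :=
    .of_continuous_injective_isOpenMap ((N.continuous_mkFrame i).comp continuous_subtype_val)
      hinj.injective ((N.isOpenMap_mkFrame i).comp hW.isOpenMap_subtype_val)
  let E := hmk.toIsEmbedding.toHomeomorph
  have hE : ∀ d : range fun w : W => N.mkFrame i w.1, N.mkFrame i (E.symm d).1 = d.1 := fun d =>
    congrArg Subtype.val (E.apply_symm_apply d)
  refine ⟨range fun w : W => N.mkFrame i w.1,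
    fun d => ⟨B.total.mkFrame i (blockFrame B (E.symm d).1 hc), (E.symm d).2.2⟩,
    fun p => T ⟨p.1, by
      obtain ⟨d, ⟨w, rfl⟩, hp⟩ := p.2
      exact ⟨w.1, w.2, hp⟩⟩, hmk.isOpen_range, ⟨⟨w₀, hw₀, hsgn⟩, rfl⟩, ?_, ?_, ?_, ?_⟩
  · exact Continuous.subtype_mk (hcont.comp (continuous_subtype_val.comp E.symm.continuous)) _
  · exact hTc.comp (Continuous.subtype_mk continuous_subtype_val _)
  · intro d
    conv_rhs => rw [← hE d]
    exact frameOver_blockFrame _ hc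
  · intro p d hp
    rw [← hE d] at hp ⊢
    obtain ⟨h1, h2, h3⟩ := hT ⟨p.1, _, (E.symm d).2, hp⟩ _ (E.symm d).2 hp
    exact ⟨Subtype.ext h1, h2, fun h => h3 (congrArg Subtype.val h)⟩

end Transport
end OrbPin

namespace OrbPin
open Set Topology ChartFamily

/-! ### The pin structure of components of the fibres -/

section Descent

variable {n : ℕ} {X : Type u} [TopologicalSpace X] {N : Orbifold n X}
variable {Y : Type u} [TopologicalSpace Y] {B : CircleBundle N Y} {o : B.total.Orientation}

/-- The points of a topological spin structure over vertical frames. -/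
def VerticalPoints (τ : TopSpinStructure B o) : Type u :=
  {p : τ.P // (τ.proj p : B.total.Frame) ∈ verticalFrames B}

variable {τ : TopSpinStructure B o}

instance : TopologicalSpace (VerticalPoints τ) := inferInstanceAs (TopologicalSpace (Subtype _))

namespace VerticalPoints

/-- The frame of the base below a point over a vertical frame. -/
noncomputable def base (p : VerticalPoints τ) : N.Frame := baseFrame ⟨_, p.2⟩

theorem frameOver_base (p : VerticalPoints τ) : FrameOver B (τ.proj p.1) p.base :=
  frameOver_baseFrame (⟨_, p.2⟩ : verticalFrames B)

theorem continuous_base : Continuous (base (τ := τ)) :=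
  continuous_baseFrame.comp (Continuous.subtype_mk (continuous_subtype_val.comp
    (τ.isCoveringMap.continuous.comp continuous_subtype_val)) _)

/-- The action of `Pin⁻(n)` through `Spin(n + 1)`. -/
noncomputable def act (p : VerticalPoints τ) (a : PinMinus n) : VerticalPoints τ :=
  ⟨τ.act p.1 (pinToSpin n a), by
    rw [τ.proj_act]
    exact ⟨_, p.frameOver_base.act_pinToSpin a⟩⟩

theorem base_eq {p : VerticalPoints τ} {d : N.Frame} (h : FrameOver B (τ.proj p.1) d) :
    p.base = d := p.frameOver_base.unique h

theorem base_act (p : VerticalPoints τ) (a : PinMinus n) :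
    (p.act a).base = Frame.act (pinRho (negSq n) a) p.base :=
  base_eq (by
    change FrameOver B (τ.proj (τ.act p.1 (pinToSpin n a))) _
    rw [τ.proj_act]
    exact p.frameOver_base.act_pinToSpin a)

variable (τ) in
/-- Points are identified when they are joined by a path over the vertical frames over a single
frame of the base. -/
def setoid : Setoid (VerticalPoints τ) where
  r p q := JoinedIn {r | FrameOver B (τ.proj r) p.base} p.1 q.1
  iseqv :=
    { refl := fun p => .refl p.frameOver_base
      symm := by
        intro p q h
        rw [base_eq h.target_mem]
        exact h.symm
      trans := by
        intro p q r h h'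
        rw [base_eq h.target_mem] at h'
        exact h.trans h' }

end VerticalPoints

variable (τ) in
/-- The components of the points over the vertical frames over a single frame of the base. -/
abbrev Descent : Type u := Quotient (VerticalPoints.setoid τ)

namespace Descent

/-- The frame of the base below a component. -/
noncomputable def proj : Descent τ → N.Frame :=
  Quotient.lift VerticalPoints.base fun _ _ h => (VerticalPoints.base_eq h.target_mem).symm

theorem continuous_proj : Continuous (proj (τ := τ)) :=
  continuous_quot_lift _ VerticalPoints.continuous_base

/-- The action of `Pin⁻(n)` on components. -/
noncomputable def act (c : Descent τ) (a : PinMinus n) : Descent τ :=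
  Quotient.map (fun p : VerticalPoints τ => p.act a) (by
    intro p q h
    have h1 : Continuous fun r => τ.act r (pinToSpin n a) :=
      τ.continuous_act.comp (continuous_id.prodMk continuous_const)
    refine (JoinedIn.map h h1).mono ?_
    rintro _ ⟨r, hr, rfl⟩
    rw [Set.mem_ofPred_eq, τ.proj_act, VerticalPoints.base_act]
    exact FrameOver.act_pinToSpin hr a) c

/-- Near every frame of the base, the components correspond to the points of the spin structure
over a continuous section to the vertical frames. -/
theorem exists_local_lift (hτ : ∀ i, τ.LiftsLocalAction i) (d₀ : N.Frame) :
    ∃ (U : Set N.Frame) (s : U → B.total.positiveFrames o)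
      (F : proj (τ := τ) ⁻¹' U → τ.P), IsOpen U ∧ d₀ ∈ U ∧ Continuous s ∧ Continuous F ∧
      (∀ c, τ.proj (F c) = s ⟨_, c.2⟩) ∧
      (∀ c, ∃ h, Quotient.mk (VerticalPoints.setoid τ) ⟨F c, h⟩ = c.1) ∧
      (∀ d, FrameOver B (s d) d.1) ∧
      ∀ p : VerticalPoints τ, ∀ hp : p.base ∈ U, τ.proj p.1 = s ⟨_, hp⟩ →
        F ⟨Quotient.mk _ p, hp⟩ = p.1 := by
  obtain ⟨U, s, T, hU, hd₀, hs, hTc, hsd, hT⟩ := exists_local_section hτ d₀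
  -- the transport is constant along the paths that define the components
  have hinv : ∀ p q : VerticalPoints τ, ∀ hp : p.base ∈ U, ∀ hq : q.base ∈ U,
      VerticalPoints.setoid τ p q →
        T ⟨p.1, _, hp, p.frameOver_base⟩ = T ⟨q.1, _, hq, q.frameOver_base⟩ := by
    rintro ⟨p, hpv⟩ ⟨q, hqv⟩ hp hq ⟨γ, hγ⟩
    let d : U := ⟨_, hp⟩
    let f : unitInterval → τ.P := fun r => T ⟨γ r, _, d.2, hγ r⟩
    have hf : Continuous f := hTc.comp (Continuous.subtype_mk γ.continuous _)
    have hconst : f = fun _ => f 0 := by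
      refine τ.isCoveringMap.eq_of_comp_eq hf continuous_const ?_ 0 rfl
      funext r
      exact (hT ⟨γ r, _, d.2, hγ r⟩ d (hγ r)).1.trans
        (hT ⟨γ 0, _, d.2, hγ 0⟩ d (hγ 0)).1.symm
    have h1 := congrFun hconst 1
    have e0 : f 0 = T ⟨p, _, hp, VerticalPoints.frameOver_base ⟨p, hpv⟩⟩ :=
      congrArg T (Subtype.ext γ.source)
    have e1 : f 1 = T ⟨q, _, hq, VerticalPoints.frameOver_base ⟨q, hqv⟩⟩ :=
      congrArg T (Subtype.ext γ.target)
    exact e0.symm.trans (h1.symm.trans e1)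
  have hex : ∀ c : proj (τ := τ) ⁻¹' U, ∃ p : VerticalPoints τ,
      Quotient.mk (VerticalPoints.setoid τ) p = c.1 := fun c => Quotient.mk_surjective c.1
  choose r hr using hex
  have hrU : ∀ c, (r c).base ∈ U := fun c => by
    have h1 : (r c).base = proj c.1 := by rw [← hr c]; rfl
    rw [h1]
    exact c.2
  let F : proj (τ := τ) ⁻¹' U → τ.P := fun c => T ⟨(r c).1, _, hrU c, (r c).frameOver_base⟩
  have hF : ∀ p : VerticalPoints τ, ∀ hp : p.base ∈ U,
      F ⟨Quotient.mk _ p, hp⟩ = T ⟨p.1, _, hp, p.frameOver_base⟩ := fun p hp =>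
    hinv _ _ (hrU _) hp (Quotient.exact (hr ⟨Quotient.mk _ p, hp⟩))
  refine ⟨U, s, F, hU, hd₀, hs, ?_, fun c => ?_, fun c => ?_, hsd, fun p hp h => ?_⟩
  · have hq := (isQuotientMap_quotient_mk' (s := VerticalPoints.setoid τ)).restrictPreimage_isOpen
      (hU.preimage continuous_proj)
    rw [hq.continuous_iff]
    have h0 : Continuous fun p : (VerticalPoints.base (τ := τ)) ⁻¹' U => p.1.1 :=
      continuous_subtype_val.comp continuous_subtype_val
    have h1 : Continuous fun p : (VerticalPoints.base (τ := τ)) ⁻¹' U =>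
        T ⟨p.1.1, _, p.2, p.1.frameOver_base⟩ := hTc.comp (Continuous.subtype_mk h0 _)
    exact h1.congr fun p => (hF p.1 p.2).symm
  · refine (hT ⟨_, _, hrU c, (r c).frameOver_base⟩ ⟨_, hrU c⟩ (r c).frameOver_base).1.trans
      (congrArg s (Subtype.ext ?_))
    exact congrArg proj (hr c)
  · have h1 := (hT ⟨_, _, hrU c, (r c).frameOver_base⟩ ⟨_, hrU c⟩ (r c).frameOver_base).2.1
    refine ⟨⟨_, h1.target_mem⟩, Eq.trans (Quotient.sound ?_) (hr c)⟩
    exact (VerticalPoints.setoid τ).symm h1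
  · rw [hF]
    exact (hT ⟨_, _, hp, p.frameOver_base⟩ ⟨_, hp⟩ p.frameOver_base).2.2 h

theorem isEvenlyCovered (hτ : ∀ i, τ.LiftsLocalAction i) (d₀ : N.Frame) :
    ∃ e, IsEvenlyCovered (proj (τ := τ)) d₀ (τ.proj ⁻¹' {e}) := by
  obtain ⟨U, s, F, hU, hd₀, hs, hFc, hF, hmk, hsd, hFmk⟩ := exists_local_lift hτ d₀
  have hb : ∀ z : {z : U × τ.P // τ.proj z.2 = s z.1}, FrameOver B (τ.proj z.1.2) z.1.1.1 :=
    fun z => by rw [z.2]; exact hsd _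
  have hbase : ∀ z : {z : U × τ.P // τ.proj z.2 = s z.1},
      VerticalPoints.base (τ := τ) ⟨z.1.2, _, hb z⟩ = z.1.1.1 := fun z =>
    VerticalPoints.base_eq (p := ⟨z.1.2, _, hb z⟩) (hb z)
  refine ⟨s ⟨d₀, hd₀⟩, isEvenlyCovered_of_pullback τ.isCoveringMap continuous_proj hU hd₀ s F
    (fun z => Quotient.mk _ ⟨z.1.2, _, hb z⟩) hs hFc ?_ hF ?_ ?_ ?_⟩
  · exact continuous_quotient_mk'.comp (Continuous.subtype_mk
      (continuous_snd.comp continuous_subtype_val) _)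
  · exact hbase
  · intro z
    refine hFmk ⟨z.1.2, _, hb z⟩ (by rw [hbase]; exact z.1.1.2) (z.2.trans ?_)
    exact congrArg s (Subtype.ext (hbase z).symm)
  · intro c
    obtain ⟨h, hc⟩ := hmk c
    exact hc

theorem continuous_act (hτ : ∀ i, τ.LiftsLocalAction i) :
    Continuous fun z : Descent τ × PinMinus n => z.1.act z.2 := by
  rw [continuous_iff_continuousAt]
  rintro ⟨c₀, a₀⟩
  obtain ⟨U, s, F, hU, hd₀, hs, hFc, hF, hmk, hsd, hFmk⟩ := exists_local_lift hτ c₀.proj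
  have hV : IsOpen ((proj (τ := τ) ⁻¹' U) ×ˢ (univ : Set (PinMinus n))) :=
    (hU.preimage continuous_proj).prod isOpen_univ
  refine ContinuousOn.continuousAt ?_ (hV.mem_nhds ⟨hd₀, trivial⟩)
  rw [continuousOn_iff_continuous_domRestrict]
  have hFv : ∀ c, (τ.proj (F c) : B.total.Frame) ∈ verticalFrames B := fun c => (hmk c).choose
  have h1 : Continuous fun z : ((proj (τ := τ) ⁻¹' U) ×ˢ (univ : Set (PinMinus n)) : Set _) =>
      Quotient.mk (VerticalPoints.setoid τ)
        (VerticalPoints.act ⟨F ⟨z.1.1, z.2.1⟩, hFv _⟩ z.1.2) := by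
    refine continuous_quotient_mk'.comp (Continuous.subtype_mk (τ.continuous_act.comp
      (Continuous.prodMk ?_ ?_)) _)
    · exact hFc.comp (Continuous.subtype_mk (continuous_fst.comp continuous_subtype_val) _)
    · exact continuous_pinToSpin.comp (continuous_snd.comp continuous_subtype_val)
  refine h1.congr fun z => ?_
  exact congrArg (fun c => act c z.1.2) (hmk ⟨z.1.1, z.2.1⟩).choose_spec

variable (τ) in
/-- If the local circle actions lift to a topological spin structure, the components of the points
over the vertical frames form a covering of the frames of the base. -/
noncomputable def frameCover (hτ : ∀ i, τ.LiftsLocalAction i) :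
    FrameCover N.toChartFamily (pinRho (negSq n)) univ where
  P := Descent τ
  act := act
  proj c := ⟨c.proj, trivial⟩
  act_one c := by
    obtain ⟨p, rfl⟩ := Quotient.mk_surjective c
    refine congrArg (Quotient.mk _) (Subtype.ext ?_)
    change τ.act p.1 (pinToSpin n 1) = p.1
    rw [map_one, τ.act_one]
  act_mul c a b := by
    obtain ⟨p, rfl⟩ := Quotient.mk_surjective c
    refine congrArg (Quotient.mk _) (Subtype.ext ?_)
    change τ.act p.1 (pinToSpin n (a * b)) = τ.act (τ.act p.1 (pinToSpin n a)) (pinToSpin n b)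
    rw [map_mul, τ.act_mul]
  continuous_act := continuous_act hτ
  isCoveringMap := by
    have h1 : IsCoveringMap (proj (τ := τ)) := fun d => by
      obtain ⟨e, he⟩ := isEvenlyCovered hτ d
      exact he.to_isEvenlyCovered_preimage
    exact h1.homeomorph_comp (Homeomorph.Set.univ _).symm
  two_sheeted d := by
    obtain ⟨e, he⟩ := isEvenlyCovered hτ d.1
    rw [← τ.two_sheeted e, Nat.card_congr he.fiberHomeomorph.toEquiv]
    refine Nat.card_congr (Equiv.setCongr ?_)
    ext c
    exact Subtype.ext_iff
  proj_act c a := by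
    obtain ⟨p, rfl⟩ := Quotient.mk_surjective c
    exact p.base_act a
  free_ker c a ha hc := by
    obtain ⟨U, s, F, hU, hd₀, hs, hFc, hF, hmk, hsd, hFmk⟩ := exists_local_lift hτ c.proj
    -- represent the component by a point over the section, which `a` maps to such a point
    obtain ⟨h, hp⟩ := hmk ⟨c, hd₀⟩
    set p : VerticalPoints τ := ⟨F ⟨c, hd₀⟩, h⟩
    have hpb : p.base = c.proj := congrArg proj hp
    have hab : (p.act a).base = c.proj := by
      rw [VerticalPoints.base_act, ha, Frame.act_one, hpb]
    have hpa : τ.proj (p.act a).1 = τ.proj p.1 := by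
      refine Subtype.ext ((τ.proj_act _ _).trans ?_)
      rw [spinRho_pinToSpin_eq_one ha, Frame.act_one]
    have h1 : F ⟨Quotient.mk _ (p.act a), show (p.act a).base ∈ U by rw [hab]; exact hd₀⟩ =
        (p.act a).1 := by
      refine hFmk _ _ (hpa.trans ((hF _).trans (congrArg s (Subtype.ext ?_))))
      exact hab.symm
    have h2 : Quotient.mk (VerticalPoints.setoid τ) (p.act a) = c := by
      refine Eq.trans ?_ hc
      exact congrArg (fun c => act c a) hp
    have h3 : τ.act p.1 (pinToSpin n a) = p.1 :=
      h1.symm.trans (congrArg F (Subtype.ext h2))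
    exact pinToSpin_injective ((τ.free_ker _ _ (spinRho_pinToSpin_eq_one ha) h3).trans
      (map_one _).symm)

end Descent

/-- Every projectable spin structure of the total space induces a pin structure of the base. -/
theorem IsProjectable.exists_pinMinusStructure {h : N.Metric} {g : B.total.Metric}
    {σ : SpinStructure B o g} (hσ : IsProjectable σ) :
    ∃ π : PinMinusStructure N h, AreInduced σ π := by
  obtain ⟨τ, hστ, hτ⟩ := hσ
  let π : PinMinusStructure N h := (Descent.frameCover τ hτ).restrict
    (N.orthonormalFrames (negSq n) h) (subset_univ _)
    fun e he a => act_mem_orthonormalFrames (norm_pinRho a) he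
  have hbase : ∀ p : {p : τ.P // ∃ d ∈ N.orthonormalFrames (negSq n) h,
      FrameOver B (τ.proj p) d}, (τ.proj p.1 : B.total.Frame) ∈ verticalFrames B := fun p => by
    obtain ⟨d, -, hd⟩ := p.2
    exact ⟨d, hd⟩
  have horth : ∀ p, VerticalPoints.base ⟨p.1, hbase p⟩ ∈ N.orthonormalFrames (negSq n) h := by
    intro p
    obtain ⟨d, hd, hpd⟩ := p.2
    rw [VerticalPoints.base_eq (p := ⟨p.1, hbase p⟩) hpd]
    exact hd
  refine ⟨π, τ, hστ, fun p => ⟨Quotient.mk _ ⟨p.1, hbase p⟩, horth p⟩, ?_, ?_, ?_⟩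
  · have h1 : Continuous fun p : {p : τ.P // ∃ d ∈ N.orthonormalFrames (negSq n) h,
        FrameOver B (τ.proj p) d} => (⟨p.1, hbase p⟩ : VerticalPoints τ) :=
      Continuous.subtype_mk continuous_subtype_val _
    have h2 : Continuous fun p => (Quotient.mk (VerticalPoints.setoid τ) ⟨p.1, hbase p⟩) :=
      continuous_quotient_mk'.comp h1
    exact Continuous.subtype_mk h2 _
  · intro p
    exact VerticalPoints.frameOver_base ⟨p.1, hbase p⟩
  · intro p q a hq
    refine Subtype.ext ?_
    exact congrArg (Quotient.mk _) (Subtype.ext hq)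

end Descent

/-- The zero-dimensional case is excluded by nonorientability: all frames are positive. -/
theorem dim_ne_zero {n : ℕ} {X : Type u} [TopologicalSpace X] {N : Orbifold n X}
    (hN : IsEmpty N.Orientation) : n ≠ 0 := by
  rintro rfl
  refine hN.false
    { sgn := fun _ => 1
      locallyConstant := .const 1
      sgn_act_of_pos := fun _ _ _ => rfl
      sgn_act_of_neg := fun L _ h => ?_ }
  rw [LinearMap.det_eq_one_of_subsingleton] at h
  exact absurd h (by norm_num)

end OrbPin

theorem proposition3p6 {n : ℕ} {X Y : Type u} [TopologicalSpace X] [T2Space X]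
    [ParacompactSpace X] [TopologicalSpace Y]
    (N : Orbifold n X) (h : N.Metric) (hN : IsEmpty N.Orientation) (B : CircleBundle N Y) :
    (∀ (o : B.total.Orientation) (g : B.total.Metric) (σ : SpinStructure B o g),
      IsProjectable σ → ∃ π : PinMinusStructure N h, AreInduced σ π) ∧
    (∀ (o : B.total.Orientation) (g : B.total.Metric) (π : PinMinusStructure N h),
      ∃ σ : SpinStructure B o g, AreInduced σ π) :=
  ⟨fun _ _ _ hσ => hσ.exists_pinMinusStructure,
    fun o g _ => exists_spinStructure (dim_ne_zero hN) o g⟩
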